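/- Consider the class $\bar{\mathcal L}_0$ of equations \[ u_t+uu_x=A^2(t,x)\,u_{xx}+\bigl(A^{11}(t)x+A^{10}(t)\bigr)u_x , \] parameterized by the tuple $\bar\theta=(A^{10},A^{11},A^2,Y^0,Y^1,Y^2)$ of smooth (locally defined) functions, where $A^2=A^2(t,x)\neq0$, the functions $A^{10},A^{11},Y^0,Y^1,Y^2$ do not depend on $x$, and \[ Y^0_t=A^{11},\qquad Y^1_t=\mathrm e^{Y^0},\qquad Y^2_t=A^{10}\mathrm e^{Y^0}. \] The equivalence groupoid of $\bar{\mathcal L}_0$ consists of the triples $(\bar\theta,\varphi,\tilde{\bar\theta})$, where $\varphi$ is a point transformation (local diffeomorphism of the space with coordinates $(t,x,u)$) that maps the equation with arbitrary elements $\bar\theta$ to the equation with arbitrary elements $\tilde{\bar\theta}$. A generalized equivalence transformation of $\bar{\mathcal L}_0$ is a local diffeomorphism of the space with coordinates $(t,x,u,A^{10},A^{11},A^2,Y^0,Y^1,Y^2)$, $A^2\neq0$, that for each $\bar\theta$ induces, wherever it is defined, an element of the equivalence groupoid with source $\bar\theta$. An effective generalized equivalence group of $\bar{\mathcal L}_0$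 is a minimal one among the groups of local transformations (pseudogroups) that consist of generalized equivalence transformations and generate the same set of admissible transformations as all generalized equivalence transformations do. (A triple $(\bar\theta,\varphi,\tilde{\bar\theta})$ is generated by a pseudogroup if around each point it is induced by an element of the pseudogroup.) Let $\breve G^\sim_0$ be constituted by the local diffeomorphisms that are locally of the form \begin{gather*} \tilde t=T,\quad \tilde x=T_t(c_1Y^1+c_0)\bigl(x+\mathrm e^{-Y^0/2}\breve X^0\bigr),\quad \tilde u=(c_1Y^1+c_0)u-c_1\mathrm e^{Y^0}x+c_2-c_1Y^2,\\ \tilde A^{10}=(c_1Y^1+c_0)\Bigl(A^{10}-\tfrac12\mathrm e^{-Y^0/2}\breve X^0A^{11}-\mathrm e^{-Y^0/2}\breve X^0_t\Bigr)+c_1\mathrm e^{Y^0/2}\breve X^0+c_2-c_1Y^2,\\ \tilde A^{11}=\frac1{T_t}\Bigl(A^{11}-\frac{T_{tt}}{T_t}-\frac{2c_1\mathrm e^{Y^0}}{c_1Y^1+c_0}\Bigr),\quad \tilde A^2=T_t(c_1Y^1+c_0)^2A^2,\\ \tilde Y^0=Y^0+\ln\frac{\delta}{T_t(c_1Y^1+c_0)^2},\quad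 \tilde Y^1=\frac{c_1'Y^1+c_0'}{c_1Y^1+c_0},\\ \tilde Y^2=\frac{\delta Y^2}{c_1Y^1+c_0}-\frac{\delta\breve X^0\mathrm e^{Y^0/2}}{c_1Y^1+c_0}+c_2\frac{c_1'Y^1+c_0'}{c_1Y^1+c_0}+c_3, \end{gather*} where $\delta:=c_1'c_0-c_0'c_1$, $T$ and $\breve X^0$ are arbitrary smooth functions of $t$, the $c$'s are arbitrary constants with $\delta T_t>0$, and the transformation is considered where $A^2\ne0$ and $c_1Y^1+c_0\neq0$. Then $\breve G^\sim_0$ is an effective generalized equivalence group of the class $\bar{\mathcal L}_0$: it is a pseudogroup of generalized equivalence transformations, it generates the entire equivalence groupoid of $\bar{\mathcal L}_0$, and no proper sub-pseudogroup of it generates this groupoid. -/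

import Mathlib

open Set Filter Topology
open scoped ContDiff

namespace SingularBurgers

/-! ### The spaces involved -/

/-- The space of the independent variables `(t, x)`. -/
abbrev Base := ℝ × ℝ

/-- The space of the variables `((t, x), u)`. -/
abbrev Pt := Base × ℝ

/-- The space of values `(A¹⁰, A¹¹, A², Y⁰, Y¹, Y²)` of the arbitrary elements. -/
abbrev Arb := ℝ × ℝ × ℝ × ℝ × ℝ × ℝ

/-- The space of `(t, x, u, A¹⁰, A¹¹, A², Y⁰, Y¹, Y²)`. -/
abbrev Ext := Pt × Arb

namespace Arb
/-- The coordinate `A¹⁰`. -/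
def a10 (a : Arb) : ℝ := a.1
/-- The coordinate `A¹¹`. -/
def a11 (a : Arb) : ℝ := a.2.1
/-- The coordinate `A²`. -/
def a2 (a : Arb) : ℝ := a.2.2.1
/-- The coordinate `Y⁰`. -/
def y0 (a : Arb) : ℝ := a.2.2.2.1
/-- The coordinate `Y¹`. -/
def y1 (a : Arb) : ℝ := a.2.2.2.2.1
/-- The coordinate `Y²`. -/
def y2 (a : Arb) : ℝ := a.2.2.2.2.2
end Arb

/-- The part of the extended space where the nonvanishing condition `A² ≠ 0` holds. -/
def extDomain : Set Ext := {z | Arb.a2 z.2 ≠ 0}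

theorem isOpen_extDomain : IsOpen extDomain := by
  have h : Continuous fun z : Ext => Arb.a2 z.2 := by
    unfold Arb.a2
    fun_prop
  exact isOpen_ne_fun h continuous_const

/-- Partial derivative with respect to `t`. -/
noncomputable def dt (F : Base → ℝ) (q : Base) : ℝ := deriv (fun s => F (s, q.2)) q.1

/-- Partial derivative with respect to `x`. -/
noncomputable def dx (F : Base → ℝ) (q : Base) : ℝ := deriv (fun y => F (q.1, y)) q.2

/-! ### The class of equations -/

/-- A value of the tuple of arbitrary elements `(A¹⁰, A¹¹, A², Y⁰, Y¹, Y²)` of the class: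
smooth functions on an open set of `(t, x)` with `A² ≠ 0`, all of them except `A²` being
independent of `x`, and with `Y⁰_t = A¹¹`, `Y¹_t = exp Y⁰`, `Y²_t = A¹⁰ exp Y⁰`. -/
structure ArbTuple where
  dom : Set Base
  isOpen_dom : IsOpen dom
  val : Base → Arb
  smooth : ContDiffOn ℝ ∞ val dom
  a2_ne : ∀ q ∈ dom, (val q).a2 ≠ 0
  a10_x : ∀ q ∈ dom, dx (fun r => (val r).a10) q = 0
  a11_x : ∀ q ∈ dom, dx (fun r => (val r).a11) q = 0
  y0_x : ∀ q ∈ dom, dx (fun r => (val r).y0) q = 0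
  y1_x : ∀ q ∈ dom, dx (fun r => (val r).y1) q = 0
  y2_x : ∀ q ∈ dom, dx (fun r => (val r).y2) q = 0
  y0_t : ∀ q ∈ dom, dt (fun r => (val r).y0) q = (val q).a11
  y1_t : ∀ q ∈ dom, dt (fun r => (val r).y1) q = Real.exp (val q).y0
  y2_t : ∀ q ∈ dom, dt (fun r => (val r).y2) q = (val q).a10 * Real.exp (val q).y0

/-- The function `f` satisfies at the point `q = (t, x)` the equation
`u_t + u u_x = A² u_xx + (A¹¹ x + A¹⁰) u_x` of the class with arbitrary elements `θ`. -/
def SatisfiesAt (θ : ArbTuple) (f : Base → ℝ) (q : Base) : Prop :=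
  dt f q + f q * dx f q =
    (θ.val q).a2 * dx (dx f) q + ((θ.val q).a11 * q.2 + (θ.val q).a10) * dx f q

/-! ### Point transformations and the equivalence groupoid -/

/-- Near the point of the graph of `f` above `q`, the local transformation `φ` of the space of
`(t, x, u)` maps the graph of `f` onto the graph of `g` (as germs of surfaces). -/
def MapsGraphAt (φ : OpenPartialHomeomorph Pt Pt) (f g : Base → ℝ) (q : Base) : Prop :=
  (∀ᶠ r in 𝓝 q, (φ (r, f r)).2 = g (φ (r, f r)).1) ∧
  (∀ᶠ r in 𝓝 (φ (q, f q)).1, (φ.symm (r, g r)).2 = f (φ.symm (r, g r)).1)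

/-- The local transformation `φ` maps the equation with arbitrary elements `θ` to the one with
arbitrary elements `θ'`: its second prolongation maps the submanifold of the second-order jet
space defined by the first equation to the one defined by the second. The prolongation is
expressed through functions representing jets: whenever `φ` maps the graph of `f` onto the
graph of `g` near some point, the 2-jet of `f` at this point satisfies the first equation if and
only if the 2-jet of `g` at the image point satisfies the second one. -/
def MapsEquation (θ : ArbTuple) (φ : OpenPartialHomeomorph Pt Pt) (θ' : ArbTuple) : Prop :=
  ∀ (q : Base) (f g : Base → ℝ), (q, f q) ∈ φ.source →
    ContDiffAt ℝ 2 f q → ContDiffAt ℝ 2 g (φ (q, f q)).1 → MapsGraphAt φ f g q →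
    (SatisfiesAt θ f q ↔ SatisfiesAt θ' g (φ (q, f q)).1)

/-- Triples (source arbitrary elements, local transformation, target arbitrary elements). -/
abbrev Triple := ArbTuple × OpenPartialHomeomorph Pt Pt × ArbTuple

/-- The source and the target of `φ` lie over the domains of the arbitrary elements. -/
def Compatible (θ : ArbTuple) (φ : OpenPartialHomeomorph Pt Pt) (θ' : ArbTuple) : Prop :=
  (∀ p ∈ φ.source, p.1 ∈ θ.dom) ∧ (∀ p ∈ φ.target, p.1 ∈ θ'.dom)

/-- The equivalence groupoid of the class: the set of its admissible transformations
`(θ, φ, θ')`, where `φ` is a point transformation (local diffeomorphism of the space of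
`(t, x, u)`) mapping the equation for `θ` to the equation for `θ'`. -/
def equivalenceGroupoid : Set Triple :=
  {τ | Compatible τ.1 τ.2.1 τ.2.2 ∧
    ContDiffOn ℝ ∞ τ.2.1 τ.2.1.source ∧ ContDiffOn ℝ ∞ τ.2.1.symm τ.2.1.target ∧
    MapsEquation τ.1 τ.2.1 τ.2.2}

/-! ### Generalized equivalence transformations -/

/-- Near the point `p`, the transformation `e` of the extended space induces the transformation
`φ` of `(t, x, u)` when the arbitrary elements `θ` are inserted, and it transforms `θ` to `θ'`. -/
def InducesAt (e : OpenPartialHomeomorph Ext Ext) (θ : ArbTuple)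
    (φ : OpenPartialHomeomorph Pt Pt) (θ' : ArbTuple) (p : Pt) : Prop :=
  (p, θ.val p.1) ∈ e.source ∧
    ∀ᶠ r in 𝓝 p, e (r, θ.val r.1) = (φ r, θ'.val (φ r).1)

/-- Generalized equivalence transformations of the class: local diffeomorphisms of the space of
`(t, x, u, A¹⁰, A¹¹, A², Y⁰, Y¹, Y²)` with `A² ≠ 0` that, for each value `θ` of the arbitrary
elements, induce admissible transformations with source `θ` wherever they are defined. -/
def generalizedEquivalences : Set (OpenPartialHomeomorph Ext Ext) :=
  {e | e.source ⊆ extDomain ∧ e.target ⊆ extDomain ∧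
    ContDiffOn ℝ ∞ e e.source ∧ ContDiffOn ℝ ∞ e.symm e.target ∧
    ∀ (θ : ArbTuple) (p : Pt), p.1 ∈ θ.dom → (p, θ.val p.1) ∈ e.source →
      ∃ (φ : OpenPartialHomeomorph Pt Pt) (θ' : ArbTuple),
        (θ, φ, θ') ∈ equivalenceGroupoid ∧ p ∈ φ.source ∧ InducesAt e θ φ θ' p}

/-- `𝒢` is a group of local transformations (a pseudogroup) on the open set `M`. -/
structure IsPseudogroupOn {Z : Type*} [TopologicalSpace Z] (M : Set Z)
    (𝒢 : Set (OpenPartialHomeomorph Z Z)) : Prop where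
  source_subset : ∀ e ∈ 𝒢, e.source ⊆ M
  target_subset : ∀ e ∈ 𝒢, e.target ⊆ M
  id_mem : ∀ hM : IsOpen M, OpenPartialHomeomorph.ofSet M hM ∈ 𝒢
  trans_mem : ∀ e ∈ 𝒢, ∀ e' ∈ 𝒢, e.trans e' ∈ 𝒢
  symm_mem : ∀ e ∈ 𝒢, e.symm ∈ 𝒢
  restr_mem : ∀ e ∈ 𝒢, ∀ s : Set Z, IsOpen s → e.restr s ∈ 𝒢
  eqOnSource_mem : ∀ e ∈ 𝒢, ∀ e' : OpenPartialHomeomorph Z Z, e' ≈ e → e' ∈ 𝒢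
  locality : ∀ e : OpenPartialHomeomorph Z Z,
    (∀ z ∈ e.source, ∃ s : Set Z, IsOpen s ∧ z ∈ s ∧ e.restr s ∈ 𝒢) → e ∈ 𝒢

/-- The set of triples `(θ, φ, θ')` generated by a set `𝒢` of transformations of the extended
space: around each point, the triple is induced by an element of `𝒢`. -/
def generated (𝒢 : Set (OpenPartialHomeomorph Ext Ext)) : Set Triple :=
  {τ | Compatible τ.1 τ.2.1 τ.2.2 ∧
    ∀ p ∈ τ.2.1.source, ∃ e ∈ 𝒢, InducesAt e τ.1 τ.2.1 τ.2.2 p}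

/-- `𝒢` is a subgroup of the generalized equivalence group that generates the same set of
admissible transformations as the entire generalized equivalence group. -/
structure IsGeneratingSubgroup (𝒢 : Set (OpenPartialHomeomorph Ext Ext)) : Prop where
  isPseudogroup : IsPseudogroupOn extDomain 𝒢
  subset : 𝒢 ⊆ generalizedEquivalences
  generated_eq : generated 𝒢 = generated generalizedEquivalences

/-- An effective generalized equivalence group is a minimal subgroup of the generalized
equivalence group that generates the same groupoid as the entire group. -/
def IsEffectiveGeneralizedEquivalenceGroup (𝒢 : Set (OpenPartialHomeomorph Ext Ext)) : Prop :=
  Minimal IsGeneratingSubgroup 𝒢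

/-! ### The explicit family of transformations -/

/-- The parameters of the family: functions `T`, `X` of `t` and constants
(`d0`, `d1` stand for `c₀'`, `c₁'`). -/
structure Params where
  T : ℝ → ℝ
  X : ℝ → ℝ
  c0 : ℝ
  c1 : ℝ
  c2 : ℝ
  c3 : ℝ
  d0 : ℝ
  d1 : ℝ

namespace Params

/-- `δ = c₁' c₀ - c₀' c₁`. -/
def delta (P : Params) : ℝ := P.d1 * P.c0 - P.d0 * P.c1

/-- The transformation of `(t, x, u, A¹⁰, A¹¹, A², Y⁰, Y¹, Y²)` with the given parameters. -/
noncomputable def toMap (P : Params) (z : Ext) : Ext :=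
  let t := z.1.1.1
  let x := z.1.1.2
  let u := z.1.2
  let A10 := z.2.a10
  let A11 := z.2.a11
  let A2 := z.2.a2
  let Y0 := z.2.y0
  let Y1 := z.2.y1
  let Y2 := z.2.y2
  let Tt := deriv P.T t
  let Ttt := deriv (deriv P.T) t
  let X := P.X t
  let Xt := deriv P.X t
  let W := P.c1 * Y1 + P.c0
  let N := P.d1 * Y1 + P.d0
  (((P.T t,
     Tt * W * (x + Real.exp (-Y0 / 2) * X)),
     W * u - P.c1 * Real.exp Y0 * x + P.c2 - P.c1 * Y2),
    W * (A10 - 1 / 2 * Real.exp (-Y0 / 2) * X * A11 - Real.exp (-Y0 / 2) * Xt)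
      + P.c1 * Real.exp (Y0 / 2) * X + P.c2 - P.c1 * Y2,
    1 / Tt * (A11 - Ttt / Tt - 2 * P.c1 * Real.exp Y0 / W),
    Tt * W ^ 2 * A2,
    Y0 + Real.log (P.delta / (Tt * W ^ 2)),
    N / W,
    P.delta * Y2 / W - P.delta * X * Real.exp (Y0 / 2) / W + P.c2 * (N / W) + P.c3)

/-- The local transformation `e` is given on its whole source by the parameters `P`, where `T` and
`X` are smooth on an open set of values of `t` with `δ T_t > 0`, and `c₁ Y¹ + c₀ ≠ 0`. -/
def Represents (P : Params) (e : OpenPartialHomeomorph Ext Ext) : Prop :=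
  ∃ I : Set ℝ, IsOpen I ∧ ContDiffOn ℝ ∞ P.T I ∧ ContDiffOn ℝ ∞ P.X I ∧
    (∀ t ∈ I, 0 < P.delta * deriv P.T t) ∧
    ∀ z ∈ e.source, z ∈ extDomain ∧ z.1.1.1 ∈ I ∧ P.c1 * z.2.y1 + P.c0 ≠ 0 ∧ e z = P.toMap z

end Params

/-- The group of local transformations constituted by the explicit family: a local
homeomorphism belongs to it if around each point it is given by the formulas of the family. -/
def breveGroup : Set (OpenPartialHomeomorph Ext Ext) :=
  {e | ∀ z ∈ e.source, ∃ s : Set Ext, IsOpen s ∧ z ∈ s ∧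
    ∃ P : Params, P.Represents (e.restr s)}

end SingularBurgers

/-! The theorem splits into three claims: every admissible transformation is locally induced by the
family, the family consists of generalized equivalences and is closed under the pseudogroup
operations, and its members are rigid.

Completeness. The equation constrains `u_xx` by lower-order jets but says nothing about `u_tt`. Two
jets of source solutions differing only in `u_tt` have images with equal `g`, `g_t`, `g_x`, hence
equal `g_xx`, and this prevents `x` and `u` from entering the `t`-component
(`compT_total_x_eq_zero`, `compT_derivs_eq_zero`). Varying `u_xx` and then `u_x` shows that the
`x`-component is free of `u` and the `u`-component is affine in `u` (`a2_relation`,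
`pU_compX_eq_zero`, `determining_equations`). Splitting the remaining equations in `u` and `x`
leaves `x̃ = T_t w x + k`, `ũ = w u + b - w_t x` with `w_tt = A¹¹ w_t` and `b_t = -A¹⁰ w_t`
(`solve_determining_equations`). The `Y`s are precisely what integrates this system: `w = c₁Y¹ +
c₀`, `w_t = c₁ exp Y⁰`, `b = c₂ - c₁Y²`. The constants `δ`, `c₀'`, `c₁'`, `c₃` absorb the
integration constants of the target `Y`s (`exists_params`), so
`equivalenceGroupoid_subset_generated` follows.

Soundness. Under a member of the family the defects of the two equations are proportional with
nonzero factors (`satisfiesAt_iff_of_toMap`), and the transformed arbitrary elements again satisfy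
the differential constraints (`hasDerivAt_arbCurve`, `Admissible.exists_induced`). Composition and
inversion are explicit on parameters; the constants act on `Y¹` by Möbius transformations with
determinant `δ`.

Minimality. Some tuple of arbitrary elements passes through each point (`exists_arbTuple`), and two
members that agree along the lift of a single tuple have the same parameters near that time, hence
the same germ in the extended space (`eventuallyEq_toMap`). A sub-pseudogroup generating the
groupoid therefore contains every germ of the family, and so the whole family. -/

namespace SingularBurgers

/-! ### Partial derivatives -/

/-- The partial derivative of a function of `(t, x, u)` with respect to `t`. -/
noncomputable def pT (F : Pt → ℝ) (p : Pt) : ℝ := fderiv ℝ F p ((1, 0), 0)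

/-- The partial derivative of a function of `(t, x, u)` with respect to `x`. -/
noncomputable def pX (F : Pt → ℝ) (p : Pt) : ℝ := fderiv ℝ F p ((0, 1), 0)

/-- The partial derivative of a function of `(t, x, u)` with respect to `u`. -/
noncomputable def pU (F : Pt → ℝ) (p : Pt) : ℝ := fderiv ℝ F p ((0, 0), 1)

theorem fderiv_pt_apply (F : Pt → ℝ) (p : Pt) (a b c : ℝ) :
    fderiv ℝ F p ((a, b), c) = pT F p * a + pX F p * b + pU F p * c := by
  have h : (((a, b), c) : Pt) = a • ((1, 0), 0) + b • ((0, 1), 0) + c • ((0, 0), 1) := by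
    ext <;> simp
  rw [h, map_add, map_add, map_smul, map_smul, map_smul, pT, pX, pU]
  simp only [smul_eq_mul]
  ring

theorem hasDerivAt_comp_pt {F : Pt → ℝ} {a b c : ℝ → ℝ} {a' b' c' s : ℝ}
    (hF : DifferentiableAt ℝ F ((a s, b s), c s)) (ha : HasDerivAt a a' s)
    (hb : HasDerivAt b b' s) (hc : HasDerivAt c c' s) :
    HasDerivAt (fun r => F ((a r, b r), c r))
      (pT F ((a s, b s), c s) * a' + pX F ((a s, b s), c s) * b'
        + pU F ((a s, b s), c s) * c') s := by
  rw [← fderiv_pt_apply]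
  exact hF.hasFDerivAt.comp_hasDerivAt s ((ha.prodMk hb).prodMk hc)

theorem hasDerivAt_pT {F : Pt → ℝ} {t x u : ℝ} (hF : DifferentiableAt ℝ F ((t, x), u)) :
    HasDerivAt (fun s => F ((s, x), u)) (pT F ((t, x), u)) t := by
  simpa using hasDerivAt_comp_pt (a := id) (b := fun _ => x) (c := fun _ => u) hF
    (hasDerivAt_id t) (hasDerivAt_const t x) (hasDerivAt_const t u)

theorem hasDerivAt_pX {F : Pt → ℝ} {t x u : ℝ} (hF : DifferentiableAt ℝ F ((t, x), u)) :
    HasDerivAt (fun s => F ((t, s), u)) (pX F ((t, x), u)) x := by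
  simpa using hasDerivAt_comp_pt (b := id) (a := fun _ => t) (c := fun _ => u) hF
    (hasDerivAt_const x t) (hasDerivAt_id x) (hasDerivAt_const x u)

theorem hasDerivAt_pU {F : Pt → ℝ} {t x u : ℝ} (hF : DifferentiableAt ℝ F ((t, x), u)) :
    HasDerivAt (fun s => F ((t, x), s)) (pU F ((t, x), u)) u := by
  simpa using hasDerivAt_comp_pt (c := id) (a := fun _ => t) (b := fun _ => x) hF
    (hasDerivAt_const u t) (hasDerivAt_const u x) (hasDerivAt_id u)

theorem fderiv_base_apply (F : Base → ℝ) {q : Base} (hF : DifferentiableAt ℝ F q) (a b : ℝ) :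
    fderiv ℝ F q (a, b) = dt F q * a + dx F q * b := by
  have h : ((a, b) : Base) = a • (1, 0) + b • (0, 1) := by ext <;> simp
  have h1 : dt F q = fderiv ℝ F q (1, 0) :=
    (hF.hasFDerivAt.comp_hasDerivAt (f := fun s => (s, q.2)) q.1
      ((hasDerivAt_id q.1).prodMk (hasDerivAt_const q.1 q.2))).deriv
  have h2 : dx F q = fderiv ℝ F q (0, 1) :=
    (hF.hasFDerivAt.comp_hasDerivAt (f := fun s => (q.1, s)) q.2
      ((hasDerivAt_const q.2 q.1).prodMk (hasDerivAt_id q.2))).deriv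
  rw [h, map_add, map_smul, map_smul, h1, h2]
  simp only [smul_eq_mul]
  ring

theorem hasDerivAt_comp_base {F : Base → ℝ} {a b : ℝ → ℝ} {a' b' s : ℝ}
    (hF : DifferentiableAt ℝ F (a s, b s)) (ha : HasDerivAt a a' s) (hb : HasDerivAt b b' s) :
    HasDerivAt (fun r => F (a r, b r)) (dt F (a s, b s) * a' + dx F (a s, b s) * b') s := by
  rw [← fderiv_base_apply F hF]
  exact hF.hasFDerivAt.comp_hasDerivAt s (ha.prodMk hb)

theorem hasDerivAt_dt {F : Base → ℝ} {t x : ℝ} (hF : DifferentiableAt ℝ F (t, x)) :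
    HasDerivAt (fun s => F (s, x)) (dt F (t, x)) t := by
  simpa using hasDerivAt_comp_base (a := id) (b := fun _ => x) hF
    (hasDerivAt_id t) (hasDerivAt_const t x)

theorem hasDerivAt_dx {F : Base → ℝ} {t x : ℝ} (hF : DifferentiableAt ℝ F (t, x)) :
    HasDerivAt (fun s => F (t, s)) (dx F (t, x)) x := by
  simpa using hasDerivAt_comp_base (b := id) (a := fun _ => t) hF
    (hasDerivAt_const x t) (hasDerivAt_id x)

theorem ContDiffOn.pX {F : Pt → ℝ} {U : Set Pt} (hU : IsOpen U) (hF : ContDiffOn ℝ ∞ F U) :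
    ContDiffOn ℝ ∞ (pX F) U :=
  (hF.fderiv_of_isOpen hU (by simp)).clm_apply contDiffOn_const

theorem ContDiffOn.pU {F : Pt → ℝ} {U : Set Pt} (hU : IsOpen U) (hF : ContDiffOn ℝ ∞ F U) :
    ContDiffOn ℝ ∞ (pU F) U :=
  (hF.fderiv_of_isOpen hU (by simp)).clm_apply contDiffOn_const

theorem differentiableAt_of_contDiffOn {E G : Type*} [NormedAddCommGroup E] [NormedSpace ℝ E]
    [NormedAddCommGroup G] [NormedSpace ℝ G] {F : E → G} {U : Set E} (hU : IsOpen U)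
    (hF : ContDiffOn ℝ ∞ F U) {p : E} (hp : p ∈ U) : DifferentiableAt ℝ F p :=
  (hF.contDiffAt (hU.mem_nhds hp)).differentiableAt (by simp)

theorem two_le_infty : (2 : WithTop ℕ∞) ≤ ∞ := WithTop.coe_le_coe.2 (le_top : (2 : ℕ∞) ≤ ⊤)

theorem pU_pX_comm {F : Pt → ℝ} {U : Set Pt} (hU : IsOpen U) (hF : ContDiffOn ℝ ∞ F U)
    {p : Pt} (hp : p ∈ U) : pU (pX F) p = pX (pU F) p := by
  have h := (hF.contDiffAt (hU.mem_nhds hp)).isSymmSndFDerivAt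
    (by simpa using two_le_infty)
  have hd : DifferentiableAt ℝ (fderiv ℝ F) p :=
    differentiableAt_of_contDiffOn hU (hF.fderiv_of_isOpen (m := ∞) hU (by simp)) hp
  have e : ∀ v w : Pt, fderiv ℝ (fun r => fderiv ℝ F r v) p w = fderiv ℝ (fderiv ℝ F) p w v := by
    intro v w
    rw [fderiv_clm_apply hd (differentiableAt_const v)]
    simp
  unfold pU pX
  rw [e, e]
  exact h.eq _ _

theorem contDiffAt_dx {f : Base → ℝ} {q : Base} (hf : ContDiffAt ℝ 2 f q) :
    ContDiffAt ℝ 1 (dx f) q := by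
  have h1 : ContDiffAt ℝ 1 (fun r => fderiv ℝ f r (0, 1)) q :=
    (hf.fderiv_right (m := 1) (by norm_num)).clm_apply contDiffAt_const
  refine h1.congr_of_eventuallyEq ?_
  filter_upwards [hf.eventually (by simp)] with r hr
  rw [fderiv_base_apply f (hr.differentiableAt (by simp))]
  simp

/-- The relations between the 2-jets of two functions whose graphs correspond to each other under a
transformation `(t, x, u) ↦ (T(t), ξ(t, x, u), η(t, x, u))`. -/
theorem jet_relations {U : Set Pt} (hU : IsOpen U) {ξ η : Pt → ℝ} (hξ : ContDiffOn ℝ ∞ ξ U)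
    (hη : ContDiffOn ℝ ∞ η U) {T : ℝ → ℝ} {t x T' : ℝ} (hT : HasDerivAt T T' t)
    {f g : Base → ℝ} {p : Pt} (hp : p = ((t, x), f (t, x))) (hpU : p ∈ U)
    (hf : ContDiffAt ℝ 2 f (t, x)) {q' : Base} (hq' : q' = (T t, ξ p)) (hg : ContDiffAt ℝ 2 g q')
    (heq : ∀ᶠ r in 𝓝 ((t, x) : Base), η (r, f r) = g (T r.1, ξ (r, f r))) :
    pT η p + pU η p * dt f (t, x) =
        dt g q' * T' + dx g q' * (pT ξ p + pU ξ p * dt f (t, x)) ∧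
    pX η p + pU η p * dx f (t, x) = dx g q' * (pX ξ p + pU ξ p * dx f (t, x)) ∧
    pX (pX η) p + 2 * pX (pU η) p * dx f (t, x) + pU (pU η) p * dx f (t, x) ^ 2
        + pU η p * dx (dx f) (t, x) =
      dx (dx g) q' * (pX ξ p + pU ξ p * dx f (t, x)) ^ 2
      + dx g q' * (pX (pX ξ) p + 2 * pX (pU ξ) p * dx f (t, x)
        + pU (pU ξ) p * dx f (t, x) ^ 2 + pU ξ p * dx (dx f) (t, x)) := by
  subst hp hq'
  have hfd : DifferentiableAt ℝ f (t, x) := hf.differentiableAt (by simp)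
  have hgd := hg.differentiableAt (by simp)
  have dξ : ∀ {r}, r ∈ U → DifferentiableAt ℝ ξ r := differentiableAt_of_contDiffOn hU hξ
  have dη : ∀ {r}, r ∈ U → DifferentiableAt ℝ η r := differentiableAt_of_contDiffOn hU hη
  have hline : Tendsto (fun s : ℝ => ((t, s) : Base)) (𝓝 x) (𝓝 (t, x)) :=
    (by fun_prop : Continuous fun s : ℝ => ((t, s) : Base)).tendsto x
  have hgraph : ContinuousAt (fun r : Base => ((r, f r) : Pt)) (t, x) :=
    continuousAt_id.prodMk hf.continuousAt
  have hUev : ∀ᶠ r in 𝓝 ((t, x) : Base), ((r, f r) : Pt) ∈ U :=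
    hgraph.eventually (hU.mem_nhds hpU)
  refine ⟨?_, ?_⟩
  · have hlt : Tendsto (fun s : ℝ => ((s, x) : Base)) (𝓝 t) (𝓝 (t, x)) :=
      (by fun_prop : Continuous fun s : ℝ => ((s, x) : Base)).tendsto t
    have h1 := hasDerivAt_comp_pt (b := fun _ => x) (a := id) (c := fun s => f (s, x)) (s := t)
      (dη hpU) (hasDerivAt_id t) (hasDerivAt_const t x) (hasDerivAt_dt hfd)
    have h2 := hasDerivAt_comp_pt (b := fun _ => x) (a := id) (c := fun s => f (s, x)) (s := t)
      (dξ hpU) (hasDerivAt_id t) (hasDerivAt_const t x) (hasDerivAt_dt hfd)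
    have h3 := hasDerivAt_comp_base (F := g) hgd hT h2
    have h4 := h1.unique (h3.congr_of_eventuallyEq (hlt.eventually heq))
    simpa using h4
  -- The first `x`-derivative relation is kept as an identity near `x`, so that it can be
  -- differentiated once more. Only the line with this fixed `t` is needed, and there `T` is
  -- constant.
  · have key : ∀ᶠ r in 𝓝 ((t, x) : Base), r.1 = t →
        pX η (r, f r) + pU η (r, f r) * dx f r =
          dx g (T t, ξ (r, f r)) * (pX ξ (r, f r) + pU ξ (r, f r) * dx f r) := by
      have hg' : ∀ᶠ r in 𝓝 ((t, x) : Base), r.1 = t →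
          DifferentiableAt ℝ g (T t, ξ (r, f r)) := by
        have hc : ContinuousAt (fun r : Base => ((T t, ξ (r, f r)) : Base)) (t, x) :=
          continuousAt_const.prodMk
            (ContinuousAt.comp (f := fun r : Base => ((r, f r) : Pt)) (dξ hpU).continuousAt hgraph)
        filter_upwards [hc.eventually (hg.eventually (by simp))] with r hr _
        exact hr.differentiableAt (by simp)
      filter_upwards [hUev, hf.eventually (by simp), hg', heq.eventually_nhds]
        with r h1 h2 h3 h4 hrt
      obtain ⟨r1, r2⟩ := r
      obtain rfl : r1 = t := hrt
      have h2' := h2.differentiableAt (by simp)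
      have a1 := hasDerivAt_comp_pt (a := fun _ => r1) (b := id) (c := fun s => f (r1, s)) (s := r2)
        (dη h1) (hasDerivAt_const r2 r1) (hasDerivAt_id r2) (hasDerivAt_dx h2')
      have a2 := hasDerivAt_comp_pt (a := fun _ => r1) (b := id) (c := fun s => f (r1, s)) (s := r2)
        (dξ h1) (hasDerivAt_const r2 r1) (hasDerivAt_id r2) (hasDerivAt_dx h2')
      have a3 := hasDerivAt_comp_base (F := g) (h3 rfl) (hasDerivAt_const r2 (T r1)) a2
      have hlt : Tendsto (fun s : ℝ => ((r1, s) : Base)) (𝓝 r2) (𝓝 (r1, r2)) :=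
        (by fun_prop : Continuous fun s : ℝ => ((r1, s) : Base)).tendsto r2
      have a4 := a1.unique (a3.congr_of_eventuallyEq (hlt.eventually h4))
      simpa using a4
    refine ⟨key.self_of_nhds rfl, ?_⟩
    have hdf := (contDiffAt_dx hf).differentiableAt (by simp)
    have hdg := (contDiffAt_dx hg).differentiableAt (by simp)
    have D : ∀ {F : Pt → ℝ}, ContDiffOn ℝ ∞ F U →
        HasDerivAt (fun s => F ((t, s), f (t, s)))
          (pX F ((t, x), f (t, x)) + pU F ((t, x), f (t, x)) * dx f (t, x)) x := by
      intro F hF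
      simpa using hasDerivAt_comp_pt (a := fun _ => t) (b := id) (c := fun s => f (t, s)) (s := x)
        (differentiableAt_of_contDiffOn hU hF hpU) (hasDerivAt_const x t) (hasDerivAt_id x)
        (hasDerivAt_dx hfd)
    have l := (D (ContDiffOn.pX hU hη)).add
      ((D (ContDiffOn.pU hU hη)).mul (hasDerivAt_dx hdf))
    have r1 := (D (ContDiffOn.pX hU hξ)).add
      ((D (ContDiffOn.pU hU hξ)).mul (hasDerivAt_dx hdf))
    have r2 := hasDerivAt_comp_base (F := dx g) hdg (hasDerivAt_const x (T t)) (D hξ)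
    have e := l.unique ((r2.mul r1).congr_of_eventuallyEq
      ((hline.eventually key).mono fun s hs => hs rfl))
    rw [pU_pX_comm hU hη hpU, pU_pX_comm hU hξ hpU] at e
    simp only [Pi.add_apply, Pi.mul_apply] at e
    linear_combination e

/-! ### Images of graphs -/

theorem exists_continuousLinearEquiv_of_det_ne_zero (L : Base →L[ℝ] Base)
    (h : (L (1, 0)).1 * (L (0, 1)).2 - (L (0, 1)).1 * (L (1, 0)).2 ≠ 0) :
    ∃ e : Base ≃L[ℝ] Base, (e : Base →L[ℝ] Base) = L := by
  have hL : ∀ a b : ℝ, L (a, b) = a • L (1, 0) + b • L (0, 1) := by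
    intro a b
    rw [← map_smul, ← map_smul, ← map_add]
    congr 1
    ext <;> simp
  have hinj : Function.Injective (L : Base →ₗ[ℝ] Base) := by
    rw [← LinearMap.ker_eq_bot, LinearMap.ker_eq_bot']
    rintro ⟨a, b⟩ hab
    have h0 : L (a, b) = 0 := hab
    rw [hL] at h0
    have h1 := congrArg Prod.fst h0
    have h2 := congrArg Prod.snd h0
    simp only [Prod.fst_add, Prod.snd_add, Prod.smul_fst, Prod.smul_snd, smul_eq_mul,
      Prod.fst_zero, Prod.snd_zero] at h1 h2
    have ha : a = 0 := by
      refine (mul_eq_zero.1 ?_).resolve_right h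
      linear_combination (L (0, 1)).2 * h1 - (L (0, 1)).1 * h2
    have hb : b = 0 := by
      refine (mul_eq_zero.1 ?_).resolve_right h
      linear_combination (L (1, 0)).1 * h2 - (L (1, 0)).2 * h1
    rw [ha, hb]; rfl
  refine ⟨(LinearEquiv.ofInjectiveEndo _ hinj).toContinuousLinearEquiv, ?_⟩
  ext <;> rfl

/-- The `t`-component of a map of the space of `(t, x, u)`. -/
def compT (φ : Pt → Pt) (r : Pt) : ℝ := (φ r).1.1
/-- The `x`-component of a map of the space of `(t, x, u)`. -/
def compX (φ : Pt → Pt) (r : Pt) : ℝ := (φ r).1.2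
/-- The `u`-component of a map of the space of `(t, x, u)`. -/
def compU (φ : Pt → Pt) (r : Pt) : ℝ := (φ r).2

section Components
variable {φ : Pt → Pt} {U : Set Pt}

theorem contDiffOn_compT (h : ContDiffOn ℝ ∞ φ U) : ContDiffOn ℝ ∞ (compT φ) U :=
  contDiff_fst.comp_contDiffOn (contDiff_fst.comp_contDiffOn h)

theorem contDiffOn_compX (h : ContDiffOn ℝ ∞ φ U) : ContDiffOn ℝ ∞ (compX φ) U :=
  contDiff_snd.comp_contDiffOn (contDiff_fst.comp_contDiffOn h)

theorem contDiffOn_compU (h : ContDiffOn ℝ ∞ φ U) : ContDiffOn ℝ ∞ (compU φ) U :=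
  contDiff_snd.comp_contDiffOn h

end Components

/-- The Jacobian of the restriction of `(τ, ξ)` to a graph with slopes `a` and `b`. -/
noncomputable def graphJac (τ ξ : Pt → ℝ) (p : Pt) (a b : ℝ) : ℝ :=
  (pT τ p + pU τ p * a) * (pX ξ p + pU ξ p * b) - (pX τ p + pU τ p * b) * (pT ξ p + pU ξ p * a)

theorem hasFDerivAt_comp_graph {F : Pt → ℝ} {f : Base → ℝ} {q : Base}
    (hF : DifferentiableAt ℝ F (q, f q)) (hf : DifferentiableAt ℝ f q) :
    DifferentiableAt ℝ (fun r => F (r, f r)) q ∧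
    dt (fun r => F (r, f r)) q = pT F (q, f q) + pU F (q, f q) * dt f q ∧
    dx (fun r => F (r, f r)) q = pX F (q, f q) + pU F (q, f q) * dx f q := by
  obtain ⟨t, x⟩ := q
  refine ⟨?_, ?_, ?_⟩
  · exact DifferentiableAt.comp (f := fun r : Base => ((r, f r) : Pt)) (t, x) hF
      (differentiableAt_id.prodMk hf)
  · have := hasDerivAt_comp_pt (a := id) (b := fun _ => x) (c := fun s => f (s, x)) (s := t)
      hF (hasDerivAt_id t) (hasDerivAt_const t x) (hasDerivAt_dt hf)
    exact Eq.trans this.deriv (by simp)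
  · have := hasDerivAt_comp_pt (a := fun _ => t) (b := id) (c := fun s => f (t, s)) (s := x)
      hF (hasDerivAt_const x t) (hasDerivAt_id x) (hasDerivAt_dx hf)
    exact Eq.trans this.deriv (by simp)

/-- A nonzero `graphJac` makes `r ↦ (φ (r, f r)).1` a local diffeomorphism of the base by the
inverse function theorem. Then `g` is the `u`-component of `φ` along the graph, written through the
inverse of this map. -/
theorem exists_image_graph {φ : OpenPartialHomeomorph Pt Pt} (hφ : ContDiffOn ℝ ∞ φ φ.source)
    {f : Base → ℝ} {q : Base} (hq : (q, f q) ∈ φ.source) (hf : ContDiff ℝ ∞ f)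
    (hJ : graphJac (compT φ) (compX φ) (q, f q) (dt f q) (dx f q) ≠ 0) :
    ∃ g : Base → ℝ, ContDiffAt ℝ ∞ g (φ (q, f q)).1 ∧ MapsGraphAt φ f g q := by
  have hgr : ContDiff ℝ ∞ (fun r : Base => ((r, f r) : Pt)) := contDiff_id.prodMk hf
  have hφq : ContDiffAt ℝ ∞ φ (q, f q) := hφ.contDiffAt (φ.open_source.mem_nhds hq)
  have hcomp : ContDiffAt ℝ ∞ (fun r : Base => φ (r, f r)) q :=
    ContDiffAt.comp (f := fun r : Base => ((r, f r) : Pt)) q hφq hgr.contDiffAt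
  set Φ : Base → Base := fun r => (φ (r, f r)).1 with hΦdef
  have hΦ : ContDiffAt ℝ ∞ Φ q := hcomp.fst
  have hΦd := hΦ.differentiableAt (by simp)
  have hfd : DifferentiableAt ℝ f q := (hf.differentiable (by simp)) q
  obtain ⟨a1, a2, a3⟩ := hasFDerivAt_comp_graph (F := compT φ)
    (differentiableAt_of_contDiffOn φ.open_source (contDiffOn_compT hφ) hq) hfd
  obtain ⟨b1, b2, b3⟩ := hasFDerivAt_comp_graph (F := compX φ)
    (differentiableAt_of_contDiffOn φ.open_source (contDiffOn_compX hφ) hq) hfd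
  have hΦ' : fderiv ℝ Φ q = (fderiv ℝ (fun r => compT φ (r, f r)) q).prod
      (fderiv ℝ (fun r => compX φ (r, f r)) q) :=
    (a1.hasFDerivAt.prodMk b1.hasFDerivAt).fderiv
  obtain ⟨e, he⟩ := exists_continuousLinearEquiv_of_det_ne_zero (fderiv ℝ Φ q) (by
    rw [hΦ']
    simp only [ContinuousLinearMap.prod_apply, fderiv_base_apply _ a1, fderiv_base_apply _ b1,
      a2, a3, b2, b3]
    unfold graphJac at hJ
    intro h0
    apply hJ
    linear_combination h0)
  have hΦf : HasFDerivAt Φ (e : Base →L[ℝ] Base) q := he ▸ hΦd.hasFDerivAt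
  set R := hΦ.toOpenPartialHomeomorph Φ hΦf (by simp) with hR
  have hRc : ∀ r, R r = Φ r := fun r => rfl
  have hqR : q ∈ R.source := hΦ.mem_toOpenPartialHomeomorph_source hΦf (by simp)
  have hRq : R.symm (Φ q) = q := R.left_inv hqR
  have hRs : ContDiffAt ℝ ∞ R.symm (Φ q) := hΦ.to_localInverse hΦf (by simp)
  refine ⟨fun s => (φ (R.symm s, f (R.symm s))).2, ?_, ?_, ?_⟩
  · have : ContDiffAt ℝ ∞ (fun s => φ (R.symm s, f (R.symm s))) (Φ q) :=
      ContDiffAt.comp (g := fun r : Base => φ (r, f r)) (Φ q) (by rw [hRq]; exact hcomp) hRs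
    exact this.snd
  · filter_upwards [R.open_source.mem_nhds hqR] with r hr
    have : R.symm (φ (r, f r)).1 = r := R.left_inv hr
    rw [this]
  · have hT : Φ q ∈ R.target := R.map_source hqR
    have hc : ContinuousAt (fun s => ((R.symm s, f (R.symm s)) : Pt)) (Φ q) :=
      ContinuousAt.comp (g := fun r : Base => ((r, f r) : Pt)) hgr.continuous.continuousAt
        hRs.continuousAt
    have hev := hc.eventually (φ.open_source.mem_nhds (by simpa only [hRq] using hq))
    filter_upwards [R.open_target.mem_nhds hT, hev] with s hs hs'
    have h1 : (φ (R.symm s, f (R.symm s))).1 = s := R.right_inv hs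
    have h2 : ((s, (φ (R.symm s, f (R.symm s))).2) : Pt) = φ (R.symm s, f (R.symm s)) := by
      ext <;> simp [h1]
    rw [h2, φ.left_inv hs']

/-- Differentiating `φ ∘ φ.symm = id` exhibits a right inverse of the Jacobian matrix, column by
column; determinants are multiplicative. -/
theorem jacobian_ne_zero {φ : OpenPartialHomeomorph Pt Pt} (hφ : ContDiffOn ℝ ∞ φ φ.source)
    (hψ : ContDiffOn ℝ ∞ φ.symm φ.target) {p : Pt} (hp : p ∈ φ.source) :
    pT (compT φ) p * (pX (compX φ) p * pU (compU φ) p - pU (compX φ) p * pX (compU φ) p)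
    - pX (compT φ) p * (pT (compX φ) p * pU (compU φ) p - pU (compX φ) p * pT (compU φ) p)
    + pU (compT φ) p * (pT (compX φ) p * pX (compU φ) p - pX (compX φ) p * pT (compU φ) p)
      ≠ 0 := by
  have d1 : DifferentiableAt ℝ φ p := differentiableAt_of_contDiffOn φ.open_source hφ hp
  have hpt := φ.map_source hp
  have d2 : DifferentiableAt ℝ φ.symm (φ p) :=
    differentiableAt_of_contDiffOn φ.open_target hψ hpt
  have d1' : HasFDerivAt φ (fderiv ℝ φ p) (φ.symm (φ p)) := by
    rw [φ.left_inv hp]; exact d1.hasFDerivAt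
  have hid : (fderiv ℝ φ p).comp (fderiv ℝ φ.symm (φ p)) = ContinuousLinearMap.id ℝ Pt := by
    refine (d1'.comp (φ p) d2.hasFDerivAt).unique ?_
    refine (hasFDerivAt_id (φ p)).congr_of_eventuallyEq ?_
    filter_upwards [φ.open_target.mem_nhds hpt] with r hr
    exact φ.right_inv hr
  have cT : fderiv ℝ (compT φ) p = (ContinuousLinearMap.fst ℝ ℝ ℝ).comp
      ((ContinuousLinearMap.fst ℝ Base ℝ).comp (fderiv ℝ φ p)) :=
    (d1.hasFDerivAt.fst.fst).fderiv
  have cX : fderiv ℝ (compX φ) p = (ContinuousLinearMap.snd ℝ ℝ ℝ).comp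
      ((ContinuousLinearMap.fst ℝ Base ℝ).comp (fderiv ℝ φ p)) :=
    (d1.hasFDerivAt.fst.snd).fderiv
  have cU : fderiv ℝ (compU φ) p = (ContinuousLinearMap.snd ℝ Base ℝ).comp (fderiv ℝ φ p) :=
    (d1.hasFDerivAt.snd).fderiv
  have key : ∀ v : Pt, ∃ a b c : ℝ,
      pT (compT φ) p * a + pX (compT φ) p * b + pU (compT φ) p * c = v.1.1 ∧
      pT (compX φ) p * a + pX (compX φ) p * b + pU (compX φ) p * c = v.1.2 ∧
      pT (compU φ) p * a + pX (compU φ) p * b + pU (compU φ) p * c = v.2 := by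
    intro v
    have hv : fderiv ℝ φ p (fderiv ℝ φ.symm (φ p) v) = v := by
      have := congrArg (fun L => L v) hid
      simpa using this
    set w := fderiv ℝ φ.symm (φ p) v
    refine ⟨w.1.1, w.1.2, w.2, ?_, ?_, ?_⟩
    · rw [← fderiv_pt_apply, cT]; simp [hv]
    · rw [← fderiv_pt_apply, cX]; simp [hv]
    · rw [← fderiv_pt_apply, cU]; simp [hv]
  obtain ⟨a1, b1, c1, e11, e12, e13⟩ := key ((1, 0), 0)
  obtain ⟨a2, b2, c2, e21, e22, e23⟩ := key ((0, 1), 0)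
  obtain ⟨a3, b3, c3, e31, e32, e33⟩ := key ((0, 0), 1)
  set M : Matrix (Fin 3) (Fin 3) ℝ := !![pT (compT φ) p, pX (compT φ) p, pU (compT φ) p;
    pT (compX φ) p, pX (compX φ) p, pU (compX φ) p; pT (compU φ) p, pX (compU φ) p, pU (compU φ) p]
  set N : Matrix (Fin 3) (Fin 3) ℝ := !![a1, a2, a3; b1, b2, b3; c1, c2, c3]
  have hMN : M * N = 1 := by
    ext i j
    fin_cases i <;> fin_cases j <;>
      simp [M, N, Matrix.mul_apply, Fin.sum_univ_three, *]
  have hdet : M.det * N.det = 1 := by rw [← Matrix.det_mul, hMN, Matrix.det_one]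
  have hM : M.det ≠ 0 := left_ne_zero_of_mul_eq_one hdet
  rw [Matrix.det_fin_three] at hM
  simp only [M, Matrix.of_apply, Matrix.cons_val', Matrix.cons_val_zero, Matrix.cons_val_one,
    Matrix.cons_val] at hM
  intro h0
  apply hM
  linear_combination h0

/-! ### The `t`-component of an admissible transformation -/

/-- Taylor's formula with Peano remainder: `D' = o(s - y)` is integrated by the mean value
inequality on balls that shrink to `y`. -/
theorem isLittleO_sq_of_hasDerivAt {D D' : ℝ → ℝ} {y : ℝ}
    (h : ∀ᶠ s in 𝓝 y, HasDerivAt D (D' s) s) (h' : HasDerivAt D' 0 y) (h0 : D y = 0)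
    (h1 : D' y = 0) : D =o[𝓝 y] fun s => (s - y) ^ 2 := by
  have h2 : D' =o[𝓝 y] fun s => s - y := by
    simpa [h1] using hasDerivAt_iff_isLittleO.1 h'
  rw [Asymptotics.isLittleO_iff] at h2 ⊢
  intro ε hε
  obtain ⟨δ, hδ, hb⟩ := Metric.eventually_nhds_iff_ball.1 (h.and (h2 hε))
  filter_upwards [Metric.ball_mem_nhds y hδ] with s hs
  have hsub : Metric.closedBall y (dist s y) ⊆ Metric.ball y δ :=
    Metric.closedBall_subset_ball (Metric.mem_ball.1 hs)
  have := (convex_closedBall y (dist s y)).norm_image_sub_le_of_norm_hasDerivWithin_le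
    (f := D) (f' := D') (C := ε * ‖s - y‖) (x := y) (y := s)
    (fun r hr => (hb r (hsub hr)).1.hasDerivWithinAt)
    (fun r hr => (hb r (hsub hr)).2.trans (by
      have : ‖r - y‖ ≤ ‖s - y‖ := by simpa [dist_eq_norm] using hr
      gcongr))
    (Metric.mem_closedBall_self dist_nonneg) (Metric.mem_closedBall.2 le_rfl)
  rw [h0, sub_zero] at this
  rw [norm_pow, pow_two, ← mul_assoc]
  exact this

/-- If `D` vanishes to second order, then `k² = O(D) = o((s - y)²)`, hence `k = o(s - y)`. Here `k`
will be a time displacement in the source and `D` the difference of two image functions. -/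
theorem deriv_eq_zero_of_sq_le {k D D' : ℝ → ℝ} {y k' K : ℝ} (hk : HasDerivAt k k' y)
    (hk0 : k y = 0) (hle : ∀ᶠ s in 𝓝 y, k s ^ 2 ≤ K * |D s|)
    (h : ∀ᶠ s in 𝓝 y, HasDerivAt D (D' s) s) (h' : HasDerivAt D' 0 y) (h0 : D y = 0)
    (h1 : D' y = 0) : k' = 0 := by
  have hD := isLittleO_sq_of_hasDerivAt h h' h0 h1
  have hO : (fun s => k s ^ 2) =O[𝓝 y] D := by
    refine Asymptotics.IsBigO.of_bound K ?_
    filter_upwards [hle] with s hs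
    rw [Real.norm_of_nonneg (sq_nonneg _)]
    exact hs
  have hk2 : k =o[𝓝 y] fun s => s - y :=
    Asymptotics.IsLittleO.of_pow (n := 2) (hO.trans_isLittleO hD) (by norm_num)
  refine hk.unique ?_
  rw [hasDerivAt_iff_isLittleO]
  simpa [hk0] using hk2

/-- A quadratic polynomial in `(t, x)` with given jet. -/
noncomputable def quad (q : Base) (u a b c d : ℝ) (r : Base) : ℝ :=
  u + a * (r.1 - q.1) + b * (r.2 - q.2) + c / 2 * (r.2 - q.2) ^ 2 + d * (r.1 - q.1) ^ 2

section quad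
variable (q : Base) (u a b c d : ℝ)

theorem contDiff_quad : ContDiff ℝ ∞ (quad q u a b c d) := by
  unfold quad; fun_prop

theorem quad_self : quad q u a b c d q = u := by simp [quad]

theorem dt_quad : dt (quad q u a b c d) q = a := by
  have : HasDerivAt (fun s => quad q u a b c d (s, q.2)) (a * 1 + d * (2 * (q.1 - q.1))) q.1 := by
    unfold quad
    simp only [sub_self, mul_zero, add_zero, ne_eq, OfNat.ofNat_ne_zero, not_false_eq_true,
      zero_pow]
    have h := (hasDerivAt_id q.1).sub_const q.1
    have h2 := ((h.const_mul a).const_add u).add ((h.pow 2).const_mul d)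
    refine HasDerivAt.congr_deriv h2 ?_
    simp
  unfold dt
  rw [this.deriv]
  ring

theorem dx_quad (r : Base) : dx (quad q u a b c d) r = b + c * (r.2 - q.2) := by
  have h := (hasDerivAt_id r.2).sub_const q.2
  have h2 := (((h.const_mul b).const_add (u + a * (r.1 - q.1))).add
    ((h.pow 2).const_mul (c / 2))).add_const (d * (r.1 - q.1) ^ 2)
  refine Eq.trans h2.deriv ?_
  simp
  ring

theorem dx_dx_quad : dx (dx (quad q u a b c d)) q = c := by
  have h : dx (quad q u a b c d) = fun r => b + c * (r.2 - q.2) := funext (dx_quad q u a b c d)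
  rw [h]
  have h2 := (((hasDerivAt_id q.2).sub_const q.2).const_mul c).const_add b
  exact Eq.trans h2.deriv (by simp)

end quad

theorem linear_system_unique {m11 m12 m21 m22 a b a' b' : ℝ} (h : m11 * m22 - m12 * m21 ≠ 0)
    (h1 : m11 * a + m12 * b = m11 * a' + m12 * b')
    (h2 : m21 * a + m22 * b = m21 * a' + m22 * b') : a = a' ∧ b = b' := by
  constructor
  · refine sub_eq_zero.1 ((mul_eq_zero.1 ?_).resolve_left h)
    linear_combination m22 * h1 - m12 * h2
  · refine sub_eq_zero.1 ((mul_eq_zero.1 ?_).resolve_left h)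
    linear_combination m11 * h2 - m21 * h1

section Admissible
variable {θ θ' : ArbTuple} {φ : OpenPartialHomeomorph Pt Pt}

/-- The relations between the first-order jets of two functions with corresponding graphs. -/
theorem first_jet_relations (hφ : ContDiffOn ℝ ∞ φ φ.source) {f g : Base → ℝ} {q : Base}
    (hq : (q, f q) ∈ φ.source) (hf : DifferentiableAt ℝ f q)
    (hg : DifferentiableAt ℝ g (φ (q, f q)).1)
    (hm : ∀ᶠ r in 𝓝 q, (φ (r, f r)).2 = g (φ (r, f r)).1) :
    (pT (compT φ) (q, f q) + pU (compT φ) (q, f q) * dt f q) * dt g (φ (q, f q)).1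
      + (pT (compX φ) (q, f q) + pU (compX φ) (q, f q) * dt f q) * dx g (φ (q, f q)).1
      = pT (compU φ) (q, f q) + pU (compU φ) (q, f q) * dt f q ∧
    (pX (compT φ) (q, f q) + pU (compT φ) (q, f q) * dx f q) * dt g (φ (q, f q)).1
      + (pX (compX φ) (q, f q) + pU (compX φ) (q, f q) * dx f q) * dx g (φ (q, f q)).1
      = pX (compU φ) (q, f q) + pU (compU φ) (q, f q) * dx f q := by
  obtain ⟨a1, a2, a3⟩ := hasFDerivAt_comp_graph (F := compT φ)
    (differentiableAt_of_contDiffOn φ.open_source (contDiffOn_compT hφ) hq) hf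
  obtain ⟨b1, b2, b3⟩ := hasFDerivAt_comp_graph (F := compX φ)
    (differentiableAt_of_contDiffOn φ.open_source (contDiffOn_compX hφ) hq) hf
  obtain ⟨c1, c2, c3⟩ := hasFDerivAt_comp_graph (F := compU φ)
    (differentiableAt_of_contDiffOn φ.open_source (contDiffOn_compU hφ) hq) hf
  rw [← a2, ← a3, ← b2, ← b3, ← c2, ← c3]
  obtain ⟨t, x⟩ := q
  constructor
  · have h := hasDerivAt_comp_base (F := g) hg (hasDerivAt_dt a1) (hasDerivAt_dt b1)
    have hl : Tendsto (fun s : ℝ => ((s, x) : Base)) (𝓝 t) (𝓝 (t, x)) :=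
      (by fun_prop : Continuous fun s : ℝ => ((s, x) : Base)).tendsto t
    have e := (hasDerivAt_dt c1).unique (h.congr_of_eventuallyEq (hl.eventually hm))
    rw [e]
    simp only [compT, compX]
    ring
  · have h := hasDerivAt_comp_base (F := g) hg (hasDerivAt_dx a1) (hasDerivAt_dx b1)
    have hl : Tendsto (fun s : ℝ => ((t, s) : Base)) (𝓝 x) (𝓝 (t, x)) :=
      (by fun_prop : Continuous fun s : ℝ => ((t, s) : Base)).tendsto x
    have e := (hasDerivAt_dx c1).unique (h.congr_of_eventuallyEq (hl.eventually hm))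
    rw [e]
    simp only [compT, compX]
    ring

/-- Two source polynomials that differ only by `(t - t₀)²` both satisfy the equation at `q`, so
their images agree to second order in `x'` on the line `t' = const`. Pulled back, this line moves in
`t` by `k` with `k²` bounded by the image difference, so it starts with zero `t`-velocity. The new
time is constant along it, which gives the relation. -/
theorem compT_total_x_eq_zero (h : (θ, φ, θ') ∈ equivalenceGroupoid) {q : Base} {u a b : ℝ}
    (hp : (q, u) ∈ φ.source) (hJ : graphJac (compT φ) (compX φ) (q, u) a b ≠ 0) :
    pX (compT φ) (q, u) + pU (compT φ) (q, u) * b = 0 := by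
  obtain ⟨hcomp, hφ, hψ, hM⟩ := h
  dsimp only at hcomp hφ hψ hM
  -- Since `A² ≠ 0`, the equation can be solved for `u_xx`; the coefficient `d` of `(t - t₀)²`
  -- remains free.
  have hA2 := θ.a2_ne q (hcomp.1 _ hp)
  set A := θ.val q
  set c : ℝ := (a + u * b - (A.a11 * q.2 + A.a10) * b) / A.a2 with hc
  have hsat : ∀ d, SatisfiesAt θ (quad q u a b c d) q := by
    intro d
    unfold SatisfiesAt
    rw [dt_quad, dx_quad, dx_dx_quad, quad_self, sub_self, mul_zero, add_zero, hc]
    field_simp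
    ring
  have hex : ∀ d, ∃ g : Base → ℝ, ContDiffAt ℝ ∞ g (φ (q, u)).1 ∧
      MapsGraphAt φ (quad q u a b c d) g q ∧ SatisfiesAt θ' g (φ (q, u)).1 ∧
      ∀ᶠ r in 𝓝 (φ (q, u)).1, (φ.symm (r, g r)).2 = quad q u a b c d (φ.symm (r, g r)).1 := by
    intro d
    have hq : (q, quad q u a b c d q) ∈ φ.source := by rw [quad_self]; exact hp
    obtain ⟨g, hg, hm⟩ := exists_image_graph hφ hq (contDiff_quad q u a b c d) (by
      rw [dt_quad, dx_quad, quad_self, sub_self, mul_zero, add_zero]; exact hJ)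
    have := (hM q _ g hq ((contDiff_quad q u a b c d).contDiffAt.of_le two_le_infty)
      (hg.of_le two_le_infty) hm).1 (hsat d)
    have hm2 := hm.2
    rw [quad_self] at hg this hm2
    exact ⟨g, hg, hm, this, hm2⟩
  obtain ⟨g1, hg1, hm1, hs1, hi1⟩ := hex 0
  obtain ⟨g2, hg2, hm2, hs2, hi2⟩ := hex 1
  set q' := (φ (q, u)).1 with hq'
  have hφp : φ (q, u) ∈ φ.target := φ.map_source hp
  have hval : ∀ {g : Base → ℝ} {d : ℝ}, MapsGraphAt φ (quad q u a b c d) g q →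
      g q' = (φ (q, u)).2 := by
    intro g d hm
    have := hm.1.self_of_nhds
    rw [quad_self] at this
    exact this.symm
  have hrel : ∀ {g : Base → ℝ} {d : ℝ}, ContDiffAt ℝ ∞ g q' →
      MapsGraphAt φ (quad q u a b c d) g q →
      (pT (compT φ) (q, u) + pU (compT φ) (q, u) * a) * dt g q'
        + (pT (compX φ) (q, u) + pU (compX φ) (q, u) * a) * dx g q'
        = pT (compU φ) (q, u) + pU (compU φ) (q, u) * a ∧
      (pX (compT φ) (q, u) + pU (compT φ) (q, u) * b) * dt g q'
        + (pX (compX φ) (q, u) + pU (compX φ) (q, u) * b) * dx g q'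
        = pX (compU φ) (q, u) + pU (compU φ) (q, u) * b := by
    intro g d hg hm
    have := first_jet_relations hφ (f := quad q u a b c d) (q := q) (g := g)
      (by rw [quad_self]; exact hp) ((contDiff_quad q u a b c d).differentiable (by simp) q)
      (by rw [quad_self]; exact hg.differentiableAt (by simp)) hm.1
    rw [dt_quad, dx_quad, quad_self, sub_self, mul_zero, add_zero] at this
    exact this
  obtain ⟨r11, r12⟩ := hrel hg1 hm1
  obtain ⟨r21, r22⟩ := hrel hg2 hm2
  obtain ⟨et, ex⟩ := linear_system_unique (a := dt g1 q') (a' := dt g2 q') (b := dx g1 q')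
    (b' := dx g2 q') (m11 := pT (compT φ) (q, u) + pU (compT φ) (q, u) * a)
    (m12 := pT (compX φ) (q, u) + pU (compX φ) (q, u) * a)
    (m21 := pX (compT φ) (q, u) + pU (compT φ) (q, u) * b)
    (m22 := pX (compX φ) (q, u) + pU (compX φ) (q, u) * b)
    (by unfold graphJac at hJ; intro h0; apply hJ; linear_combination h0)
    (r11.trans r21.symm) (r12.trans r22.symm)
  have e0 : g1 q' = g2 q' := (hval hm1).trans (hval hm2).symm
  have exx : dx (dx g1) q' = dx (dx g2) q' := by
    have hA2' := θ'.a2_ne q' (hcomp.2 _ hφp)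
    unfold SatisfiesAt at hs1 hs2
    rw [et, ex, e0] at hs1
    exact mul_left_cancel₀ hA2' (by linear_combination hs2 - hs1)
  -- The difference of `g1` and `g2` along the line `t' = const` is of third order.
  have hp' : (q', (φ (q, u)).2) = φ (q, u) := rfl
  -- This function vanishes on the graph of `g1` and equals `(t - t₀)²`, evaluated at the preimage,
  -- on the graph of `g2`. Its Lipschitz bound yields `k² ≤ K |g2 - g1|`.
  have hH : ContDiffAt ℝ 1 (fun z : Pt => (φ.symm z).2 - quad q u a b c 0 (φ.symm z).1)
      (φ (q, u)) := by
    have h1 : ContDiffAt ℝ 1 φ.symm (φ (q, u)) :=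
      (hψ.contDiffAt (φ.open_target.mem_nhds hφp)).of_le (by simp)
    exact h1.snd.sub (((contDiff_quad q u a b c 0).of_le (by simp)).contDiffAt.comp _ h1.fst)
  obtain ⟨K, W, hW, hLip⟩ := hH.exists_lipschitzOnWith
  obtain ⟨t', x'⟩ := q'
  have hline : Tendsto (fun s : ℝ => ((t', s) : Base)) (𝓝 x') (𝓝 (t', x')) :=
    (by fun_prop : Continuous fun s : ℝ => ((t', s) : Base)).tendsto x'
  have hcg : ∀ {g : Base → ℝ}, ContDiffAt ℝ ∞ g (t', x') → g (t', x') = (φ (q, u)).2 →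
      ∀ V ∈ 𝓝 (φ (q, u)), ∀ᶠ s in 𝓝 x', (((t', s), g (t', s)) : Pt) ∈ V := by
    intro g hg hgv V hV
    have hc : ContinuousAt (fun s : ℝ => (((t', s), g (t', s)) : Pt)) x' :=
      hline.prodMk_nhds (ContinuousAt.comp (f := fun s : ℝ => ((t', s)
          : Base)) hg.continuousAt hline)
    exact hc.eventually (by simp only [hgv, hp']; exact hV)
  have d2 : DifferentiableAt ℝ φ.symm (φ (q, u)) :=
    differentiableAt_of_contDiffOn φ.open_target hψ hφp
  have hcurve : HasDerivAt (fun s => φ.symm ((t', s), g2 (t', s)))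
      (fderiv ℝ φ.symm (φ (q, u)) ((0, 1), dx g2 (t', x'))) x' := by
    have hh : HasDerivAt (fun s => (((t', s), g2 (t', s)) : Pt)) ((0, 1), dx g2 (t', x')) x' :=
      ((hasDerivAt_const x' t').prodMk (hasDerivAt_id x')).prodMk
        (hasDerivAt_dx (hg2.differentiableAt (by simp)))
    refine HasFDerivAt.comp_hasDerivAt (f := fun s => (((t', s), g2 (t', s)) : Pt)) x' ?_ hh
    rw [hval hm2, hp']
    exact d2.hasFDerivAt
  set w := fderiv ℝ φ.symm (φ (q, u)) ((0, 1), dx g2 (t', x')) with hw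
  have hstart : φ.symm ((t', x'), g2 (t', x')) = (q, u) := by
    rw [hval hm2, hp', φ.left_inv hp]
  have hcurve1 : HasDerivAt (fun s => (φ.symm ((t', s), g2 (t', s))).1) w.1 x' :=
    HasFDerivAt.comp_hasDerivAt (f := fun s => φ.symm ((t', s), g2 (t', s))) x'
      (hasFDerivAt_fst (𝕜 := ℝ)) hcurve
  have hwt : HasDerivAt (fun s => (φ.symm ((t', s), g2 (t', s))).1.1) w.1.1 x' :=
    HasFDerivAt.comp_hasDerivAt (f := fun s => (φ.symm ((t', s), g2 (t', s))).1) x'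
      (hasFDerivAt_fst (𝕜 := ℝ)) hcurve1
  have hwx : HasDerivAt (fun s => (φ.symm ((t', s), g2 (t', s))).1.2) w.1.2 x' :=
    HasFDerivAt.comp_hasDerivAt (f := fun s => (φ.symm ((t', s), g2 (t', s))).1) x'
      (hasFDerivAt_snd (𝕜 := ℝ)) hcurve1
  have hwu : HasDerivAt (fun s => (φ.symm ((t', s), g2 (t', s))).2) w.2 x' :=
    HasFDerivAt.comp_hasDerivAt (f := fun s => φ.symm ((t', s), g2 (t', s))) x'
      (hasFDerivAt_snd (𝕜 := ℝ)) hcurve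
  have hk := hwt.sub_const q.1
  have hgraph2 := hline.eventually hi2
  have hgraph1 := hline.eventually hi1
  have hw0 : w.1.1 = 0 := by
    refine deriv_eq_zero_of_sq_le (K := K) (D := fun s => g2 (t', s) - g1 (t', s))
      (D' := fun s => dx g2 (t', s) - dx g1 (t', s)) hk ?_ ?_ ?_ ?_ ?_ ?_
    · simp [hstart]
    · filter_upwards [hgraph1, hgraph2, hcg hg1 (hval hm1) W hW, hcg hg2 (hval hm2) W hW]
        with s h1 h2 h3 h4
      have h5 := hLip.dist_le_mul _ h4 _ h3
      simp only [h1, h2, sub_self, dist_zero_right] at h5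
      have h6 : dist (((t', s), g2 (t', s)) : Pt) ((t', s), g1 (t', s))
          = |g2 (t', s) - g1 (t', s)| := by
        rw [Prod.dist_eq, dist_self, max_eq_right dist_nonneg, Real.dist_eq]
      rw [h6] at h5
      refine le_trans (le_trans (le_of_eq ?_) (le_abs_self _)) h5
      unfold quad
      ring
    · have hd : ∀ {g : Base → ℝ}, ContDiffAt ℝ ∞ g (t', x') →
          ∀ᶠ s in 𝓝 x', HasDerivAt (fun s => g (t', s)) (dx g (t', s)) s := by
        intro g hg
        filter_upwards [hline.eventually ((hg.of_le two_le_infty).eventually (by simp))] with s hs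
        exact hasDerivAt_dx (hs.differentiableAt (by simp))
      filter_upwards [hd hg1, hd hg2] with s h1 h2
      exact h2.sub h1
    · have h1 := hasDerivAt_dx ((contDiffAt_dx (hg1.of_le two_le_infty)).differentiableAt (by simp))
      have h2 := hasDerivAt_dx ((contDiffAt_dx (hg2.of_le two_le_infty)).differentiableAt (by simp))
      refine (h2.sub h1).congr_deriv ?_
      rw [exx, sub_self]
    · simp [e0]
    · simp [ex]
  -- The pulled-back curve lies on the source graph, whose `x`-slope at `q` is `b`, and its
  -- `t`-velocity is zero.
  have hw2 : w.2 = b * w.1.2 := by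
    have h1 := hasDerivAt_comp_base (F := quad q u a b c 1)
      ((contDiff_quad q u a b c 1).differentiable (by simp) _) hwt hwx
    have h2 := hwu.unique (h1.congr_of_eventuallyEq hgraph2)
    rw [hstart, hw0, Prod.mk.eta, dx_quad] at h2
    rw [h2]; ring
  have hrinv : ∀ᶠ s in 𝓝 x', φ (φ.symm ((t', s), g2 (t', s))) = ((t', s), g2 (t', s)) := by
    filter_upwards [hcg hg2 (hval hm2) _ (φ.open_target.mem_nhds hφp)] with s hs
    exact φ.right_inv hs
  have hT := hasDerivAt_comp_pt (F := compT φ) (by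
    simp only [Prod.mk.eta, hstart]
    exact differentiableAt_of_contDiffOn φ.open_source (contDiffOn_compT hφ) hp) hwt hwx hwu
  have hX := hasDerivAt_comp_pt (F := compX φ) (by
    simp only [Prod.mk.eta, hstart]
    exact differentiableAt_of_contDiffOn φ.open_source (contDiffOn_compX hφ) hp) hwt hwx hwu
  simp only [Prod.mk.eta, hstart] at hT hX
  have hT' := hT.unique ((hasDerivAt_const x' t').congr_of_eventuallyEq (by
    filter_upwards [hrinv] with s hs
    simp [compT, hs]))
  have hX' := hX.unique ((hasDerivAt_id x').congr_of_eventuallyEq (by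
    filter_upwards [hrinv] with s hs
    simp [compX, hs]))
  rw [hw0, hw2] at hT' hX'
  -- Otherwise the curve would be stationary at `q`, although the `x'`-coordinate of its image has
  -- velocity one.
  have hne : w.1.2 ≠ 0 := by
    intro h0
    rw [h0] at hX'
    simp at hX'
  refine (mul_eq_zero.1 ?_).resolve_right hne
  linear_combination hT'

/-- The relation holds for all slopes at which `graphJac` is nonzero, so its product with `graphJac`
vanishes for all slopes. If `τ_x` or `τ_u` were nonzero, all three `2 × 2` minors of the gradients
of the `t`- and `x`-components would vanish, contradicting the nonzero Jacobian. -/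
theorem compT_derivs_eq_zero (h : (θ, φ, θ') ∈ equivalenceGroupoid) {p : Pt}
    (hp : p ∈ φ.source) : pX (compT φ) p = 0 ∧ pU (compT φ) p = 0 := by
  obtain ⟨q, u⟩ := p
  have hjac := jacobian_ne_zero h.2.1 h.2.2.1 hp
  have key := fun a b => compT_total_x_eq_zero (a := a) (b := b) h hp
  unfold graphJac at key
  set τt := pT (compT φ) (q, u)
  set τx := pX (compT φ) (q, u)
  set τu := pU (compT φ) (q, u)
  set ξt := pT (compX φ) (q, u)
  set ξx := pX (compX φ) (q, u)
  set ξu := pU (compX φ) (q, u)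
  -- The `ab`-terms of `graphJac` cancel, leaving an affine function of `(a, b)` whose coefficients
  -- are the minors. The six values below isolate the coefficients of the product.
  have key' : ∀ a b, (τx + τu * b) * ((τt * ξx - τx * ξt) + a * (τu * ξx - τx * ξu)
      + b * (τt * ξu - τu * ξt)) = 0 := by
    intro a b
    by_cases hJ : (τt + τu * a) * (ξx + ξu * b) - (τx + τu * b) * (ξt + ξu * a) = 0
    · linear_combination (τx + τu * b) * hJ
    · rw [key a b hJ, zero_mul]
  have h00 := key' 0 0
  have h01 := key' 0 1
  have h02 := key' 0 (-1)
  have h10 := key' 1 0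
  have h11 := key' 1 1
  have h12 := key' 1 (-1)
  have hu : τu = 0 := by
    by_contra hu
    have e1 : τu * (τt * ξu - τu * ξt) = 0 := by linear_combination (h01 + h02 - 2 * h00) / 2
    have e1' := (mul_eq_zero.1 e1).resolve_left hu
    have e2 : τu * (τu * ξx - τx * ξu) = 0 := by
      linear_combination (h11 - h12 - h01 + h02) / 2
    have e2' := (mul_eq_zero.1 e2).resolve_left hu
    have e3 : τu * (τt * ξx - τx * ξt) = 0 := by
      linear_combination (h01 - h02) / 2 - τx * e1'
    have e3' := (mul_eq_zero.1 e3).resolve_left hu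
    apply hjac
    linear_combination pU (compU φ) (q, u) * e3' - pX (compU φ) (q, u) * e1'
      - pT (compU φ) (q, u) * e2'
  refine ⟨?_, hu⟩
  by_contra hx
  rw [hu] at h00 h10 h01
  have e3 := (mul_eq_zero.1 h00).resolve_left (by simpa using hx)
  have e2 := (mul_eq_zero.1 h10).resolve_left (by simpa using hx)
  have e1 := (mul_eq_zero.1 h01).resolve_left (by simpa using hx)
  apply hjac
  rw [hu]
  linear_combination pU (compU φ) (q, u) * e3 - pX (compU φ) (q, u) * (e1 - e3)
      - pT (compU φ) (q, u) * (e2 - e3)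

end Admissible

/-! ### Functions not depending on some of the variables -/

theorem mem_ball_pt {p r : Pt} {ε : ℝ} : r ∈ Metric.ball p ε ↔
    (r.1.1 ∈ Metric.ball p.1.1 ε ∧ r.1.2 ∈ Metric.ball p.1.2 ε) ∧ r.2 ∈ Metric.ball p.2 ε := by
  rw [← ball_prod_same, ← ball_prod_same]
  simp [Set.mem_prod]

theorem mem_ball_base {p r : Base} {ε : ℝ} : r ∈ Metric.ball p ε ↔
    r.1 ∈ Metric.ball p.1 ε ∧ r.2 ∈ Metric.ball p.2 ε := by
  rw [← ball_prod_same]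
  exact Set.mem_prod

theorem eq_of_hasDerivAt_zero {f : ℝ → ℝ} {c ε : ℝ}
    (h : ∀ s ∈ Metric.ball c ε, HasDerivAt f 0 s) {a b : ℝ} (ha : a ∈ Metric.ball c ε)
    (hb : b ∈ Metric.ball c ε) : f a = f b :=
  Metric.isOpen_ball.is_const_of_deriv_eq_zero (convex_ball c ε).isPreconnected
    (fun s hs => (h s hs).differentiableAt.differentiableWithinAt)
    (fun s hs => (h s hs).deriv) ha hb

theorem eq_add_mul_of_hasDerivAt {f : ℝ → ℝ} {c ε m : ℝ}
    (h : ∀ s ∈ Metric.ball c ε, HasDerivAt f m s) {a b : ℝ} (ha : a ∈ Metric.ball c ε)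
    (hb : b ∈ Metric.ball c ε) : f a = f b + m * (a - b) := by
  have := eq_of_hasDerivAt_zero (f := fun s => f s - m * s) (c := c) (ε := ε)
    (fun s hs => ((h s hs).sub ((hasDerivAt_id s).const_mul m)).congr_deriv (by simp)) ha hb
  linear_combination this

theorem eq_of_pU_eq_zero {F : Pt → ℝ} {p : Pt} {ε : ℝ}
    (hF : ContDiffOn ℝ ∞ F (Metric.ball p ε)) (h : ∀ r ∈ Metric.ball p ε, pU F r = 0)
    {q : Base} {u v : ℝ} (hu : (q, u) ∈ Metric.ball p ε) (hv : (q, v) ∈ Metric.ball p ε) :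
    F (q, u) = F (q, v) := by
  have hu' := mem_ball_pt.1 hu
  refine eq_of_hasDerivAt_zero (f := fun s => F (q, s)) (c := p.2) (ε := ε) (fun s hs => ?_)
    hu'.2 (mem_ball_pt.1 hv).2
  have hm : (q, s) ∈ Metric.ball p ε := mem_ball_pt.2 ⟨hu'.1, hs⟩
  rw [← h _ hm]
  exact hasDerivAt_pU (differentiableAt_of_contDiffOn Metric.isOpen_ball hF hm)

theorem eq_of_pX_eq_zero {F : Pt → ℝ} {p : Pt} {ε : ℝ}
    (hF : ContDiffOn ℝ ∞ F (Metric.ball p ε)) (h : ∀ r ∈ Metric.ball p ε, pX F r = 0)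
    {t u x y : ℝ} (hx : ((t, x), u) ∈ Metric.ball p ε) (hy : ((t, y), u) ∈ Metric.ball p ε) :
    F ((t, x), u) = F ((t, y), u) := by
  have hx' := mem_ball_pt.1 hx
  refine eq_of_hasDerivAt_zero (f := fun s => F ((t, s), u)) (c := p.1.2) (ε := ε) (fun s hs => ?_)
    hx'.1.2 (mem_ball_pt.1 hy).1.2
  have hm : ((t, s), u) ∈ Metric.ball p ε := mem_ball_pt.2 ⟨⟨hx'.1.1, hs⟩, hx'.2⟩
  rw [← h _ hm]
  exact hasDerivAt_pX (differentiableAt_of_contDiffOn Metric.isOpen_ball hF hm)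

/-! ### The `x`- and `u`-components of an admissible transformation -/

section Admissible
variable {θ θ' : ArbTuple} {φ : OpenPartialHomeomorph Pt Pt}

theorem compT_eq_of_mem_ball (h : (θ, φ, θ') ∈ equivalenceGroupoid) {p : Pt} {ε : ℝ}
    (hsub : Metric.ball p ε ⊆ φ.source) {r : Pt} (hr : r ∈ Metric.ball p ε) :
    compT φ r = compT φ ((r.1.1, p.1.2), p.2) := by
  have hc : ContDiffOn ℝ ∞ (compT φ) (Metric.ball p ε) := (contDiffOn_compT h.2.1).mono hsub
  have hr' := mem_ball_pt.1 hr
  have hε : 0 < ε := Metric.pos_of_mem_ball hr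
  have hx := Metric.mem_ball_self (x := p.1.2) hε
  have hu := Metric.mem_ball_self (x := p.2) hε
  obtain ⟨⟨t, x⟩, u⟩ := r
  have h1 : ((t, p.1.2), u) ∈ Metric.ball p ε := mem_ball_pt.2 ⟨⟨hr'.1.1, hx⟩, hr'.2⟩
  have h2 : ((t, p.1.2), p.2) ∈ Metric.ball p ε := mem_ball_pt.2 ⟨⟨hr'.1.1, hx⟩, hu⟩
  rw [eq_of_pX_eq_zero hc (fun r hr => (compT_derivs_eq_zero h (hsub hr)).1) hr h1,
    eq_of_pU_eq_zero hc (fun r hr => (compT_derivs_eq_zero h (hsub hr)).2) h1 h2]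

/-- Every jet `(u, u_x, u_xx) = (u, b, c)` extends to a source jet by solving the equation for `u_t
= a`. It is realized by a polynomial, whose image must satisfy the target equation; this turns the
condition on `φ` into algebraic relations with free `b` and `c`. -/
theorem exists_jets (h : (θ, φ, θ') ∈ equivalenceGroupoid) {t x u : ℝ}
    (hp : ((t, x), u) ∈ φ.source) {p : Pt} (hpe : p = ((t, x), u)) (b c a : ℝ)
    (ha : a = (θ.val (t, x)).a2 * c + ((θ.val (t, x)).a11 * x + (θ.val (t, x)).a10) * b - u * b)
    (hJ : pT (compT φ) p * (pX (compX φ) p + pU (compX φ) p * b) ≠ 0) :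
    ∃ gt gx gxx : ℝ,
      pT (compU φ) p + pU (compU φ) p * a =
        gt * pT (compT φ) p + gx * (pT (compX φ) p + pU (compX φ) p * a) ∧
      pX (compU φ) p + pU (compU φ) p * b = gx * (pX (compX φ) p + pU (compX φ) p * b) ∧
      pX (pX (compU φ)) p + 2 * pX (pU (compU φ)) p * b + pU (pU (compU φ)) p * b ^ 2
          + pU (compU φ) p * c =
        gxx * (pX (compX φ) p + pU (compX φ) p * b) ^ 2
        + gx * (pX (pX (compX φ)) p + 2 * pX (pU (compX φ)) p * b
          + pU (pU (compX φ)) p * b ^ 2 + pU (compX φ) p * c) ∧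
      gt + compU φ p * gx = (θ'.val (φ p).1).a2 * gxx
        + ((θ'.val (φ p).1).a11 * compX φ p + (θ'.val (φ p).1).a10) * gx := by
  subst hpe
  set f := quad (t, x) u a b c 0 with hf
  have hfu : f (t, x) = u := quad_self _ _ _ _ _ _
  have hfa : dt f (t, x) = a := dt_quad _ _ _ _ _ _
  have hfb : dx f (t, x) = b := by rw [hf, dx_quad]; simp
  have hfc : dx (dx f) (t, x) = c := dx_dx_quad _ _ _ _ _ _
  have hfs : ContDiff ℝ ∞ f := contDiff_quad _ _ _ _ _ _
  obtain ⟨z1, z2⟩ := compT_derivs_eq_zero h hp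
  obtain ⟨g, hg, hm⟩ := exists_image_graph h.2.1 (f := f) (q := (t, x)) (by rw [hfu]; exact hp) hfs
    (by
      rw [hfu, hfa, hfb]; unfold graphJac
      dsimp only
      rw [z1, z2]; simpa using hJ)
  have hsat : SatisfiesAt θ f (t, x) := by
    unfold SatisfiesAt
    rw [hfu, hfa, hfb, hfc, ha]; ring
  have hsat' := (h.2.2.2 (t, x) f g (by rw [hfu]; exact hp)
    (hfs.contDiffAt.of_le two_le_infty) (hg.of_le two_le_infty) hm).1 hsat
  rw [hfu] at hg hsat'
  obtain ⟨ε, hε, hsub⟩ := Metric.isOpen_iff.1 φ.open_source _ hp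
  have hpb := Metric.mem_ball_self (x := (((t, x), u) : Pt)) hε
  have hT : HasDerivAt (fun s => compT φ ((s, x), u)) (pT (compT φ) ((t, x), u)) t :=
    hasDerivAt_pT (differentiableAt_of_contDiffOn φ.open_source (contDiffOn_compT h.2.1) hp)
  have hgraph : ContinuousAt (fun r : Base => ((r, f r) : Pt)) (t, x) :=
    continuousAt_id.prodMk hfs.continuous.continuousAt
  have := jet_relations (U := Metric.ball ((t, x), u) ε) Metric.isOpen_ball
    ((contDiffOn_compX h.2.1).mono hsub) ((contDiffOn_compU h.2.1).mono hsub)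
    hT (f := f) (g := g) (p := ((t, x), u)) (by rw [hfu]) hpb
    (hfs.contDiffAt.of_le two_le_infty) (q' := (φ ((t, x), u)).1) rfl (hg.of_le two_le_infty) (by
      filter_upwards [hm.1, hgraph.eventually (Metric.isOpen_ball.mem_nhds
        (by simp only [hfu]; exact hpb))] with r h1 h2
      rw [← compT_eq_of_mem_ball h hsub h2]
      exact h1)
  rw [hfa, hfb, hfc] at this
  obtain ⟨e1, e2, e3⟩ := this
  refine ⟨_, _, _, e1, e2, e3, ?_⟩
  have hv : g (φ ((t, x), u)).1 = compU φ ((t, x), u) := by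
    have := hm.1.self_of_nhds
    rw [hfu] at this
    exact this.symm
  unfold SatisfiesAt at hsat'
  rw [hv] at hsat'
  exact hsat'

theorem nondegenerate (h : (θ, φ, θ') ∈ equivalenceGroupoid) {p : Pt} (hp : p ∈ φ.source) :
    pT (compT φ) p ≠ 0 ∧
      pX (compX φ) p * pU (compU φ) p - pU (compX φ) p * pX (compU φ) p ≠ 0 := by
  have hjac := jacobian_ne_zero h.2.1 h.2.2.1 hp
  obtain ⟨z1, z2⟩ := compT_derivs_eq_zero h hp
  dsimp only at hjac
  rw [z1, z2, zero_mul, zero_mul, sub_zero, add_zero] at hjac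
  exact mul_ne_zero_iff.1 hjac

/-- The jets with `u_xx = 0` and `u_xx = 1` and the same `u`, `u_x` have the same image slope `gx`.
Subtracting their relations compares the increments of `gt` and `gxx`, and the common factor `η_u -
gx ξ_u` is nonzero by nondegeneracy. -/
theorem a2_relation (h : (θ, φ, θ') ∈ equivalenceGroupoid) {p : Pt} (hp : p ∈ φ.source) {b : ℝ}
    (hb : pX (compX φ) p + pU (compX φ) p * b ≠ 0) :
    (θ.val p.1).a2 * (pX (compX φ) p + pU (compX φ) p * b) ^ 2 =
      (θ'.val (φ p).1).a2 * pT (compT φ) p := by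
  obtain ⟨hT, hK⟩ := nondegenerate h hp
  obtain ⟨⟨t, x⟩, u⟩ := p
  obtain ⟨gt, gx, gxx, e1, e2, e3, e4⟩ := exists_jets h hp rfl b 0 _ rfl (mul_ne_zero hT hb)
  obtain ⟨gt', gx', gxx', e1', e2', e3', e4'⟩ := exists_jets h hp rfl b 1 _ rfl (mul_ne_zero hT hb)
  have hx : gx' = gx := mul_right_cancel₀ hb (e2'.symm.trans e2)
  subst hx
  set p : Pt := ((t, x), u)
  set D := pX (compX φ) p + pU (compX φ) p * b
  have hK' : pU (compU φ) p - gx' * pU (compX φ) p ≠ 0 := by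
    intro h0
    apply hK
    have e2'' : pX (compU φ) p + pU (compU φ) p * b
      = gx' * (pX (compX φ) p + pU (compX φ) p * b) := e2
    linear_combination pX (compX φ) p * h0 - pU (compX φ) p * e2'' + pU (compX φ) p * b * h0
  refine mul_right_cancel₀ hK' ?_
  linear_combination D ^ 2 * (e1' - e1) + D ^ 2 * pT (compT φ) p * (e4' - e4)
    - (θ'.val (φ p).1).a2 * pT (compT φ) p * (e3' - e3)

/-- In `a2_relation` only the factor `(ξ_x + ξ_u b)²` depends on `b`. If `ξ_u ≠ 0`, this base takes
both values `1` and `2`. -/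
theorem pU_compX_eq_zero (h : (θ, φ, θ') ∈ equivalenceGroupoid) {p : Pt} (hp : p ∈ φ.source) :
    pU (compX φ) p = 0 := by
  by_contra hu
  have h1 := a2_relation h hp (b := (1 - pX (compX φ) p) / pU (compX φ) p) (by
    field_simp; simp)
  have h2 := a2_relation h hp (b := (2 - pX (compX φ) p) / pU (compX φ) p) (by
    field_simp; simp)
  rw [← h1] at h2
  have hA := θ.a2_ne p.1 (h.1.1 p hp)
  have h3 := mul_left_cancel₀ hA h2
  field_simp at h3
  norm_num at h3

/-- The determining equations for the components of an admissible transformation. -/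
theorem determining_equations (h : (θ, φ, θ') ∈ equivalenceGroupoid) {t x u : ℝ} {p : Pt}
    (hpe : p = ((t, x), u)) (hp : p ∈ φ.source) :
    pX (compX φ) p ≠ 0 ∧ pU (compU φ) p ≠ 0 ∧
    (θ.val (t, x)).a2 * pX (compX φ) p ^ 2 = (θ'.val (φ p).1).a2 * pT (compT φ) p ∧
    pU (pU (compU φ)) p = 0 ∧
    pX (compX φ) p * ((θ.val (t, x)).a11 * x + (θ.val (t, x)).a10 - u) * pU (compU φ) p
      - pU (compU φ) p * pT (compX φ) p + pT (compT φ) p * compU φ p * pU (compU φ) p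
      - (θ.val (t, x)).a2 * (2 * pX (compX φ) p * pX (pU (compU φ)) p
        - pU (compU φ) p * pX (pX (compX φ)) p)
      - pT (compT φ) p * ((θ'.val (φ p).1).a11 * compX φ p + (θ'.val (φ p).1).a10)
        * pU (compU φ) p = 0 ∧
    pX (compX φ) p * pT (compU φ) p
      - pX (compU φ) p * pT (compX φ) p + pT (compT φ) p * compU φ p * pX (compU φ) p
      - (θ.val (t, x)).a2 * (pX (compX φ) p * pX (pX (compU φ)) p
        - pX (compU φ) p * pX (pX (compX φ)) p)
      - pT (compT φ) p * ((θ'.val (φ p).1).a11 * compX φ p + (θ'.val (φ p).1).a10)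
        * pX (compU φ) p = 0 := by
  obtain ⟨hT, hK⟩ := nondegenerate h hp
  have hu := pU_compX_eq_zero h hp
  rw [hu, zero_mul, sub_zero] at hK
  obtain ⟨hX, hU⟩ := mul_ne_zero_iff.1 hK
  have hA := a2_relation h hp (b := 0) (by simpa [hu] using hX)
  rw [mul_zero, add_zero] at hA
  have hz : ∀ᶠ r in 𝓝 p, pU (compX φ) r = 0 := by
    filter_upwards [φ.open_source.mem_nhds hp] with r hr
    exact pU_compX_eq_zero h hr
  have hz' : fderiv ℝ (pU (compX φ)) p = 0 := by
    have : pU (compX φ) =ᶠ[𝓝 p] fun _ => 0 := hz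
    rw [this.fderiv_eq]; simp
  have huu : pU (pU (compX φ)) p = 0 := by
    change fderiv ℝ (pU (compX φ)) p _ = 0
    rw [hz']; rfl
  have hxu : pX (pU (compX φ)) p = 0 := by
    change fderiv ℝ (pU (compX φ)) p _ = 0
    rw [hz']; rfl
  -- Jets with `u_xx = 0` suffice, as `a2_relation` already records the dependence on `u_xx`.
  -- Eliminating the image jet leaves a polynomial identity of degree two in `b = u_x`.
  have key : ∀ b : ℝ,
      pX (compX φ) p * (pT (compU φ) p
          + ((θ.val (t, x)).a11 * x + (θ.val (t, x)).a10 - u) * b * pU (compU φ) p)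
        - (pX (compU φ) p + b * pU (compU φ) p) * pT (compX φ) p
        + pT (compT φ) p * compU φ p * (pX (compU φ) p + b * pU (compU φ) p)
        - (θ.val (t, x)).a2 * (pX (compX φ) p * (pX (pX (compU φ)) p + 2 * b * pX (pU (compU φ)) p
          + b ^ 2 * pU (pU (compU φ)) p)
          - (pX (compU φ) p + b * pU (compU φ) p) * pX (pX (compX φ)) p)
        - pT (compT φ) p * ((θ'.val (φ p).1).a11 * compX φ p + (θ'.val (φ p).1).a10)
          * (pX (compU φ) p + b * pU (compU φ) p) = 0 := by
    intro b
    obtain ⟨gt, gx, gxx, e1, e2, e3, e4⟩ := exists_jets h (hpe ▸ hp) hpe b 0 _ rfl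
      (by rw [hu, zero_mul, add_zero]; exact mul_ne_zero hT hX)
    rw [hu] at e1 e2 e3
    rw [huu, hxu] at e3
    have hA' : (θ.val (t, x)).a2 * pX (compX φ) p ^ 2
      = (θ'.val (φ p).1).a2 * pT (compT φ) p := by rw [← hA, hpe]
    set ξx := pX (compX φ) p
    set T' := pT (compT φ) p
    have G : pX (compU φ) p + b * pU (compU φ) p = gx * ξx := by linear_combination e2
    rw [G]
    linear_combination ξx * e1 - (θ.val (t, x)).a2 * ξx * e3 + T' * ξx * e4 - ξx * gxx * hA'
  -- The values at `0, 1, -1` separate the three coefficients of this polynomial.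
  have k0 := key 0
  have k1 := key 1
  have k2 := key (-1)
  have hA2 := θ.a2_ne p.1 (h.1.1 p hp)
  refine ⟨hX, hU, by rw [← hA, hpe], ?_, ?_, ?_⟩
  · have : (θ.val p.1).a2 * pX (compX φ) p * pU (pU (compU φ)) p = 0 := by
      rw [show p.1 = (t, x) by rw [hpe]]
      linear_combination k0 - (k1 + k2) / 2
    exact (mul_eq_zero.1 this).resolve_left (mul_ne_zero hA2 hX)
  · linear_combination (k1 - k2) / 2
  · linear_combination k0

end Admissible

/-! ### Local form of the arbitrary elements -/

theorem contDiffOn_dx_base {F : Base → ℝ} {U : Set Base} (hU : IsOpen U)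
    (hF : ContDiffOn ℝ ∞ F U) : ContDiffOn ℝ ∞ (dx F) U := by
  refine ((hF.fderiv_of_isOpen (m := ∞) hU (by simp)).clm_apply
    (contDiffOn_const (c := ((0, 1) : Base)))).congr fun q hq => ?_
  rw [fderiv_base_apply F (differentiableAt_of_contDiffOn hU hF hq)]
  simp

theorem contDiffOn_slice_fst {E : Type*} [NormedAddCommGroup E] [NormedSpace ℝ E] {F : Base → E}
    {q : Base} {ε : ℝ} (hF : ContDiffOn ℝ ∞ F (Metric.ball q ε)) {x : ℝ}
    (hx : x ∈ Metric.ball q.2 ε) : ContDiffOn ℝ ∞ (fun t => F (t, x)) (Metric.ball q.1 ε) :=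
  hF.comp (contDiff_id.prodMk contDiff_const).contDiffOn
    fun _ ht => mem_ball_base.2 ⟨ht, hx⟩

theorem eq_of_dx_eq_zero {F : Base → ℝ} {q : Base} {ε : ℝ}
    (hF : ContDiffOn ℝ ∞ F (Metric.ball q ε)) (h : ∀ r ∈ Metric.ball q ε, dx F r = 0)
    {t x y : ℝ} (hx : (t, x) ∈ Metric.ball q ε) (hy : (t, y) ∈ Metric.ball q ε) :
    F (t, x) = F (t, y) := by
  have hx' := mem_ball_base.1 hx
  refine eq_of_hasDerivAt_zero (f := fun s => F (t, s)) (c := q.2) (ε := ε) (fun s hs => ?_)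
    hx'.2 (mem_ball_base.1 hy).2
  have hm : (t, s) ∈ Metric.ball q ε := mem_ball_base.2 ⟨hx'.1, hs⟩
  rw [← h _ hm]
  exact hasDerivAt_dx (differentiableAt_of_contDiffOn Metric.isOpen_ball hF hm)

/-- On a ball around `q`, the `x`-independent components of `θ` are given by functions of `t`. -/
structure LocalForm (θ : ArbTuple) (q : Base) (ε : ℝ) (a10 a11 y0 y1 y2 : ℝ → ℝ) : Prop where
  sub : Metric.ball q ε ⊆ θ.dom
  s10 : ContDiffOn ℝ ∞ a10 (Metric.ball q.1 ε)
  s11 : ContDiffOn ℝ ∞ a11 (Metric.ball q.1 ε)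
  d0 : ∀ t ∈ Metric.ball q.1 ε, HasDerivAt y0 (a11 t) t
  d1 : ∀ t ∈ Metric.ball q.1 ε, HasDerivAt y1 (Real.exp (y0 t)) t
  d2 : ∀ t ∈ Metric.ball q.1 ε, HasDerivAt y2 (a10 t * Real.exp (y0 t)) t
  s0 : ContDiffOn ℝ ∞ y0 (Metric.ball q.1 ε)
  s1 : ContDiffOn ℝ ∞ y1 (Metric.ball q.1 ε)
  s2 : ContDiffOn ℝ ∞ y2 (Metric.ball q.1 ε)
  e10 : ∀ r ∈ Metric.ball q ε, (θ.val r).a10 = a10 r.1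
  e11 : ∀ r ∈ Metric.ball q ε, (θ.val r).a11 = a11 r.1
  e0 : ∀ r ∈ Metric.ball q ε, (θ.val r).y0 = y0 r.1
  e1 : ∀ r ∈ Metric.ball q ε, (θ.val r).y1 = y1 r.1
  e2 : ∀ r ∈ Metric.ball q ε, (θ.val r).y2 = y2 r.1

theorem LocalForm.mono {θ : ArbTuple} {q : Base} {ε δ : ℝ} {a10 a11 y0 y1 y2 : ℝ → ℝ}
    (h : LocalForm θ q ε a10 a11 y0 y1 y2) (hδ : δ ≤ ε) : LocalForm θ q δ a10 a11 y0 y1 y2 := by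
  have b1 := Metric.ball_subset_ball (x := q) hδ
  have b2 := Metric.ball_subset_ball (x := q.1) hδ
  exact ⟨b1.trans h.sub, h.s10.mono b2, h.s11.mono b2, fun t ht => h.d0 t (b2 ht),
    fun t ht => h.d1 t (b2 ht), fun t ht => h.d2 t (b2 ht), h.s0.mono b2, h.s1.mono b2,
    h.s2.mono b2, fun r hr => h.e10 r (b1 hr), fun r hr => h.e11 r (b1 hr),
    fun r hr => h.e0 r (b1 hr), fun r hr => h.e1 r (b1 hr), fun r hr => h.e2 r (b1 hr)⟩

theorem contDiff_a10 : ContDiff ℝ ∞ Arb.a10 := by unfold Arb.a10; fun_prop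
theorem contDiff_a11 : ContDiff ℝ ∞ Arb.a11 := by unfold Arb.a11; fun_prop
theorem contDiff_a2 : ContDiff ℝ ∞ Arb.a2 := by unfold Arb.a2; fun_prop
theorem contDiff_y0 : ContDiff ℝ ∞ Arb.y0 := by unfold Arb.y0; fun_prop
theorem contDiff_y1 : ContDiff ℝ ∞ Arb.y1 := by unfold Arb.y1; fun_prop
theorem contDiff_y2 : ContDiff ℝ ∞ Arb.y2 := by unfold Arb.y2; fun_prop

theorem exists_localForm (θ : ArbTuple) {q : Base} (hq : q ∈ θ.dom) :
    ∃ ε > 0, ∃ a10 a11 y0 y1 y2, LocalForm θ q ε a10 a11 y0 y1 y2 := by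
  obtain ⟨ε, hε, hsub⟩ := Metric.isOpen_iff.1 θ.isOpen_dom q hq
  have hs : ∀ {c : Arb → ℝ}, ContDiff ℝ ∞ c →
      ContDiffOn ℝ ∞ (fun r => c (θ.val r)) (Metric.ball q ε) :=
    fun hc => hc.comp_contDiffOn (θ.smooth.mono hsub)
  have hx := Metric.mem_ball_self (x := q.2) hε
  have hD : ∀ {c : Arb → ℝ}, ContDiff ℝ ∞ c → ∀ t ∈ Metric.ball q.1 ε,
      HasDerivAt (fun t => c (θ.val (t, q.2))) (dt (fun r => c (θ.val r)) (t, q.2)) t :=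
    fun hc t ht => hasDerivAt_dt (F := fun r => _)
      (differentiableAt_of_contDiffOn Metric.isOpen_ball (hs hc) (mem_ball_base.2 ⟨ht, hx⟩))
  have hE : ∀ {c : Arb → ℝ}, ContDiff ℝ ∞ c →
      (∀ r ∈ θ.dom, dx (fun r => c (θ.val r)) r = 0) →
      ∀ r ∈ Metric.ball q ε, c (θ.val r) = c (θ.val (r.1, q.2)) := by
    intro c hc h0 r hr
    exact eq_of_dx_eq_zero (hs hc) (fun r hr => h0 r (hsub hr)) (x := r.2) hr
      (mem_ball_base.2 ⟨(mem_ball_base.1 hr).1, hx⟩)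
  refine ⟨ε, hε, fun t => (θ.val (t, q.2)).a10, fun t => (θ.val (t, q.2)).a11,
    fun t => (θ.val (t, q.2)).y0, fun t => (θ.val (t, q.2)).y1, fun t => (θ.val (t, q.2)).y2, ?_⟩
  exact
  { sub := hsub
    s10 := contDiffOn_slice_fst (hs contDiff_a10) hx
    s11 := contDiffOn_slice_fst (hs contDiff_a11) hx
    s0 := contDiffOn_slice_fst (hs contDiff_y0) hx
    s1 := contDiffOn_slice_fst (hs contDiff_y1) hx
    s2 := contDiffOn_slice_fst (hs contDiff_y2) hx
    d0 := fun t ht => (hD contDiff_y0 t ht).congr_deriv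
      (θ.y0_t _ (hsub (mem_ball_base.2 ⟨ht, hx⟩)))
    d1 := fun t ht => (hD contDiff_y1 t ht).congr_deriv
      (θ.y1_t _ (hsub (mem_ball_base.2 ⟨ht, hx⟩)))
    d2 := fun t ht => (hD contDiff_y2 t ht).congr_deriv
      (θ.y2_t _ (hsub (mem_ball_base.2 ⟨ht, hx⟩)))
    e10 := hE contDiff_a10 θ.a10_x
    e11 := hE contDiff_a11 θ.a11_x
    e0 := hE contDiff_y0 θ.y0_x
    e1 := hE contDiff_y1 θ.y1_x
    e2 := hE contDiff_y2 θ.y2_x }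

/-! ### Solving the determining equations -/

theorem quadratic_coeff_zero {c0 c1 c2 v ε : ℝ} (hε : 0 < ε)
    (h : ∀ u ∈ Metric.ball v ε, c2 * u ^ 2 + c1 * u + c0 = 0) : c2 = 0 ∧ c1 = 0 ∧ c0 = 0 := by
  have hm : ∀ s : ℝ, |s| < ε → v + s ∈ Metric.ball v ε := by
    intro s hs; simpa [Real.dist_eq] using hs
  have h0 := h _ (hm 0 (by simpa using hε))
  have h1 := h _ (hm (ε / 2) (by rw [abs_of_pos (by positivity)]; linarith))
  have h2 := h _ (hm (-(ε / 2)) (by rw [abs_neg, abs_of_pos (by positivity)]; linarith))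
  have e2 : c2 = 0 := by
    have : c2 * ε ^ 2 = 0 := by linear_combination 2 * (h1 + h2 - 2 * h0)
    exact (mul_eq_zero.1 this).resolve_right (by positivity)
  subst e2
  have e1 : c1 = 0 := by
    have : c1 * ε = 0 := by linear_combination h1 - h2
    exact (mul_eq_zero.1 this).resolve_right hε.ne'
  subst e1
  exact ⟨rfl, rfl, by linear_combination h0⟩

theorem hasDerivAt_deriv_of_contDiffOn {f : ℝ → ℝ} {I : Set ℝ} (hI : IsOpen I)
    (hf : ContDiffOn ℝ ∞ f I) {t : ℝ} (ht : t ∈ I) : HasDerivAt f (deriv f t) t :=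
  (differentiableAt_of_contDiffOn hI hf ht).hasDerivAt

/-- Both equations are polynomial in `u` on an interval, so their coefficients vanish separately.
What remains after determining the shape of `α`, `β`, `Ξ` is affine in `x` and is split once more.
-/
theorem solve_determining_equations {q : Base} {v ε : ℝ} (hε : 0 < ε) {T a10 a11 b10 b11 : ℝ → ℝ}
    {A α β Ξ : Base → ℝ} (hT : ContDiffOn ℝ ∞ T (Metric.ball q.1 ε))
    (hα : ContDiffOn ℝ ∞ α (Metric.ball q ε)) (hβ : ContDiffOn ℝ ∞ β (Metric.ball q ε))
    (hΞ : ContDiffOn ℝ ∞ Ξ (Metric.ball q ε))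
    (hT0 : ∀ t ∈ Metric.ball q.1 ε, deriv T t ≠ 0)
    (hα0 : ∀ r ∈ Metric.ball q ε, α r ≠ 0)
    (h1 : ∀ r ∈ Metric.ball q ε, ∀ u ∈ Metric.ball v ε,
      dx Ξ r * (a11 r.1 * r.2 + a10 r.1 - u) * α r - α r * dt Ξ r
      + deriv T r.1 * (α r * u + β r) * α r
      - A r * (2 * dx Ξ r * dx α r - α r * dx (dx Ξ) r)
      - deriv T r.1 * (b11 r.1 * Ξ r + b10 r.1) * α r = 0)
    (h0 : ∀ r ∈ Metric.ball q ε, ∀ u ∈ Metric.ball v ε,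
      dx Ξ r * (dt α r * u + dt β r) - (dx α r * u + dx β r) * dt Ξ r
      + deriv T r.1 * (α r * u + β r) * (dx α r * u + dx β r)
      - A r * (dx Ξ r * (dx (dx α) r * u + dx (dx β) r)
        - (dx α r * u + dx β r) * dx (dx Ξ) r)
      - deriv T r.1 * (b11 r.1 * Ξ r + b10 r.1) * (dx α r * u + dx β r) = 0) :
    ∃ w k b : ℝ → ℝ, ContDiffOn ℝ ∞ w (Metric.ball q.1 ε) ∧ ContDiffOn ℝ ∞ k (Metric.ball q.1 ε) ∧
      ContDiffOn ℝ ∞ b (Metric.ball q.1 ε) ∧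
      (∀ r ∈ Metric.ball q ε, α r = w r.1 ∧ β r = b r.1 - deriv w r.1 * r.2 ∧
        Ξ r = deriv T r.1 * w r.1 * r.2 + k r.1) ∧
      (∀ t ∈ Metric.ball q.1 ε, deriv (deriv w) t = a11 t * deriv w t ∧
        deriv b t = - (a10 t * deriv w t) ∧
        deriv T t * w t * a11 t - (deriv (deriv T) t * w t + deriv T t * deriv w t)
          - deriv T t * deriv w t - deriv T t ^ 2 * b11 t * w t = 0 ∧
        deriv T t * w t * a10 t - deriv k t + deriv T t * b t
          - deriv T t * (b11 t * k t + b10 t) = 0) := by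
  have hbo := Metric.isOpen_ball (x := q) (ε := ε)
  have hIo := Metric.isOpen_ball (x := q.1) (ε := ε)
  have hx0 := Metric.mem_ball_self (x := q.2) hε
  -- The coefficient of `u` in `h1` is `α (T_t α - Ξ_x)`.
  have H1 : ∀ r ∈ Metric.ball q ε, dx Ξ r = deriv T r.1 * α r := by
    intro r hr
    obtain ⟨-, e1, -⟩ := quadratic_coeff_zero (c2 := 0)
      (c1 := α r * (deriv T r.1 * α r - dx Ξ r))
      (c0 := dx Ξ r * (a11 r.1 * r.2 + a10 r.1) * α r - α r * dt Ξ r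
        + deriv T r.1 * β r * α r - A r * (2 * dx Ξ r * dx α r - α r * dx (dx Ξ) r)
        - deriv T r.1 * (b11 r.1 * Ξ r + b10 r.1) * α r) hε
      (fun u hu => by linear_combination h1 r hr u hu)
    linear_combination -((mul_eq_zero.1 e1).resolve_left (hα0 r hr))
  -- The coefficients of `u²`, `u`, `1` in `h0` will give in turn `α_x = 0`, `β_x = -w_t` and the
  -- equation for `β_t`.
  have H0 := fun r hr => quadratic_coeff_zero (c2 := deriv T r.1 * α r * dx α r)
      (c1 := dx Ξ r * dt α r - dx α r * dt Ξ r + deriv T r.1 * (α r * dx β r + β r * dx α r)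
        - A r * (dx Ξ r * dx (dx α) r - dx α r * dx (dx Ξ) r)
        - deriv T r.1 * (b11 r.1 * Ξ r + b10 r.1) * dx α r)
      (c0 := dx Ξ r * dt β r - dx β r * dt Ξ r + deriv T r.1 * β r * dx β r
        - A r * (dx Ξ r * dx (dx β) r - dx β r * dx (dx Ξ) r)
        - deriv T r.1 * (b11 r.1 * Ξ r + b10 r.1) * dx β r) hε
      (fun u hu => by linear_combination h0 r hr u hu)
  have hTα : ∀ r ∈ Metric.ball q ε, deriv T r.1 * α r ≠ 0 := fun r hr =>
    mul_ne_zero (hT0 _ (mem_ball_base.1 hr).1) (hα0 r hr)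
  have Hαx : ∀ r ∈ Metric.ball q ε, dx α r = 0 := fun r hr =>
    (mul_eq_zero.1 (H0 r hr).1).resolve_left (hTα r hr)
  have hloc : ∀ {F G : Base → ℝ}, (∀ r ∈ Metric.ball q ε, F r = G r) →
      ∀ r ∈ Metric.ball q ε, dx F r = dx G r := by
    intro F G hFG r hr
    refine Filter.EventuallyEq.deriv_eq ?_
    have hl : Tendsto (fun s : ℝ => ((r.1, s) : Base)) (𝓝 r.2) (𝓝 (r.1, r.2)) :=
      (by fun_prop : Continuous fun s : ℝ => ((r.1, s) : Base)).tendsto r.2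
    filter_upwards [hl.eventually (hbo.mem_nhds hr)] with s hs
    exact hFG _ hs
  have hloct : ∀ {F G : Base → ℝ}, (∀ r ∈ Metric.ball q ε, F r = G r) →
      ∀ r ∈ Metric.ball q ε, dt F r = dt G r := by
    intro F G hFG r hr
    refine Filter.EventuallyEq.deriv_eq ?_
    have hl : Tendsto (fun s : ℝ => ((s, r.2) : Base)) (𝓝 r.1) (𝓝 (r.1, r.2)) :=
      (by fun_prop : Continuous fun s : ℝ => ((s, r.2) : Base)).tendsto r.1
    filter_upwards [hl.eventually (hbo.mem_nhds hr)] with s hs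
    exact hFG _ hs
  have Hαxx : ∀ r ∈ Metric.ball q ε, dx (dx α) r = 0 := by
    intro r hr
    rw [hloc (G := fun _ => 0) Hαx r hr]
    simp [dx]
  set w : ℝ → ℝ := fun t => α (t, q.2) with hw
  have hws : ContDiffOn ℝ ∞ w (Metric.ball q.1 ε) := contDiffOn_slice_fst hα hx0
  have hmem0 : ∀ {t : ℝ}, t ∈ Metric.ball q.1 ε → (t, q.2) ∈ Metric.ball q ε :=
    fun ht => mem_ball_base.2 ⟨ht, hx0⟩
  have Hw : ∀ r ∈ Metric.ball q ε, α r = w r.1 := fun r hr =>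
    eq_of_dx_eq_zero hα Hαx (x := r.2) hr (hmem0 (mem_ball_base.1 hr).1)
  have Hαt : ∀ r ∈ Metric.ball q ε, dt α r = deriv w r.1 := by
    intro r hr
    rw [hloct (G := fun r => w r.1) Hw r hr]
    rfl
  have HΞx : ∀ r ∈ Metric.ball q ε, dx Ξ r = deriv T r.1 * w r.1 := fun r hr => by
    rw [H1 r hr, Hw r hr]
  have HΞxx : ∀ r ∈ Metric.ball q ε, dx (dx Ξ) r = 0 := by
    intro r hr
    rw [hloc (G := fun r => deriv T r.1 * w r.1) HΞx r hr]
    simp [dx]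
  have Hβx : ∀ r ∈ Metric.ball q ε, dx β r = -deriv w r.1 := by
    intro r hr
    have e := (H0 r hr).2.1
    rw [Hαx r hr, Hαxx r hr, Hαt r hr, H1 r hr] at e
    have : deriv T r.1 * α r * (deriv w r.1 + dx β r) = 0 := by linear_combination e
    linear_combination (mul_eq_zero.1 this).resolve_left (hTα r hr)
  have Hβxx : ∀ r ∈ Metric.ball q ε, dx (dx β) r = 0 := by
    intro r hr
    rw [hloc (G := fun r => -deriv w r.1) Hβx r hr]
    simp [dx]
  have hline : ∀ {F : Base → ℝ} {m : ℝ → ℝ}, ContDiffOn ℝ ∞ F (Metric.ball q ε) →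
      (∀ r ∈ Metric.ball q ε, dx F r = m r.1) → ∀ r ∈ Metric.ball q ε,
        F r = F (r.1, q.2) + m r.1 * (r.2 - q.2) := by
    intro F m hF hm r hr
    have hr' := mem_ball_base.1 hr
    refine eq_add_mul_of_hasDerivAt (f := fun s => F (r.1, s)) (c := q.2) (ε := ε)
      (fun s hs => ?_) hr'.2 hx0
    have hms : (r.1, s) ∈ Metric.ball q ε := mem_ball_base.2 ⟨hr'.1, hs⟩
    rw [← hm _ hms]
    exact hasDerivAt_dx (differentiableAt_of_contDiffOn hbo hF hms)
  have hdT : ContDiffOn ℝ ∞ (deriv T) (Metric.ball q.1 ε) := hT.deriv_of_isOpen hIo (by simp)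
  have hdw : ContDiffOn ℝ ∞ (deriv w) (Metric.ball q.1 ε) := hws.deriv_of_isOpen hIo (by simp)
  -- The slices are taken at `x = q.2`; subtracting the linear part converts them to the
  -- coefficients of `x⁰`.
  set k : ℝ → ℝ := fun t => Ξ (t, q.2) - deriv T t * w t * q.2 with hk
  set b : ℝ → ℝ := fun t => β (t, q.2) + deriv w t * q.2 with hb
  have hks : ContDiffOn ℝ ∞ k (Metric.ball q.1 ε) :=
    (contDiffOn_slice_fst hΞ hx0).sub ((hdT.mul hws).mul contDiffOn_const)
  have hbs : ContDiffOn ℝ ∞ b (Metric.ball q.1 ε) :=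
    (contDiffOn_slice_fst hβ hx0).add (hdw.mul contDiffOn_const)
  have HΞ : ∀ r ∈ Metric.ball q ε, Ξ r = deriv T r.1 * w r.1 * r.2 + k r.1 := by
    intro r hr
    rw [hline (m := fun t => deriv T t * w t) hΞ HΞx r hr, hk]
    ring
  have Hβ : ∀ r ∈ Metric.ball q ε, β r = b r.1 - deriv w r.1 * r.2 := by
    intro r hr
    rw [hline (m := fun t => -deriv w t) hβ Hβx r hr, hb]
    ring
  refine ⟨w, k, b, hws, hks, hbs, fun r hr => ⟨Hw r hr, Hβ r hr, HΞ r hr⟩, fun t ht => ?_⟩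
  have D := fun {f : ℝ → ℝ} (hf : ContDiffOn ℝ ∞ f (Metric.ball q.1 ε)) =>
    hasDerivAt_deriv_of_contDiffOn hIo hf ht
  have hmem : ∀ {x : ℝ}, x ∈ Metric.ball q.2 ε → (t, x) ∈ Metric.ball q ε :=
    fun hx => mem_ball_base.2 ⟨ht, hx⟩
  have HΞt : ∀ x ∈ Metric.ball q.2 ε, dt Ξ (t, x) =
      (deriv (deriv T) t * w t + deriv T t * deriv w t) * x + deriv k t := by
    intro x hx
    rw [hloct (G := fun r => deriv T r.1 * w r.1 * r.2 + k r.1) HΞ _ (hmem hx)]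
    exact ((((D hdT).mul (D hws)).mul_const x).add (D hks)).deriv
  have Hβt : ∀ x ∈ Metric.ball q.2 ε, dt β (t, x) = deriv b t - deriv (deriv w) t * x := by
    intro x hx
    rw [hloct (G := fun r => b r.1 - deriv w r.1 * r.2) Hβ _ (hmem hx)]
    exact ((D hbs).sub ((D hdw).mul_const x)).deriv
  have E1 : ∀ x ∈ Metric.ball q.2 ε, deriv T t * w t * (a11 t * x + a10 t) - dt Ξ (t, x)
      + deriv T t * β (t, x) - deriv T t * (b11 t * Ξ (t, x) + b10 t) = 0 := by
    intro x hx
    have e := h1 _ (hmem hx) v (Metric.mem_ball_self hε)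
    rw [HΞxx _ (hmem hx), Hαx _ (hmem hx), HΞx _ (hmem hx), Hw _ (hmem hx)] at e
    have hwt : w t ≠ 0 := hα0 _ (hmem0 ht)
    refine (mul_eq_zero.1 ?_).resolve_left hwt
    linear_combination e
  -- As `β_x = -w_t`, all terms containing `β_x` combine into a multiple of the relation `E1`.
  have E0 : ∀ x ∈ Metric.ball q.2 ε, dt β (t, x) = -deriv w t * (a11 t * x + a10 t) := by
    intro x hx
    have e := (H0 _ (hmem hx)).2.2
    rw [HΞxx _ (hmem hx), Hβxx _ (hmem hx), Hβx _ (hmem hx), HΞx _ (hmem hx)] at e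
    have hTw : deriv T t * w t ≠ 0 := hTα _ (hmem0 ht)
    refine mul_left_cancel₀ hTw ?_
    linear_combination e + deriv w t * E1 x hx
  obtain ⟨-, c1, c0⟩ := quadratic_coeff_zero (c2 := 0) (c1 := a11 t * deriv w t - deriv (deriv w) t)
    (c0 := deriv b t + a10 t * deriv w t) hε (fun x hx => by
      have e := E0 x hx
      rw [Hβt x hx] at e
      linear_combination e)
  obtain ⟨-, c1', c0'⟩ := quadratic_coeff_zero (c2 := 0)
    (c1 := deriv T t * w t * a11 t - (deriv (deriv T) t * w t + deriv T t * deriv w t)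
          - deriv T t * deriv w t - deriv T t ^ 2 * b11 t * w t)
    (c0 := deriv T t * w t * a10 t - deriv k t + deriv T t * b t
          - deriv T t * (b11 t * k t + b10 t)) hε (fun x hx => by
      have e := E1 x hx
      rw [HΞt x hx, Hβ _ (hmem hx), HΞ _ (hmem hx)] at e
      linear_combination e)
  exact ⟨by linear_combination -c1, by linear_combination c0, c1', c0'⟩

/-! ### Normal form of admissible transformations -/

theorem mem_ball_pt_iff_base {p r : Pt} {ε : ℝ} :
    r ∈ Metric.ball p ε ↔ r.1 ∈ Metric.ball p.1 ε ∧ r.2 ∈ Metric.ball p.2 ε := by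
  rw [← ball_prod_same]
  exact Set.mem_prod

theorem partials_of_affine {F : Pt → ℝ} {A B : Base → ℝ} {p : Pt} {ε : ℝ}
    (hA : ContDiffOn ℝ ∞ A (Metric.ball p.1 ε)) (hB : ContDiffOn ℝ ∞ B (Metric.ball p.1 ε))
    (hF : ∀ r ∈ Metric.ball p ε, F r = A r.1 * r.2 + B r.1) :
    ∀ r ∈ Metric.ball p ε, pT F r = dt A r.1 * r.2 + dt B r.1 ∧
      pX F r = dx A r.1 * r.2 + dx B r.1 ∧ pU F r = A r.1 := by
  intro r hr
  have hr' := mem_ball_pt_iff_base.1 hr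
  obtain ⟨⟨t, x⟩, u⟩ := r
  have hev : F =ᶠ[𝓝 ((t, x), u)] fun r => A r.1 * r.2 + B r.1 := by
    filter_upwards [Metric.isOpen_ball.mem_nhds hr] with r hr
    exact hF r hr
  have dA : DifferentiableAt ℝ A (t, x) :=
    differentiableAt_of_contDiffOn Metric.isOpen_ball hA hr'.1
  have dB : DifferentiableAt ℝ B (t, x) :=
    differentiableAt_of_contDiffOn Metric.isOpen_ball hB hr'.1
  have dF : DifferentiableAt ℝ F ((t, x), u) := by
    refine DifferentiableAt.congr_of_eventuallyEq ?_ hev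
    exact ((DifferentiableAt.comp (f := fun r : Pt => r.1) ((t, x), u) dA
      differentiableAt_fst).mul differentiableAt_snd).add
      (DifferentiableAt.comp (f := fun r : Pt => r.1) ((t, x), u) dB differentiableAt_fst)
  refine ⟨?_, ?_, ?_⟩
  · have hl : Tendsto (fun s : ℝ => (((s, x), u) : Pt)) (𝓝 t) (𝓝 ((t, x), u)) :=
      (by fun_prop : Continuous fun s : ℝ => (((s, x), u) : Pt)).tendsto t
    exact (hasDerivAt_pT dF).unique ((((hasDerivAt_dt dA).mul_const u).add
      (hasDerivAt_dt dB)).congr_of_eventuallyEq (hl.eventually hev))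
  · have hl : Tendsto (fun s : ℝ => (((t, s), u) : Pt)) (𝓝 x) (𝓝 ((t, x), u)) :=
      (by fun_prop : Continuous fun s : ℝ => (((t, s), u) : Pt)).tendsto x
    exact (hasDerivAt_pX dF).unique ((((hasDerivAt_dx dA).mul_const u).add
      (hasDerivAt_dx dB)).congr_of_eventuallyEq (hl.eventually hev))
  · have hl : Tendsto (fun s : ℝ => (((t, x), s) : Pt)) (𝓝 u) (𝓝 ((t, x), u)) :=
      (by fun_prop : Continuous fun s : ℝ => (((t, x), s) : Pt)).tendsto u
    refine (hasDerivAt_pU dF).unique (((((hasDerivAt_id u).const_mul (A (t, x))).add_const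
      (B (t, x))).congr_of_eventuallyEq (hl.eventually hev)).congr_deriv (by simp))

theorem contDiffOn_slice_base {F : Pt → ℝ} {p : Pt} {ε : ℝ} (hε : 0 < ε)
    (hF : ContDiffOn ℝ ∞ F (Metric.ball p ε)) :
    ContDiffOn ℝ ∞ (fun q => F (q, p.2)) (Metric.ball p.1 ε) :=
  hF.comp (contDiff_id.prodMk contDiff_const).contDiffOn
    fun _ hq => mem_ball_pt_iff_base.2 ⟨hq, Metric.mem_ball_self hε⟩

/-- The functions `α`, `β`, `Ξ` are read off on the slice `u = p.2`, which loses nothing because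
`ξ_u = 0` and `η_uu = 0`. The ball is small enough for `φ` to stay where the target has its local
form, so the target coefficients become functions of `T t`. -/
theorem exists_normal_form {θ θ' : ArbTuple} {φ : OpenPartialHomeomorph Pt Pt}
    (h : (θ, φ, θ') ∈ equivalenceGroupoid) {p : Pt} (hp : p ∈ φ.source)
    {ε₀ ε₁ : ℝ} (hε₀ : 0 < ε₀) (hε₁ : 0 < ε₁) {a10 a11 y0 y1 y2 b10 b11 z0 z1 z2 : ℝ → ℝ}
    (hθ : LocalForm θ p.1 ε₀ a10 a11 y0 y1 y2) (hθ' : LocalForm θ' (φ p).1 ε₁ b10 b11 z0 z1 z2) :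
    ∃ ε > 0, ε ≤ ε₀ ∧ Metric.ball p ε ⊆ φ.source ∧
    ∃ T w k b : ℝ → ℝ, ContDiffOn ℝ ∞ T (Metric.ball p.1.1 ε) ∧
      ContDiffOn ℝ ∞ w (Metric.ball p.1.1 ε) ∧ ContDiffOn ℝ ∞ k (Metric.ball p.1.1 ε) ∧
      ContDiffOn ℝ ∞ b (Metric.ball p.1.1 ε) ∧
      (∀ r ∈ Metric.ball p ε, (φ r).1 ∈ Metric.ball (φ p).1 ε₁ ∧
        φ r = ((T r.1.1, deriv T r.1.1 * w r.1.1 * r.1.2 + k r.1.1),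
          w r.1.1 * r.2 + (b r.1.1 - deriv w r.1.1 * r.1.2)) ∧
        (θ.val r.1).a2 * (deriv T r.1.1 * w r.1.1) ^ 2
          = (θ'.val (φ r).1).a2 * deriv T r.1.1) ∧
      (∀ t ∈ Metric.ball p.1.1 ε, deriv T t ≠ 0 ∧ w t ≠ 0 ∧
        T t ∈ Metric.ball (φ p).1.1 ε₁ ∧
        deriv (deriv w) t = a11 t * deriv w t ∧
        deriv b t = - (a10 t * deriv w t) ∧
        deriv T t * w t * a11 t - (deriv (deriv T) t * w t + deriv T t * deriv w t)
          - deriv T t * deriv w t - deriv T t ^ 2 * b11 (T t) * w t = 0 ∧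
        deriv T t * w t * a10 t - deriv k t + deriv T t * b t
          - deriv T t * (b11 (T t) * k t + b10 (T t)) = 0) := by
  have hcont : ContinuousAt (fun r => (φ r).1) p :=
    continuous_fst.continuousAt.comp (φ.continuousAt hp)
  obtain ⟨ε₂, hε₂, hsub₂⟩ := Metric.mem_nhds_iff.1 (Filter.inter_mem (φ.open_source.mem_nhds hp)
    (hcont.preimage_mem_nhds (Metric.ball_mem_nhds _ hε₁)))
  obtain ⟨ε, hε, hle₀, hle₂⟩ : ∃ ε > 0, ε ≤ ε₀ ∧ ε ≤ ε₂ :=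
    ⟨min ε₀ ε₂, lt_min hε₀ hε₂, min_le_left _ _, min_le_right _ _⟩
  have hsub : Metric.ball p ε ⊆ φ.source := fun r hr =>
    (hsub₂ (Metric.ball_subset_ball hle₂ hr)).1
  have hmap : ∀ r ∈ Metric.ball p ε, (φ r).1 ∈ Metric.ball (φ p).1 ε₁ := fun r hr =>
    (hsub₂ (Metric.ball_subset_ball hle₂ hr)).2
  have hθε := hθ.mono hle₀
  have hx0 := Metric.mem_ball_self (x := p.1.2) hε
  have hu0 := Metric.mem_ball_self (x := p.2) hε
  have hcT := (contDiffOn_compT h.2.1).mono hsub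
  have hcX := (contDiffOn_compX h.2.1).mono hsub
  have hcU := (contDiffOn_compU h.2.1).mono hsub
  have hbo := Metric.isOpen_ball (x := p) (ε := ε)
  set T : ℝ → ℝ := fun s => compT φ ((s, p.1.2), p.2) with hTdef
  have hmemT : ∀ {s : ℝ}, s ∈ Metric.ball p.1.1 ε → ((s, p.1.2), p.2) ∈ Metric.ball p ε :=
    fun hs => mem_ball_pt.2 ⟨⟨hs, hx0⟩, hu0⟩
  have hT : ContDiffOn ℝ ∞ T (Metric.ball p.1.1 ε) :=
    contDiffOn_slice_fst (contDiffOn_slice_base hε hcT) hx0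
  have hTeq : ∀ r ∈ Metric.ball p ε, compT φ r = T r.1.1 := fun r hr =>
    compT_eq_of_mem_ball h hsub hr
  set Ξ : Base → ℝ := fun q => compX φ (q, p.2) with hΞdef
  have hΞ : ContDiffOn ℝ ∞ Ξ (Metric.ball p.1 ε) := contDiffOn_slice_base hε hcX
  have hΞeq : ∀ r ∈ Metric.ball p ε, compX φ r = Ξ r.1 := fun r hr =>
    eq_of_pU_eq_zero hcX (fun r hr => pU_compX_eq_zero h (hsub hr)) (u := r.2) hr
      (mem_ball_pt_iff_base.2 ⟨(mem_ball_pt_iff_base.1 hr).1, hu0⟩)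
  set α : Base → ℝ := fun q => pU (compU φ) (q, p.2) with hαdef
  have hα : ContDiffOn ℝ ∞ α (Metric.ball p.1 ε) :=
    contDiffOn_slice_base hε (ContDiffOn.pU hbo hcU)
  have hαeq : ∀ r ∈ Metric.ball p ε, pU (compU φ) r = α r.1 := fun r hr =>
    eq_of_pU_eq_zero (ContDiffOn.pU hbo hcU)
      (fun r hr => (determining_equations h (p := r) rfl (hsub hr)).2.2.2.1) (u := r.2) hr
      (mem_ball_pt_iff_base.2 ⟨(mem_ball_pt_iff_base.1 hr).1, hu0⟩)
  set β : Base → ℝ := fun q => compU φ (q, p.2) - α q * p.2 with hβdef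
  have hβ : ContDiffOn ℝ ∞ β (Metric.ball p.1 ε) :=
    (contDiffOn_slice_base hε hcU).sub (hα.mul contDiffOn_const)
  have hηeq : ∀ r ∈ Metric.ball p ε, compU φ r = α r.1 * r.2 + β r.1 := by
    intro r hr
    have hr' := mem_ball_pt_iff_base.1 hr
    have := eq_add_mul_of_hasDerivAt (f := fun s => compU φ (r.1, s)) (c := p.2) (ε := ε)
      (m := α r.1) (fun s hs => by
        have hm : (r.1, s) ∈ Metric.ball p ε := mem_ball_pt_iff_base.2 ⟨hr'.1, hs⟩
        rw [← hαeq _ hm]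
        exact hasDerivAt_pU (differentiableAt_of_contDiffOn hbo hcU hm)) hr'.2 hu0
    have e : compU φ r = compU φ (r.1, p.2) + α r.1 * (r.2 - p.2) := this
    rw [e, hβdef]
    ring
  have hdα : ContDiffOn ℝ ∞ (dx α) (Metric.ball p.1 ε) := contDiffOn_dx_base Metric.isOpen_ball hα
  have hdβ : ContDiffOn ℝ ∞ (dx β) (Metric.ball p.1 ε) := contDiffOn_dx_base Metric.isOpen_ball hβ
  have hdΞ : ContDiffOn ℝ ∞ (dx Ξ) (Metric.ball p.1 ε) := contDiffOn_dx_base Metric.isOpen_ball hΞ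
  have z1 : ∀ r, dx (fun _ : Base => (0 : ℝ)) r = 0 := fun r => by simp [dx]
  have z2 : ∀ r, dt (fun _ : Base => (0 : ℝ)) r = 0 := fun r => by simp [dt]
  have PU := partials_of_affine hα hβ hηeq
  have PUX := partials_of_affine hdα hdβ (fun r hr => (PU r hr).2.1)
  have PUU := partials_of_affine (F := pU (compU φ)) (A := fun _ => 0) contDiffOn_const hα
    (fun r hr => by rw [(PU r hr).2.2]; ring)
  have PX := partials_of_affine (F := compX φ) (A := fun _ => 0) contDiffOn_const hΞ
    (fun r hr => by rw [hΞeq r hr]; ring)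
  have PXX := partials_of_affine (F := pX (compX φ)) (A := fun _ => 0) contDiffOn_const hdΞ
    (fun r hr => by rw [(PX r hr).2.1, z1])
  have PT : ∀ r ∈ Metric.ball p ε, pT (compT φ) r = deriv T r.1.1 := by
    intro r hr
    have h1 := hasDerivAt_pT (F := compT φ) (t := r.1.1) (x := r.1.2) (u := r.2)
      (differentiableAt_of_contDiffOn hbo hcT hr)
    have hl : Tendsto (fun s : ℝ => (((s, r.1.2), r.2) : Pt)) (𝓝 r.1.1) (𝓝 r) :=
      (by fun_prop : Continuous fun s : ℝ => (((s, r.1.2), r.2) : Pt)).tendsto r.1.1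
    have h2 := (hasDerivAt_deriv_of_contDiffOn Metric.isOpen_ball hT
      (mem_ball_pt.1 hr).1.1).congr_of_eventuallyEq
      (f₁ := fun s => compT φ ((s, r.1.2), r.2)) (by
        filter_upwards [hl.eventually (hbo.mem_nhds hr)] with s hs
        exact hTeq _ hs)
    exact h1.unique h2
  have hmk : ∀ {r : Base} {u : ℝ}, r ∈ Metric.ball p.1 ε → u ∈ Metric.ball p.2 ε →
      (r, u) ∈ Metric.ball p ε := fun h1 h2 => mem_ball_pt_iff_base.2 ⟨h1, h2⟩
  have hφ1 : ∀ r ∈ Metric.ball p ε, (φ r).1.1 = T r.1.1 := hTeq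
  have hT0 : ∀ t ∈ Metric.ball p.1.1 ε, deriv T t ≠ 0 := fun t ht => by
    have := (nondegenerate h (hsub (hmemT ht))).1
    rwa [PT _ (hmemT ht)] at this
  have hα0 : ∀ r ∈ Metric.ball p.1 ε, α r ≠ 0 := fun r hr => by
    have hm := hmk hr hu0
    have := (determining_equations h (p := (r, p.2)) rfl (hsub hm)).2.1
    rwa [hαeq _ hm] at this
  obtain ⟨w, k, b, hw, hk, hb, hform, hode⟩ := solve_determining_equations (v := p.2) hε
    (a10 := a10) (a11 := a11) (b10 := fun t => b10 (T t)) (b11 := fun t => b11 (T t))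
    (A := fun r => (θ.val r).a2) hT hα hβ hΞ hT0 hα0 (by
      intro r hr u hu
      have hm := hmk hr hu
      have e := (determining_equations h (p := (r, u)) rfl (hsub hm)).2.2.2.2.1
      rw [(PX _ hm).1, (PX _ hm).2.1, (PU _ hm).2.2, (PUU _ hm).2.1, (PXX _ hm).2.1, PT _ hm,
        hηeq _ hm, hΞeq _ hm, hθ'.e10 _ (hmap _ hm), hθ'.e11 _ (hmap _ hm), hφ1 _ hm,
        hθε.e10 _ hr, hθε.e11 _ hr] at e
      simp only [z1, z2] at e
      linear_combination e) (by
      intro r hr u hu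
      have hm := hmk hr hu
      have e := (determining_equations h (p := (r, u)) rfl (hsub hm)).2.2.2.2.2
      rw [(PX _ hm).1, (PX _ hm).2.1, (PU _ hm).1, (PU _ hm).2.1, (PUX _ hm).2.1, (PXX _ hm).2.1,
        PT _ hm, hηeq _ hm, hΞeq _ hm, hθ'.e10 _ (hmap _ hm), hθ'.e11 _ (hmap _ hm), hφ1 _ hm] at e
      simp only [z1, z2] at e
      linear_combination e)
  refine ⟨ε, hε, hle₀, hsub, T, w, k, b, hT, hw, hk, hb, ?_, ?_⟩
  · intro r hr
    obtain ⟨f1, f2, f3⟩ := hform _ (mem_ball_pt_iff_base.1 hr).1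
    refine ⟨hmap r hr, ?_, ?_⟩
    · rw [← f3, ← f2, ← f1, ← hηeq r hr, ← hΞeq r hr, ← hTeq r hr]
      rfl
    · have e := (determining_equations h (p := r) rfl (hsub hr)).2.2.1
      have hdΞ : dx Ξ r.1 = deriv T r.1.1 * w r.1.1 := by
        have hr1 := (mem_ball_pt_iff_base.1 hr).1
        have hl : Tendsto (fun s : ℝ => ((r.1.1, s) : Base)) (𝓝 r.1.2) (𝓝 r.1) :=
          (by fun_prop : Continuous fun s : ℝ => ((r.1.1, s) : Base)).tendsto r.1.2
        refine ((((hasDerivAt_id r.1.2).const_mul (deriv T r.1.1 * w r.1.1)).add_const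
          (k r.1.1)).congr_of_eventuallyEq ?_).deriv.trans (by simp)
        filter_upwards [hl.eventually (Metric.isOpen_ball.mem_nhds hr1)] with s hs
        exact (hform _ hs).2.2
      rw [(PX r hr).2.1, z1, zero_mul, zero_add, hdΞ, PT r hr] at e
      exact e
  · intro t ht
    have hm := hmemT ht
    refine ⟨hT0 t ht, ?_, ?_, hode t ht⟩
    · have := hα0 (t, p.1.2) (mem_ball_pt_iff_base.1 hm).1
      rwa [(hform (t, p.1.2) (mem_ball_pt_iff_base.1 hm).1).1] at this
    · have := (mem_ball_base.1 (hmap _ hm)).1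
      rwa [hφ1 _ hm] at this

/-! ### Composition and inversion in the explicit family -/

namespace Params

/-- The functional parameters are smooth on the open set `I` and `δ T_t > 0` there. -/
structure Admissible (P : Params) (I : Set ℝ) : Prop where
  isOpen : IsOpen I
  smooth_T : ContDiffOn ℝ ∞ P.T I
  smooth_X : ContDiffOn ℝ ∞ P.X I
  pos : ∀ t ∈ I, 0 < P.delta * deriv P.T t

/-- The set where the formulas of the family define a transformation. -/
def domain (P : Params) (I : Set ℝ) : Set Ext :=
  {z | z ∈ extDomain ∧ z.1.1.1 ∈ I ∧ P.c1 * z.2.y1 + P.c0 ≠ 0}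

theorem Represents.exists_admissible {P : Params} {e : OpenPartialHomeomorph Ext Ext}
    (h : P.Represents e) : ∃ I, P.Admissible I ∧ e.source ⊆ P.domain I ∧
      ∀ z ∈ e.source, e z = P.toMap z := by
  obtain ⟨I, h1, h2, h3, h4, h5⟩ := h
  exact ⟨I, ⟨h1, h2, h3, h4⟩, fun z hz => ⟨(h5 z hz).1, (h5 z hz).2.1, (h5 z hz).2.2.1⟩,
    fun z hz => (h5 z hz).2.2.2⟩

theorem Admissible.represents {P : Params} {I : Set ℝ} (h : P.Admissible I)
    {e : OpenPartialHomeomorph Ext Ext} (hd : e.source ⊆ P.domain I)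
    (he : ∀ z ∈ e.source, e z = P.toMap z) : P.Represents e :=
  ⟨I, h.isOpen, h.smooth_T, h.smooth_X, h.pos, fun z hz =>
    ⟨(hd hz).1, (hd hz).2.1, (hd hz).2.2, he z hz⟩⟩

section Admissible
variable {P : Params} {I : Set ℝ}

theorem Admissible.delta_ne (h : P.Admissible I) {t : ℝ} (ht : t ∈ I) : P.delta ≠ 0 :=
  left_ne_zero_of_mul (h.pos t ht).ne'

theorem Admissible.deriv_ne (h : P.Admissible I) {t : ℝ} (ht : t ∈ I) : deriv P.T t ≠ 0 :=
  right_ne_zero_of_mul (h.pos t ht).ne'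

theorem Admissible.div_pos (h : P.Admissible I) {t : ℝ} (ht : t ∈ I) : 0 < P.delta / deriv P.T t :=
  div_pos_iff.2 (mul_pos_iff.1 (h.pos t ht))

theorem Admissible.smooth_deriv (h : P.Admissible I) : ContDiffOn ℝ ∞ (deriv P.T) I :=
  h.smooth_T.deriv_of_isOpen h.isOpen (by simp)

theorem Admissible.hasDerivAt_T (h : P.Admissible I) {t : ℝ} (ht : t ∈ I) : HasDerivAt P.T
    (deriv P.T t) t :=
  hasDerivAt_deriv_of_contDiffOn h.isOpen h.smooth_T ht

theorem Admissible.hasDerivAt_T' (h : P.Admissible I) {t : ℝ} (ht : t ∈ I) :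
    HasDerivAt (deriv P.T) (deriv (deriv P.T) t) t :=
  hasDerivAt_deriv_of_contDiffOn h.isOpen h.smooth_deriv ht

theorem Admissible.hasDerivAt_X (h : P.Admissible I) {t : ℝ} (ht : t ∈ I) : HasDerivAt P.X
    (deriv P.X t) t :=
  hasDerivAt_deriv_of_contDiffOn h.isOpen h.smooth_X ht

theorem Admissible.isOpen_domain (h : P.Admissible I) : IsOpen (P.domain I) := by
  have h1 : Continuous fun z : Ext => z.1.1.1 := by fun_prop
  have h2 : Continuous fun z : Ext => P.c1 * z.2.y1 + P.c0 := by unfold Arb.y1; fun_prop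
  exact isOpen_extDomain.inter ((h.isOpen.preimage h1).inter (isOpen_ne_fun h2 continuous_const))

theorem Admissible.contDiffOn_toMap (h : P.Admissible I) : ContDiffOn ℝ ∞ P.toMap (P.domain I) := by
  have pr : ∀ {f : ℝ → ℝ}, ContDiffOn ℝ ∞ f I →
      ContDiffOn ℝ ∞ (fun z : Ext => f z.1.1.1) (P.domain I) := fun hf =>
    hf.comp (by fun_prop : ContDiff ℝ ∞ fun z : Ext => z.1.1.1).contDiffOn fun z hz => hz.2.1
  have hT := pr h.smooth_T
  have hT' := pr h.smooth_deriv
  have hT'' := pr (h.smooth_deriv.deriv_of_isOpen (m := ∞) h.isOpen (by simp))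
  have hX := pr h.smooth_X
  have hX' := pr (h.smooth_X.deriv_of_isOpen (m := ∞) h.isOpen (by simp))
  have hn : ∀ z ∈ P.domain I, deriv P.T z.1.1.1 ≠ 0 := fun z hz => h.deriv_ne hz.2.1
  have s : ∀ {c : Arb → ℝ}, ContDiff ℝ ∞ c → ContDiffOn ℝ ∞ (fun z : Ext => c z.2) (P.domain I) :=
    fun hc => (hc.comp contDiff_snd).contDiffOn
  have s10 := s contDiff_a10
  have s11 := s contDiff_a11
  have s2 := s contDiff_a2
  have s0 := s contDiff_y0
  have s1 := s contDiff_y1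
  have sy2 := s contDiff_y2
  have hx : ContDiffOn ℝ ∞ (fun z : Ext => z.1.1.2) (P.domain I) := by fun_prop
  have hu : ContDiffOn ℝ ∞ (fun z : Ext => z.1.2) (P.domain I) := by fun_prop
  have hW : ContDiffOn ℝ ∞ (fun z : Ext => P.c1 * z.2.y1 + P.c0) (P.domain I) := by fun_prop
  have hWn : ∀ z ∈ P.domain I, P.c1 * z.2.y1 + P.c0 ≠ 0 := fun z hz => hz.2.2
  have hlog : ContDiffOn ℝ ∞ (fun z : Ext =>
      Real.log (P.delta / (deriv P.T z.1.1.1 * (P.c1 * z.2.y1 + P.c0) ^ 2))) (P.domain I) := by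
    refine ContDiffOn.log (contDiffOn_const.div (hT'.mul (hW.pow 2)) ?_) ?_
    · exact fun z hz => mul_ne_zero (hn z hz) (pow_ne_zero 2 (hWn z hz))
    · exact fun z hz => div_ne_zero (h.delta_ne hz.2.1)
        (mul_ne_zero (hn z hz) (pow_ne_zero 2 (hWn z hz)))
  unfold toMap
  refine ContDiffOn.prodMk (ContDiffOn.prodMk (ContDiffOn.prodMk hT ?_) ?_)
    (ContDiffOn.prodMk ?_ (ContDiffOn.prodMk ?_ (ContDiffOn.prodMk ?_ (ContDiffOn.prodMk ?_
      (ContDiffOn.prodMk ?_ ?_)))))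
  · fun_prop
  · fun_prop
  · fun_prop
  · fun_prop (disch := assumption)
  · fun_prop
  · fun_prop
  · fun_prop (disch := assumption)
  · fun_prop (disch := assumption)

end Admissible

/-- The parameters of the composition (first `P`, then `Q`) where `c₁ Y¹ + c₀` has sign `σ`. -/
noncomputable def comp (Q P : Params) (σ : ℝ) : Params where
  T := fun t => Q.T (P.T t)
  X := fun t => P.X t + σ / P.delta * (Q.X (P.T t) * √(P.delta / deriv P.T t))
  c0 := Q.c1 * P.d0 + Q.c0 * P.c0
  c1 := Q.c1 * P.d1 + Q.c0 * P.c1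
  c2 := Q.c0 * P.c2 + Q.c2 - Q.c1 * P.c3
  c3 := Q.c3 + Q.d1 * P.c3 - Q.d0 * P.c2
  d0 := Q.d1 * P.d0 + Q.d0 * P.c0
  d1 := Q.d1 * P.d1 + Q.d0 * P.c1

section comp
variable {P Q : Params} {I J : Set ℝ}

/-- The constants act on `Y¹` as the Möbius matrix with rows `(d1, d0)` and `(c1, c0)`. `comp`
multiplies these matrices, and `delta` is the determinant. -/
theorem delta_comp (Q P : Params) (σ : ℝ) : (comp Q P σ).delta = Q.delta * P.delta := by
  unfold delta comp
  ring

theorem deriv_comp_T (hP : P.Admissible I) (hQ : Q.Admissible J) (σ : ℝ) {t : ℝ} (ht : t ∈ I) (hPt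
    : P.T t ∈ J) :
    deriv (comp Q P σ).T t = deriv Q.T (P.T t) * deriv P.T t :=
  ((hQ.hasDerivAt_T hPt).comp t (hP.hasDerivAt_T ht)).deriv

theorem deriv_deriv_comp_T (hP : P.Admissible I) (hQ : Q.Admissible J) (σ : ℝ) {t : ℝ} (ht : t ∈ I)
    (hPt : P.T t ∈ J) :
    deriv (deriv (comp Q P σ).T) t = deriv (deriv Q.T) (P.T t) * deriv P.T t ^ 2
      + deriv Q.T (P.T t) * deriv (deriv P.T) t := by
  have hev : deriv (comp Q P σ).T =ᶠ[𝓝 t] fun s => deriv Q.T (P.T s) * deriv P.T s := by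
    filter_upwards [hP.isOpen.mem_nhds ht,
      (hP.hasDerivAt_T ht).continuousAt.preimage_mem_nhds (hQ.isOpen.mem_nhds hPt)] with s h1 h2
    exact deriv_comp_T hP hQ σ h1 h2
  rw [hev.deriv_eq]
  refine ((((hQ.hasDerivAt_T' hPt).comp t (hP.hasDerivAt_T ht)).mul
    (hP.hasDerivAt_T' ht)).deriv).trans ?_
  simp only [Function.comp_apply]
  ring

theorem hasDerivAt_sqrt (hP : P.Admissible I) {t : ℝ} (ht : t ∈ I) : HasDerivAt (fun s
    => √(P.delta / deriv P.T s))
    (-(√(P.delta / deriv P.T t) * deriv (deriv P.T) t / (2 * deriv P.T t))) t := by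
  have hpos := hP.div_pos ht
  have h1 := ((hasDerivAt_const t P.delta).div (hP.hasDerivAt_T' ht) (hP.deriv_ne ht)).sqrt hpos.ne'
  refine h1.congr_deriv ?_
  have hd := hP.deriv_ne ht
  have hs := Real.sqrt_pos.2 hpos
  have hsq := Real.sq_sqrt hpos.le
  simp only [Pi.div_apply]
  set ρ := √(P.delta / deriv P.T t)
  have hδ : P.delta = ρ ^ 2 * deriv P.T t := by rw [hsq]; field_simp
  rw [hδ]
  field_simp
  ring

theorem deriv_comp_X (hP : P.Admissible I) (hQ : Q.Admissible J) (σ : ℝ) {t : ℝ} (ht : t ∈ I) (hPt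
    : P.T t ∈ J) :
    deriv (comp Q P σ).X t = deriv P.X t + σ / P.delta *
      (deriv Q.X (P.T t) * deriv P.T t * √(P.delta / deriv P.T t)
      - Q.X (P.T t) * (√(P.delta / deriv P.T t) * deriv (deriv P.T) t / (2 * deriv P.T t))) := by
  refine ((hP.hasDerivAt_X ht).add ((((hQ.hasDerivAt_X hPt).comp t (hP.hasDerivAt_T ht)).mul
    (hasDerivAt_sqrt hP ht)).const_mul _)).deriv.trans ?_
  simp only [Function.comp_apply]
  ring

theorem Admissible.comp (hP : P.Admissible I) (hQ : Q.Admissible J) (σ : ℝ) :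
    (comp Q P σ).Admissible (I ∩ P.T ⁻¹' J) where
  isOpen := hP.smooth_T.continuousOn.isOpen_inter_preimage hP.isOpen hQ.isOpen
  smooth_T := hQ.smooth_T.comp (hP.smooth_T.mono inter_subset_left) fun _ ht => ht.2
  smooth_X := by
    refine (hP.smooth_X.mono inter_subset_left).add (contDiffOn_const.mul
      ((hQ.smooth_X.comp (hP.smooth_T.mono inter_subset_left) fun _ ht => ht.2).mul
      (ContDiffOn.sqrt (contDiffOn_const.div (hP.smooth_deriv.mono inter_subset_left)
        fun t ht => hP.deriv_ne ht.1) fun t ht => (hP.div_pos ht.1).ne')))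
  pos := by
    rintro t ⟨ht, hPt⟩
    rw [deriv_comp_T hP hQ σ ht hPt, delta_comp]
    have := mul_pos (hP.pos t ht) (hQ.pos _ hPt)
    linarith

/-- Under `P`, `exp (Y⁰/2)` is multiplied by `√(δ/T_t) / |c₁Y¹ + c₀|`. The absolute value is why the
sign `σ` of the denominator enters the parameter `X` of the composition; the other parameters do not
involve it. -/
theorem toMap_comp (hP : P.Admissible I) (hQ : Q.Admissible J) {σ : ℝ} (hσ : σ = 1 ∨ σ = -1) {z
    : Ext} (ht : z.1.1.1 ∈ I)
    (hPt : P.T z.1.1.1 ∈ J) (hW : 0 < σ * (P.c1 * z.2.y1 + P.c0))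
    (hW2 : Q.c1 * (P.toMap z).2.y1 + Q.c0 ≠ 0) :
    Q.toMap (P.toMap z) = (comp Q P σ).toMap z := by
  obtain ⟨⟨⟨t, x⟩, u⟩, A10, A11, A2, Y0, Y1, Y2⟩ := z
  have d1 := deriv_comp_T hP hQ σ ht hPt
  have d2 := deriv_deriv_comp_T hP hQ σ ht hPt
  have d3 := deriv_comp_X hP hQ σ ht hPt
  have hpos := hP.div_pos ht
  have hposQ := hQ.div_pos hPt
  have hTd := hP.deriv_ne ht
  have hTd2 := hQ.deriv_ne hPt
  have hδ0 := hP.delta_ne ht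
  have hδ20 := hQ.delta_ne hPt
  have hWn : P.c1 * Y1 + P.c0 ≠ 0 := right_ne_zero_of_mul hW.ne'
  have hρ := Real.sqrt_pos.2 hpos
  have hρsq := Real.sq_sqrt hpos.le
  have dδ := delta_comp Q P σ
  simp only [Params.toMap, Arb.a10, Arb.a11, Arb.a2, Arb.y0, Arb.y1, Arb.y2, d1, d2, d3, dδ]
    at hW2 ⊢
  dsimp only at ht hPt hW hpos hposQ hTd hTd2 hρ hρsq
  simp only [Params.comp]
  change 0 < σ * (P.c1 * Y1 + P.c0) at hW
  set ρ := √(P.delta / deriv P.T t) with hρdef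
  set T1 := deriv P.T t
  set T2 := deriv (deriv P.T) t
  set S1 := deriv Q.T (P.T t)
  set S2 := deriv (deriv Q.T) (P.T t)
  set E := Real.exp (Y0 / 2) with hE
  have hE0 : E ≠ 0 := (Real.exp_pos _).ne'
  have e1 : Real.exp Y0 = E ^ 2 := by rw [hE, ← Real.exp_nat_mul]; congr 1; push_cast; ring
  have e2 : Real.exp (-Y0 / 2) = E⁻¹ := by rw [hE, ← Real.exp_neg]; congr 1; ring
  have hT1 : T1 = P.delta / ρ ^ 2 := by rw [hρsq]; field_simp
  set L := Real.log (P.delta / (T1 * (P.c1 * Y1 + P.c0) ^ 2)) with hL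
  have hσσ : σ * σ = 1 := by rcases hσ with rfl | rfl <;> norm_num
  have hσ0 : σ ≠ 0 := by rintro rfl; norm_num at hσσ
  -- The positive square root is the right one: `σ` times the denominator is its absolute value.
  have hL2 : Real.exp (L / 2) = σ * ρ / (P.c1 * Y1 + P.c0) := by
    have h1 : P.delta / (T1 * (P.c1 * Y1 + P.c0) ^ 2) = (σ * ρ / (P.c1 * Y1 + P.c0)) ^ 2 := by
      rw [div_pow, mul_pow, hρsq, pow_two σ, hσσ]
      field_simp
    have h2 : 0 < σ * ρ / (P.c1 * Y1 + P.c0) := by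
      have : σ * ρ / (P.c1 * Y1 + P.c0) = ρ / (σ * (P.c1 * Y1 + P.c0)) := by
        field_simp
        rw [pow_two, hσσ]
      rw [this]
      positivity
    have h3 : L / 2 = Real.log (σ * ρ / (P.c1 * Y1 + P.c0)) := by
      rw [hL, h1, Real.log_pow]; push_cast; ring
    rw [h3, Real.exp_log h2]
  have e3 : Real.exp ((Y0 + L) / 2) = E * (σ * ρ / (P.c1 * Y1 + P.c0)) := by
    rw [add_div, Real.exp_add, hL2]
  have e4 : Real.exp (Y0 + L) = (E * (σ * ρ / (P.c1 * Y1 + P.c0))) ^ 2 := by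
    rw [← e3, ← Real.exp_nat_mul]; congr 1; push_cast; ring
  have e5 : Real.exp (-(Y0 + L) / 2) = (E * (σ * ρ / (P.c1 * Y1 + P.c0)))⁻¹ := by
    rw [← e3, ← Real.exp_neg]; congr 1; ring
  rw [e1, e2, e3, e4, e5]
  have hWc : (Q.c1 * P.d1 + Q.c0 * P.c1) * Y1 + (Q.c1 * P.d0 + Q.c0 * P.c0)
      = Q.c1 * (P.d1 * Y1 + P.d0) + Q.c0 * (P.c1 * Y1 + P.c0) := by ring
  have hW2' : Q.c1 * ((P.d1 * Y1 + P.d0) / (P.c1 * Y1 + P.c0)) + Q.c0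
      = (Q.c1 * (P.d1 * Y1 + P.d0) + Q.c0 * (P.c1 * Y1 + P.c0)) / (P.c1 * Y1 + P.c0) := by
    rw [eq_div_iff hWn, add_mul, mul_assoc, div_mul_cancel₀ _ hWn]
  have hM : Q.c1 * (P.d1 * Y1 + P.d0) + Q.c0 * (P.c1 * Y1 + P.c0) ≠ 0 := by
    rw [hW2'] at hW2
    exact left_ne_zero_of_mul (div_eq_mul_inv (G := ℝ) _ _ ▸ hW2)
  rw [hWc, hW2']
  have hlog : Y0 + L + Real.log (Q.delta / (S1 *
      ((Q.c1 * (P.d1 * Y1 + P.d0) + Q.c0 * (P.c1 * Y1 + P.c0)) / (P.c1 * Y1 + P.c0)) ^ 2))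
      = Y0 + Real.log (Q.delta * P.delta / (S1 * T1 *
        (Q.c1 * (P.d1 * Y1 + P.d0) + Q.c0 * (P.c1 * Y1 + P.c0)) ^ 2)) := by
    rw [hL, add_assoc, ← Real.log_mul (by positivity) (by positivity)]
    congr 2
    field_simp
  have hKc : (Q.d1 * P.d1 + Q.d0 * P.c1) * Y1 + (Q.d1 * P.d0 + Q.d0 * P.c0)
      = Q.d1 * (P.d1 * Y1 + P.d0) + Q.d0 * (P.c1 * Y1 + P.c0) := by ring
  rw [hKc]
  -- The linear forms `N`, `W`, `M`, `K` are to be treated as independent quantities. Redundant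
  -- constants are therefore expressed through them and the two determinants, after which the
  -- components are rational identities.
  have hd1 : P.d1 = (P.c1 * (P.d1 * Y1 + P.d0) + P.delta) / (P.c1 * Y1 + P.c0) := by
    rw [eq_div_iff hWn]; unfold delta; ring
  have hk0 : Q.c0 = ((Q.c1 * (P.d1 * Y1 + P.d0) + Q.c0 * (P.c1 * Y1 + P.c0))
      - Q.c1 * (P.d1 * Y1 + P.d0)) / (P.c1 * Y1 + P.c0) := by
    rw [eq_div_iff hWn]; ring
  have hl1 : Q.d1 = (Q.delta * (P.c1 * Y1 + P.c0)
      + (Q.d1 * (P.d1 * Y1 + P.d0) + Q.d0 * (P.c1 * Y1 + P.c0)) * Q.c1) /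
      (Q.c1 * (P.d1 * Y1 + P.d0) + Q.c0 * (P.c1 * Y1 + P.c0)) := by
    rw [eq_div_iff hM]; unfold delta; ring
  have hl0 : Q.d0 = ((Q.d1 * (P.d1 * Y1 + P.d0) + Q.d0 * (P.c1 * Y1 + P.c0))
      - Q.d1 * (P.d1 * Y1 + P.d0)) / (P.c1 * Y1 + P.c0) := by
    rw [eq_div_iff hWn]; ring
  have hρ0 := hρ.ne'
  refine Prod.ext (Prod.ext (Prod.ext rfl ?_) ?_) (Prod.ext ?_ (Prod.ext ?_ (Prod.ext ?_
    (Prod.ext hlog (Prod.ext ?_ ?_))))) <;> dsimp only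
  all_goals
    generalize P.d1 * Y1 + P.d0 = N at *
    generalize P.c1 * Y1 + P.c0 = W at *
    generalize Q.c1 * N + Q.c0 * W = M at *
    generalize Q.d1 * N + Q.d0 * W = K at *
    clear_value ρ E T1 T2 S1 S2 L
    generalize P.delta = δ at *
    generalize Q.delta = δ' at *
  · rw [hT1]
    rcases hσ with rfl | rfl
    · field_simp
      ring
    · field_simp
      ring
  · rw [hT1, hd1, hk0]
    rcases hσ with rfl | rfl
    · field_simp
      ring
    · field_simp
      ring
  · rw [hT1, hd1, hk0]
    rcases hσ with rfl | rfl
    · field_simp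
      ring
    · field_simp
      ring
  · rw [hT1, hd1, hk0]
    rcases hσ with rfl | rfl
    · field_simp
      ring
    · field_simp
      ring
  · field_simp
  · rw [hl0]
    field_simp
    ring
  · rw [hl0, hl1, hk0]
    rcases hσ with rfl | rfl
    · field_simp
      ring
    · field_simp
      ring

end comp

end Params

/-! ### Identity and inverses in the explicit family -/

namespace Params

theorem toMap_congr {P Q : Params} {z : Ext} (hT : P.T =ᶠ[𝓝 z.1.1.1] Q.T)
    (hX : P.X =ᶠ[𝓝 z.1.1.1] Q.X) (h0 : P.c0 = Q.c0) (h1 : P.c1 = Q.c1) (h2 : P.c2 = Q.c2)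
    (h3 : P.c3 = Q.c3) (h4 : P.d0 = Q.d0) (h5 : P.d1 = Q.d1) : P.toMap z = Q.toMap z := by
  simp only [toMap, delta]
  rw [hT.eq_of_nhds, hX.eq_of_nhds, hT.deriv_eq, hX.deriv_eq, hT.deriv.deriv_eq, h0, h1, h2, h3,
    h4, h5]

/-- The parameters of the identity transformation. -/
def one : Params where
  T := fun t => t
  X := fun _ => 0
  c0 := 1
  c1 := 0
  c2 := 0
  c3 := 0
  d0 := 0
  d1 := 1

theorem toMap_one (z : Ext) : one.toMap z = z := by
  have h1 : deriv (fun t : ℝ => t) = fun _ => 1 := funext fun t => (hasDerivAt_id t).deriv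
  obtain ⟨⟨⟨t, x⟩, u⟩, A10, A11, A2, Y0, Y1, Y2⟩ := z
  simp [toMap, one, delta, h1, Arb.a10, Arb.a11, Arb.a2, Arb.y0, Arb.y1, Arb.y2]

theorem admissible_one : one.Admissible univ where
  isOpen := isOpen_univ
  smooth_T := contDiff_id.contDiffOn
  smooth_X := contDiff_const.contDiffOn
  pos := by
    intro t _
    have h1 : deriv one.T t = 1 := (hasDerivAt_id t).deriv
    rw [h1]
    simp [delta, one]

/-- The parameters of the inverse transformation; here `S` is the inverse of `T`. -/
noncomputable def inv (P : Params) (S : ℝ → ℝ) (σ : ℝ) : Params where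
  T := S
  X := fun s => -(σ * P.delta * P.X (S s)) / √(P.delta / deriv P.T (S s))
  c0 := P.d1 / P.delta
  c1 := -P.c1 / P.delta
  c2 := -(P.d1 * P.c2 + P.c1 * P.c3) / P.delta
  c3 := -(P.c0 * P.c3 + P.d0 * P.c2) / P.delta
  d0 := -P.d0 / P.delta
  d1 := P.c0 / P.delta

/-- `tt` is a local inverse of the functional parameter `T` on a part of `I`. -/
structure LocalInverse (P : Params) (I : Set ℝ) (tt : OpenPartialHomeomorph ℝ ℝ) : Prop where
  sub : tt.source ⊆ I
  eq : ∀ t, tt t = P.T t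
  smooth : ContDiffOn ℝ ∞ tt.symm tt.target

theorem Admissible.exists_localInverse {P : Params} {I : Set ℝ} (h : P.Admissible I) {t : ℝ}
    (ht : t ∈ I) : ∃ tt, P.LocalInverse I tt ∧ t ∈ tt.source := by
  have hc : ContDiffAt ℝ ∞ P.T t := h.smooth_T.contDiffAt (h.isOpen.mem_nhds ht)
  have hd : HasFDerivAt P.T ((ContinuousLinearEquiv.unitsEquivAut ℝ
      (Units.mk0 _ (h.deriv_ne ht)) : ℝ ≃L[ℝ] ℝ) : ℝ →L[ℝ] ℝ) t := by
    refine (h.hasDerivAt_T ht).hasFDerivAt.congr_fderiv ?_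
    ext
    simp
  let R := hc.toOpenPartialHomeomorph P.T hd (by simp)
  have hR : t ∈ R.source := hc.mem_toOpenPartialHomeomorph_source hd (by simp)
  have hs : (R.restrOpen I h.isOpen).source = R.source ∩ I := R.restrOpen_source I h.isOpen
  refine ⟨R.restrOpen I h.isOpen, ⟨?_, fun t => rfl, ?_⟩, ?_⟩
  · rw [hs]; exact inter_subset_right
  · intro s hs'
    have hm := (R.restrOpen I h.isOpen).map_target hs'
    set t' := (R.restrOpen I h.isOpen).symm s with ht'
    rw [hs] at hm
    have h1 := h.hasDerivAt_T hm.2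
    refine (OpenPartialHomeomorph.contDiffAt_symm_deriv (R.restrOpen I h.isOpen) (n := ∞)
      (f₀' := deriv P.T t') (h.deriv_ne hm.2) hs' ?_ ?_).contDiffWithinAt
    · exact h1
    · exact h.smooth_T.contDiffAt (h.isOpen.mem_nhds hm.2)
  · rw [hs]; exact ⟨hR, ht⟩

section inv
variable {P : Params} {I : Set ℝ} {tt : OpenPartialHomeomorph ℝ ℝ}

theorem LocalInverse.hasDerivAt_symm (hi : P.LocalInverse I tt) (h : P.Admissible I) {s : ℝ}
    (hs : s ∈ tt.target) : HasDerivAt tt.symm (deriv P.T (tt.symm s))⁻¹ s := by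
  have hm := hi.sub (tt.map_target hs)
  refine tt.hasDerivAt_symm hs (h.deriv_ne hm) ?_
  have : (tt : ℝ → ℝ) = P.T := funext hi.eq
  rw [this]
  exact h.hasDerivAt_T hm

/-- `inv` carries the inverse Möbius matrix, whose determinant is the reciprocal. -/
theorem delta_inv (P : Params) (S : ℝ → ℝ) (σ : ℝ) (h : P.delta ≠ 0) :
    (P.inv S σ).delta = P.delta⁻¹ := by
  have : (P.inv S σ).delta = (P.d1 * P.c0 - P.d0 * P.c1) / (P.delta * P.delta) := by
    simp only [delta, inv]
    rw [div_mul_div_comm, div_mul_div_comm, ← sub_div]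
    congr 1; ring
  rw [this]
  change P.delta / _ = _
  field_simp

theorem Admissible.inv (h : P.Admissible I) (hi : P.LocalInverse I tt) (σ : ℝ) :
    (P.inv tt.symm σ).Admissible tt.target where
  isOpen := tt.open_target
  smooth_T := hi.smooth
  smooth_X := by
    have hm : MapsTo tt.symm tt.target I := fun s hs => hi.sub (tt.map_target hs)
    refine ((contDiffOn_const.mul (h.smooth_X.comp hi.smooth hm)).neg).div (ContDiffOn.sqrt
      (contDiffOn_const.div (h.smooth_deriv.comp hi.smooth hm) fun s hs => h.deriv_ne (hm hs))
      fun s hs => (h.div_pos (hm hs)).ne') fun s hs => (Real.sqrt_pos.2 (h.div_pos (hm hs))).ne'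
  pos := by
    intro s hs
    have hm := hi.sub (tt.map_target hs)
    rw [delta_inv _ _ _ (h.delta_ne hm)]
    have : deriv (P.inv tt.symm σ).T s = (deriv P.T (tt.symm s))⁻¹ :=
      (hi.hasDerivAt_symm h hs).deriv
    rw [this, ← mul_inv]
    exact inv_pos.2 (h.pos _ hm)

theorem toMap_y1 (P : Params) (z : Ext) :
    (P.toMap z).2.y1 = (P.d1 * z.2.y1 + P.d0) / (P.c1 * z.2.y1 + P.c0) := rfl

theorem inv_denominator (P : Params) (S : ℝ → ℝ) (σ : ℝ) {z : Ext} (hδ : P.delta ≠ 0)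
    (hW : P.c1 * z.2.y1 + P.c0 ≠ 0) :
    (P.inv S σ).c1 * (P.toMap z).2.y1 + (P.inv S σ).c0 = (P.c1 * z.2.y1 + P.c0)⁻¹ := by
  rw [toMap_y1]
  simp only [inv]
  generalize z.2.y1 = y at *
  rw [div_mul_div_comm, ← sub_eq_zero]
  have : P.d1 = (P.c1 * (P.d1 * y + P.d0) + P.delta) / (P.c1 * y + P.c0) := by
    rw [eq_div_iff hW]; unfold delta; ring
  nth_rewrite 2 [this]
  generalize P.d1 * y + P.d0 = N at *
  generalize P.c1 * y + P.c0 = W at *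
  field_simp
  ring

theorem denominator_inv (P : Params) (S : ℝ → ℝ) (σ : ℝ) {z : Ext} (hδ : P.delta ≠ 0)
    (hW : (P.inv S σ).c1 * z.2.y1 + (P.inv S σ).c0 ≠ 0) :
    P.c1 * ((P.inv S σ).toMap z).2.y1 + P.c0 = ((P.inv S σ).c1 * z.2.y1 + (P.inv S σ).c0)⁻¹ := by
  refine eq_inv_of_mul_eq_one_left ?_
  rw [toMap_y1, add_mul, mul_assoc, div_mul_cancel₀ _ hW]
  simp only [inv]
  field_simp
  unfold delta
  ring

/-- By `toMap_comp` it is enough to compose parameters: those of the composition agree with the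
parameters of `one` near the given time, with `σ² = 1` cancelling the two signs in `X`. -/
theorem inv_toMap (h : P.Admissible I) (hi : P.LocalInverse I tt) {σ : ℝ}
    (hσ : σ = 1 ∨ σ = -1) {z : Ext} (ht : z.1.1.1 ∈ tt.source)
    (hW : 0 < σ * (P.c1 * z.2.y1 + P.c0)) : (P.inv tt.symm σ).toMap (P.toMap z) = z := by
  have hWn : P.c1 * z.2.y1 + P.c0 ≠ 0 := right_ne_zero_of_mul hW.ne'
  have hδ := h.delta_ne (hi.sub ht)
  have hσσ : σ * σ = 1 := by rcases hσ with rfl | rfl <;> norm_num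
  rw [toMap_comp h (h.inv hi σ) hσ (hi.sub ht) (by rw [← hi.eq]; exact tt.map_source ht) hW
    (by rw [inv_denominator _ _ _ hδ hWn]; exact inv_ne_zero hWn)]
  refine Eq.trans (toMap_congr (Q := one) ?_ ?_ ?_ ?_ ?_ ?_ ?_ ?_) (toMap_one z)
  · filter_upwards [tt.open_source.mem_nhds ht] with s hs
    change tt.symm (P.T s) = s
    rw [← hi.eq, tt.left_inv hs]
  · filter_upwards [tt.open_source.mem_nhds ht] with s hs
    change P.X s + σ / P.delta * (-(σ * P.delta * P.X (tt.symm (P.T s))) /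
      √(P.delta / deriv P.T (tt.symm (P.T s))) * √(P.delta / deriv P.T s)) = 0
    rw [← hi.eq, tt.left_inv hs, div_mul_cancel₀ _ (Real.sqrt_pos.2 (h.div_pos (hi.sub hs))).ne']
    field_simp
    linear_combination -P.X s * hσσ
  all_goals
    simp only [comp, inv, one]
    field_simp
    try unfold delta
    try ring

/-- The denominators of `P` and of its inverse at corresponding points are reciprocal, so the same
sign `σ` serves in both directions. -/
theorem toMap_inv (h : P.Admissible I) (hi : P.LocalInverse I tt) {σ : ℝ}
    (hσ : σ = 1 ∨ σ = -1) {z : Ext} (ht : z.1.1.1 ∈ tt.target)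
    (hW : 0 < σ * ((P.inv tt.symm σ).c1 * z.2.y1 + (P.inv tt.symm σ).c0)) :
    P.toMap ((P.inv tt.symm σ).toMap z) = z := by
  have hWn := right_ne_zero_of_mul hW.ne'
  have hm := hi.sub (tt.map_target ht)
  have hδ := h.delta_ne hm
  have hσσ : σ * σ = 1 := by rcases hσ with rfl | rfl <;> norm_num
  rw [toMap_comp (h.inv hi σ) h hσ ht hm hW
    (by rw [denominator_inv _ _ _ hδ hWn]; exact inv_ne_zero hWn)]
  refine Eq.trans (toMap_congr (Q := one) ?_ ?_ ?_ ?_ ?_ ?_ ?_ ?_) (toMap_one z)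
  · filter_upwards [tt.open_target.mem_nhds ht] with s hs
    change P.T (tt.symm s) = s
    rw [← hi.eq, tt.right_inv hs]
  · filter_upwards [tt.open_target.mem_nhds ht] with s hs
    have hs' := hi.sub (tt.map_target hs)
    have e : deriv (P.inv tt.symm σ).T s = (deriv P.T (tt.symm s))⁻¹ :=
      (hi.hasDerivAt_symm h hs).deriv
    have hr := Real.sqrt_pos.2 (h.div_pos hs')
    change -(σ * P.delta * P.X (tt.symm s)) / √(P.delta / deriv P.T (tt.symm s))
      + σ / (P.inv tt.symm σ).delta * (P.X (tt.symm s) *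
        √((P.inv tt.symm σ).delta / deriv (P.inv tt.symm σ).T s)) = 0
    rw [e, delta_inv _ _ _ hδ, show P.delta⁻¹ / (deriv P.T (tt.symm s))⁻¹
      = (P.delta / deriv P.T (tt.symm s))⁻¹ by rw [inv_div_inv, inv_div], Real.sqrt_inv]
    field_simp
    ring
  all_goals
    simp only [comp, inv, one]
    field_simp
    try unfold delta
    try ring

/-- The local transformation of the extended space given by the parameters `P`. -/
noncomputable def toHomeo (P : Params) (I : Set ℝ) (tt : OpenPartialHomeomorph ℝ ℝ) (σ : ℝ)
    (h : P.Admissible I) (hi : P.LocalInverse I tt) (hσ : σ = 1 ∨ σ = -1) :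
    OpenPartialHomeomorph Ext Ext where
  toFun := P.toMap
  invFun := (P.inv tt.symm σ).toMap
  source := {z | z ∈ extDomain ∧ z.1.1.1 ∈ tt.source ∧ 0 < σ * (P.c1 * z.2.y1 + P.c0)}
  target := {z | z ∈ extDomain ∧ z.1.1.1 ∈ tt.target ∧
    0 < σ * ((P.inv tt.symm σ).c1 * z.2.y1 + (P.inv tt.symm σ).c0)}
  map_source' := by
    rintro z ⟨h1, h2, h3⟩
    have hWn := right_ne_zero_of_mul h3.ne'
    refine ⟨mul_ne_zero (mul_ne_zero (h.deriv_ne (hi.sub h2)) (pow_ne_zero 2 hWn)) h1, ?_, ?_⟩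
    · change P.T z.1.1.1 ∈ _
      rw [← hi.eq]; exact tt.map_source h2
    · rw [inv_denominator _ _ _ (h.delta_ne (hi.sub h2)) hWn, ← div_eq_mul_inv]
      exact div_pos_iff.2 (mul_pos_iff.1 h3)
  map_target' := by
    rintro z ⟨h1, h2, h3⟩
    have hWn := right_ne_zero_of_mul h3.ne'
    refine ⟨mul_ne_zero (mul_ne_zero ((h.inv hi σ).deriv_ne h2) (pow_ne_zero 2 hWn)) h1, ?_, ?_⟩
    · exact tt.map_target h2
    · rw [denominator_inv _ _ _ (h.delta_ne (hi.sub (tt.map_target h2))) hWn, ← div_eq_mul_inv]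
      exact div_pos_iff.2 (mul_pos_iff.1 h3)
  left_inv' := fun z hz => inv_toMap h hi hσ hz.2.1 hz.2.2
  right_inv' := fun z hz => toMap_inv h hi hσ hz.2.1 hz.2.2
  open_source := by
    have h1 : Continuous fun z : Ext => z.1.1.1 := by fun_prop
    have h2 : Continuous fun z : Ext => σ * (P.c1 * z.2.y1 + P.c0) := by unfold Arb.y1; fun_prop
    exact isOpen_extDomain.inter ((tt.open_source.preimage h1).inter
      (isOpen_lt continuous_const h2))
  open_target := by
    have h1 : Continuous fun z : Ext => z.1.1.1 := by fun_prop
    have h2 : Continuous fun z : Ext =>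
        σ * ((P.inv tt.symm σ).c1 * z.2.y1 + (P.inv tt.symm σ).c0) := by unfold Arb.y1; fun_prop
    exact isOpen_extDomain.inter ((tt.open_target.preimage h1).inter
      (isOpen_lt continuous_const h2))
  continuousOn_toFun := h.contDiffOn_toMap.continuousOn.mono fun z hz =>
    ⟨hz.1, hi.sub hz.2.1, right_ne_zero_of_mul hz.2.2.ne'⟩
  continuousOn_invFun := (h.inv hi σ).contDiffOn_toMap.continuousOn.mono fun z hz =>
    ⟨hz.1, hz.2.1, right_ne_zero_of_mul hz.2.2.ne'⟩

end inv

end Params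

/-! ### The explicit family is a pseudogroup -/

open Params

/-- Membership is a condition on germs. In this form closure under composition, inversion and
restriction can be checked point by point, without tracking sources. -/
theorem mem_breveGroup_iff {e : OpenPartialHomeomorph Ext Ext} :
    e ∈ breveGroup ↔ ∀ z ∈ e.source, ∃ (P : Params) (I : Set ℝ), P.Admissible I ∧
      z ∈ P.domain I ∧ e =ᶠ[𝓝 z] P.toMap := by
  constructor
  · intro h z hz
    obtain ⟨s, hs, hzs, P, hP⟩ := h z hz
    obtain ⟨I, hI, hd, he⟩ := hP.exists_admissible
    have hzr : z ∈ (e.restr s).source := by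
      rw [e.restr_source' s hs]; exact ⟨hz, hzs⟩
    refine ⟨P, I, hI, hd hzr, ?_⟩
    filter_upwards [(e.restr s).open_source.mem_nhds hzr] with w hw
    exact he w hw
  · intro h z hz
    obtain ⟨P, I, hI, hd, he⟩ := h z hz
    obtain ⟨s, hsub, hs, hzs⟩ := mem_nhds_iff.1
      (Filter.inter_mem (hI.isOpen_domain.mem_nhds hd) he)
    refine ⟨s, hs, hzs, P, hI.represents (e := e.restr s) ?_ ?_⟩ <;> rw [e.restr_source' s hs]
    · exact fun w hw => (hsub hw.2).1
    · exact fun w hw => (hsub hw.2).2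

theorem continuous_denominator (P : Params) :
    Continuous fun z : Ext => P.c1 * z.2.y1 + P.c0 := by unfold Arb.y1; fun_prop

theorem exists_sign {W : ℝ} (h : W ≠ 0) : ∃ σ : ℝ, (σ = 1 ∨ σ = -1) ∧ 0 < σ * W := by
  rcases lt_or_gt_of_ne h with h | h
  · exact ⟨-1, Or.inr rfl, by linarith⟩
  · exact ⟨1, Or.inl rfl, by linarith⟩

theorem eventually_sign (P : Params) {σ : ℝ} {z : Ext} (h : 0 < σ * (P.c1 * z.2.y1 + P.c0)) :
    ∀ᶠ w in 𝓝 z, 0 < σ * (P.c1 * w.2.y1 + P.c0) :=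
  ((continuous_const.mul (continuous_denominator P)).continuousAt.eventually_const_lt h)

theorem continuous_time : Continuous fun z : Ext => z.1.1.1 := by fun_prop

theorem comp_denominator (P Q : Params) (σ : ℝ) {z : Ext} (hW : P.c1 * z.2.y1 + P.c0 ≠ 0) :
    (comp Q P σ).c1 * z.2.y1 + (comp Q P σ).c0
      = (Q.c1 * (P.toMap z).2.y1 + Q.c0) * (P.c1 * z.2.y1 + P.c0) := by
  rw [toMap_y1, add_mul, mul_assoc, div_mul_cancel₀ _ hW]
  simp only [comp]
  ring

theorem trans_mem_breveGroup {e e' : OpenPartialHomeomorph Ext Ext} (he : e ∈ breveGroup)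
    (he' : e' ∈ breveGroup) : e.trans e' ∈ breveGroup := by
  rw [mem_breveGroup_iff] at *
  intro z hz
  rw [e.trans_source] at hz
  obtain ⟨P, I, hP, hzP, hPe⟩ := he z hz.1
  obtain ⟨Q, J, hQ, hzQ, hQe⟩ := he' (e z) hz.2
  have hez := hPe.eq_of_nhds
  rw [hez] at hzQ
  obtain ⟨σ, hσ, hpos⟩ := exists_sign hzP.2.2
  refine ⟨comp Q P σ, _, hP.comp hQ σ, ⟨hzP.1, ⟨hzP.2.1, hzQ.2.1⟩, ?_⟩, ?_⟩
  · rw [comp_denominator P Q σ hzP.2.2]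
    exact mul_ne_zero hzQ.2.2 hzP.2.2
  · have hc := e.continuousAt hz.1
    have hQd := hc.eventually (hQ.isOpen_domain.mem_nhds (by rw [hez]; exact hzQ))
    filter_upwards [hPe, hc.eventually hQe, hQd, hP.isOpen_domain.mem_nhds hzP,
      eventually_sign P hpos] with w h1 h2 h3 h4 h5
    change e' (e w) = _
    rw [h2, h1]
    rw [h1] at h3
    exact toMap_comp hP hQ hσ h4.2.1 h3.2.1 h5 h3.2.2

/-- Near `e.symm z'` the map `e` is given by parameters `P`, so its inverse must be given by the
inverse parameters. Continuity of `e.symm` keeps its values where the sign of the denominator and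
the local inverse of `T` are valid. -/
theorem symm_mem_breveGroup {e : OpenPartialHomeomorph Ext Ext} (he : e ∈ breveGroup) :
    e.symm ∈ breveGroup := by
  rw [mem_breveGroup_iff] at *
  intro z' hz'
  have hz : e.symm z' ∈ e.source := e.map_target hz'
  obtain ⟨P, I, hP, hzP, hPe⟩ := he _ hz
  obtain ⟨σ, hσ, hpos⟩ := exists_sign hzP.2.2
  obtain ⟨tt, hi, htt⟩ := hP.exists_localInverse hzP.2.1
  have hez : z' = P.toMap (e.symm z') := by rw [← hPe.eq_of_nhds, e.right_inv hz']
  have hm := (toHomeo P I tt σ hP hi hσ).map_source ⟨hzP.1, htt, hpos⟩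
  change P.toMap (e.symm z') ∈ _ at hm
  rw [← hez] at hm
  refine ⟨P.inv tt.symm σ, tt.target, hP.inv hi σ,
    ⟨hm.1, hm.2.1, right_ne_zero_of_mul hm.2.2.ne'⟩, ?_⟩
  have hc := e.symm.continuousAt hz'
  filter_upwards [hc.eventually hPe, hc.eventually (eventually_sign P hpos),
    hc.eventually (continuous_time.continuousAt.eventually (tt.open_source.mem_nhds htt)),
    e.open_target.mem_nhds hz'] with y h1 h2 h3 h4
  have h5 := inv_toMap hP hi hσ h3 h2
  rw [← h1, e.right_inv h4] at h5
  exact h5.symm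

theorem isPseudogroupOn_breveGroup : IsPseudogroupOn extDomain breveGroup := by
  have hsrc : ∀ e ∈ breveGroup, e.source ⊆ extDomain := by
    intro e he z hz
    obtain ⟨P, I, -, hd, -⟩ := mem_breveGroup_iff.1 he z hz
    exact hd.1
  exact
  { source_subset := hsrc
    target_subset := fun e he => hsrc e.symm (symm_mem_breveGroup he)
    id_mem := by
      intro hM
      rw [mem_breveGroup_iff]
      intro z hz
      refine ⟨one, univ, admissible_one, ⟨hz, mem_univ _, by simp [one]⟩, ?_⟩
      exact Eventually.of_forall fun w => (toMap_one w).symm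
    trans_mem := fun e he e' he' => trans_mem_breveGroup he he'
    symm_mem := fun e he => symm_mem_breveGroup he
    restr_mem := by
      intro e he s hs
      rw [mem_breveGroup_iff] at *
      intro z hz
      rw [e.restr_source' s hs] at hz
      exact he z hz.1
    eqOnSource_mem := by
      intro e he e' hee
      rw [mem_breveGroup_iff] at *
      intro z hz
      obtain ⟨P, I, hI, hd, hP⟩ := he z (hee.1 ▸ hz)
      refine ⟨P, I, hI, hd, ?_⟩
      filter_upwards [hP, e'.open_source.mem_nhds hz] with w h1 h2
      rw [← h1]
      exact hee.2 h2
    locality := by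
      intro e he
      rw [mem_breveGroup_iff]
      intro z hz
      obtain ⟨s, hs, hzs, hes⟩ := he z hz
      exact mem_breveGroup_iff.1 hes z (by rw [e.restr_source' s hs]; exact ⟨hz, hzs⟩) }

theorem toHomeo_mem_breveGroup {P : Params} {I : Set ℝ} {tt : OpenPartialHomeomorph ℝ ℝ} {σ : ℝ}
    (h : P.Admissible I) (hi : P.LocalInverse I tt) (hσ : σ = 1 ∨ σ = -1) :
    toHomeo P I tt σ h hi hσ ∈ breveGroup := by
  rw [mem_breveGroup_iff]
  exact fun z hz => ⟨P, I, h, ⟨hz.1, hi.sub hz.2.1, right_ne_zero_of_mul hz.2.2.ne'⟩,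
    EventuallyEq.rfl⟩

theorem contDiffOn_of_mem_breveGroup {e : OpenPartialHomeomorph Ext Ext} (he : e ∈ breveGroup) :
    ContDiffOn ℝ ∞ e e.source := by
  intro z hz
  obtain ⟨P, I, hI, hd, hP⟩ := mem_breveGroup_iff.1 he z hz
  exact ((hI.contDiffOn_toMap.contDiffAt (hI.isOpen_domain.mem_nhds hd)).congr_of_eventuallyEq
    hP).contDiffWithinAt

/-! ### Transformations of the explicit family map equations to equations -/

theorem contDiffOn_comp_time {f : ℝ → ℝ} {q : Base} {ε : ℝ}
    (hf : ContDiffOn ℝ ∞ f (Metric.ball q.1 ε)) :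
    ContDiffOn ℝ ∞ (fun r : Base => f r.1) (Metric.ball q ε) :=
  hf.comp contDiff_fst.contDiffOn fun _ hr => (mem_ball_base.1 hr).1

/-- The relations between the jets of two functions with graphs corresponding to each other under a
transformation that is affine in `x` and in `u`. -/
theorem affine_jet_relations {t x ε : ℝ} (hε : 0 < ε) {T m k w n l : ℝ → ℝ}
    (hT : ContDiffOn ℝ ∞ T (Metric.ball t ε)) (hm : ContDiffOn ℝ ∞ m (Metric.ball t ε))
    (hk : ContDiffOn ℝ ∞ k (Metric.ball t ε)) (hw : ContDiffOn ℝ ∞ w (Metric.ball t ε))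
    (hn : ContDiffOn ℝ ∞ n (Metric.ball t ε)) (hl : ContDiffOn ℝ ∞ l (Metric.ball t ε))
    {f g : Base → ℝ} (hf : ContDiffAt ℝ 2 f (t, x)) {q' : Base} (hq' : q' = (T t, m t * x + k t))
    (hg : ContDiffAt ℝ 2 g q')
    (heq : ∀ᶠ r in 𝓝 ((t, x) : Base), w r.1 * f r + (n r.1 * r.2 + l r.1)
      = g (T r.1, m r.1 * r.2 + k r.1)) :
    deriv w t * f (t, x) + (deriv n t * x + deriv l t) + w t * dt f (t, x)
        = dt g q' * deriv T t + dx g q' * (deriv m t * x + deriv k t) ∧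
      n t + w t * dx f (t, x) = dx g q' * m t ∧
      w t * dx (dx f) (t, x) = dx (dx g) q' * m t ^ 2 := by
  set p : Pt := ((t, x), f (t, x)) with hp
  have hpb : p ∈ Metric.ball p ε := Metric.mem_ball_self hε
  have hqb : ((t, x) : Base) ∈ Metric.ball p.1 ε := Metric.mem_ball_self hε
  have hIo : IsOpen (Metric.ball t ε) := Metric.isOpen_ball
  have htI := Metric.mem_ball_self (x := t) hε
  have sB : ∀ {F : Base → ℝ}, ContDiffOn ℝ ∞ F (Metric.ball p.1 ε) →
      ContDiffOn ℝ ∞ (fun r : Pt => F r.1) (Metric.ball p ε) := fun hF =>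
    hF.comp contDiff_fst.contDiffOn fun _ hr => (mem_ball_pt_iff_base.1 hr).1
  have hxs : ContDiffOn ℝ ∞ (fun r : Base => r.2) (Metric.ball p.1 ε) := contDiff_snd.contDiffOn
  have hΞ : ContDiffOn ℝ ∞ (fun r : Base => m r.1 * r.2 + k r.1) (Metric.ball p.1 ε) :=
    ((contDiffOn_comp_time hm).mul hxs).add (contDiffOn_comp_time hk)
  have hB : ContDiffOn ℝ ∞ (fun r : Base => n r.1 * r.2 + l r.1) (Metric.ball p.1 ε) :=
    ((contDiffOn_comp_time hn).mul hxs).add (contDiffOn_comp_time hl)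
  have hA : ContDiffOn ℝ ∞ (fun r : Base => w r.1) (Metric.ball p.1 ε) := contDiffOn_comp_time hw
  have hξ := sB hΞ
  have hη : ContDiffOn ℝ ∞ (fun r : Pt => w r.1.1 * r.2 + (n r.1.1 * r.1.2 + l r.1.1))
      (Metric.ball p ε) := ((sB hA).mul contDiff_snd.contDiffOn).add (sB hB)
  have dxl : ∀ (a b : ℝ → ℝ) (r : Base), dx (fun r : Base => a r.1 * r.2 + b r.1) r = a r.1 := by
    intro a b r
    exact ((((hasDerivAt_id r.2).const_mul (a r.1)).add_const (b r.1)).deriv).trans (mul_one _)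
  have dx0 : ∀ (a : ℝ → ℝ) (r : Base), dx (fun r : Base => a r.1) r = 0 := by
    intro a r; simp [dx]
  have dtl : ∀ {a b : ℝ → ℝ}, ContDiffOn ℝ ∞ a (Metric.ball t ε) →
      ContDiffOn ℝ ∞ b (Metric.ball t ε) →
      dt (fun r : Base => a r.1 * r.2 + b r.1) (t, x) = deriv a t * x + deriv b t := by
    intro a b ha hb
    exact (((hasDerivAt_deriv_of_contDiffOn hIo ha htI).mul_const x).add
      (hasDerivAt_deriv_of_contDiffOn hIo hb htI)).deriv
  have hc0 : ∀ {c : ℝ}, ContDiffOn ℝ ∞ (fun _ : Base => c) (Metric.ball p.1 ε) := contDiffOn_const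
  have PE := partials_of_affine hA hB (fun r _ => rfl) (p := p)
  have PEX := partials_of_affine (F := pX fun r : Pt => w r.1.1 * r.2 + (n r.1.1 * r.1.2 + l r.1.1))
    (A := fun _ => 0) (B := fun r => n r.1) hc0 (contDiffOn_comp_time hn) (p := p)
    (fun r hr => by rw [(PE r hr).2.1, dx0, dxl])
  have PEU := partials_of_affine (F := pU fun r : Pt => w r.1.1 * r.2 + (n r.1.1 * r.1.2 + l r.1.1))
    (A := fun _ => 0) (B := fun r => w r.1) hc0 hA (p := p)
    (fun r hr => by rw [(PE r hr).2.2]; ring)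
  have PX := partials_of_affine (F := fun r : Pt => m r.1.1 * r.1.2 + k r.1.1)
    (A := fun _ => 0) hc0 hΞ (p := p) (fun r _ => by ring)
  have PXX := partials_of_affine (F := pX fun r : Pt => m r.1.1 * r.1.2 + k r.1.1)
    (A := fun _ => 0) (B := fun r => m r.1) hc0 (contDiffOn_comp_time hm) (p := p)
    (fun r hr => by rw [(PX r hr).2.1, dx0 (fun _ => 0), dxl])
  have PXU := partials_of_affine (F := pU fun r : Pt => m r.1.1 * r.1.2 + k r.1.1)
    (A := fun _ => 0) (B := fun _ => 0) hc0 hc0 (p := p)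
    (fun r hr => by rw [(PX r hr).2.2]; ring)
  have key := jet_relations Metric.isOpen_ball hξ hη
    (hasDerivAt_deriv_of_contDiffOn hIo hT htI) hp hpb hf hq' hg heq
  have hdt0 : ∀ (c : ℝ) (r : Base), dt (fun _ => c) r = 0 := fun c r => by simp [dt]
  have hdtw : dt (fun r : Base => w r.1) (t, x) = deriv w t := rfl
  have hp1 : p.1 = (t, x) := rfl
  have hp2 : p.2 = f (t, x) := rfl
  rw [(PE p hpb).1, (PE p hpb).2.1, (PE p hpb).2.2, (PEX p hpb).2.1, (PEU p hpb).2.1,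
    (PEU p hpb).2.2, (PX p hpb).1, (PX p hpb).2.1, (PX p hpb).2.2, (PXX p hpb).2.1,
    (PXU p hpb).2.1, (PXU p hpb).2.2, hp1, hp2, dtl hn hl, dtl hm hk, hdtw, dxl, dxl] at key
  simp only [hdt0, dx0] at key
  obtain ⟨k1, k2, k3⟩ := key
  have z : ∀ r, dx (fun _ : Base => (0 : ℝ)) r = 0 := fun r => by simp [dx]
  simp only [z] at k2 k3
  refine ⟨by linear_combination k1, by linear_combination k2, by linear_combination k3⟩

/-- With the jets of `f` and `g` related by the chain rule, the defect of the target equation times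
`T_t` equals the defect of the source equation times `c₁Y¹ + c₀`. Both factors are nonzero. -/
theorem satisfiesAt_iff_of_toMap {θ θ' : ArbTuple} {φ : OpenPartialHomeomorph Pt Pt}
    {P : Params} {I : Set ℝ} (hP : P.Admissible I) {q : Base} {f g : Base → ℝ} (hq : q ∈ θ.dom)
    (hd : ((q, f q), θ.val q) ∈ P.domain I)
    (hφ : ∀ᶠ r in 𝓝 ((q, f q) : Pt), P.toMap (r, θ.val r.1) = (φ r, θ'.val (φ r).1))
    (hf : ContDiffAt ℝ 2 f q) (hg : ContDiffAt ℝ 2 g (φ (q, f q)).1)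
    (hfg : ∀ᶠ r in 𝓝 q, (φ (r, f r)).2 = g (φ (r, f r)).1) :
    SatisfiesAt θ f q ↔ SatisfiesAt θ' g (φ (q, f q)).1 := by
  obtain ⟨t, x⟩ := q
  obtain ⟨ε₀, hε₀, a10, a11, y0, y1, y2, hL⟩ := exists_localForm θ hq
  obtain ⟨ε₁, hε₁, hI⟩ := Metric.isOpen_iff.1 hP.isOpen t hd.2.1
  obtain ⟨ε, hε, hle₀, hle₁⟩ : ∃ ε > 0, ε ≤ ε₀ ∧ ε ≤ ε₁ :=
    ⟨min ε₀ ε₁, lt_min hε₀ hε₁, min_le_left _ _, min_le_right _ _⟩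
  replace hL := hL.mono hle₀
  replace hI := (Metric.ball_subset_ball (x := t) hle₁).trans hI
  have htI := Metric.mem_ball_self (x := t) hε
  have hqb := Metric.mem_ball_self (x := ((t, x) : Base)) hε
  have hpt := hφ.self_of_nhds
  have hTs := hP.smooth_T.mono hI
  have hT's := hP.smooth_deriv.mono hI
  have hXs := hP.smooth_X.mono hI
  set w : ℝ → ℝ := fun s => P.c1 * y1 s + P.c0 with hw
  have hws : ContDiffOn ℝ ∞ w (Metric.ball t ε) :=
    (contDiffOn_const.mul hL.s1).add contDiffOn_const
  have hEs : ContDiffOn ℝ ∞ (fun s => Real.exp (-y0 s / 2)) (Metric.ball t ε) :=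
    (hL.s0.neg.div_const 2).exp
  set m : ℝ → ℝ := fun s => deriv P.T s * w s with hm
  have hms : ContDiffOn ℝ ∞ m (Metric.ball t ε) := hT's.mul hws
  set k : ℝ → ℝ := fun s => deriv P.T s * w s * (Real.exp (-y0 s / 2) * P.X s) with hk
  have hks : ContDiffOn ℝ ∞ k (Metric.ball t ε) := hms.mul (hEs.mul hXs)
  set n : ℝ → ℝ := fun s => -(P.c1 * Real.exp (y0 s)) with hn
  have hns : ContDiffOn ℝ ∞ n (Metric.ball t ε) := (contDiffOn_const.mul hL.s0.exp).neg
  set l : ℝ → ℝ := fun s => P.c2 - P.c1 * y2 s with hl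
  have hls : ContDiffOn ℝ ∞ l (Metric.ball t ε) :=
    contDiffOn_const.sub (contDiffOn_const.mul hL.s2)
  have hform : ∀ᶠ r in 𝓝 (((t, x), f (t, x)) : Pt), φ r = ((P.T r.1.1, m r.1.1 * r.1.2 + k r.1.1),
      w r.1.1 * r.2 + (n r.1.1 * r.1.2 + l r.1.1)) := by
    have hb : ∀ᶠ r in 𝓝 (((t, x), f (t, x)) : Pt), r.1 ∈ Metric.ball ((t, x) : Base) ε :=
      continuous_fst.continuousAt.eventually (Metric.isOpen_ball.mem_nhds hqb)
    filter_upwards [hφ, hb] with r h1 h2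
    have h3 := congrArg Prod.fst h1
    dsimp only at h3
    rw [← h3]
    simp only [Params.toMap, hL.e0 _ h2, hL.e1 _ h2, hL.e2 _ h2]
    refine Prod.ext (Prod.ext rfl ?_) ?_
    · simp only [hm, hk, hw]; ring
    · simp only [hn, hl, hw]; ring
  have hgraph : ContinuousAt (fun r : Base => ((r, f r) : Pt)) (t, x) :=
    continuousAt_id.prodMk hf.continuousAt
  have hq' : (φ ((t, x), f (t, x))).1 = (P.T t, m t * x + k t) := by
    rw [hform.self_of_nhds]
  obtain ⟨r1, r2, r3⟩ := affine_jet_relations hε hTs hms hks hws hns hls hf hq' hg (by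
    filter_upwards [hfg, hgraph.eventually hform] with r h1 h2
    rw [h2] at h1
    exact h1)
  set q' := (φ ((t, x), f (t, x))).1 with hq'def
  set u := f (t, x) with hu
  have hu' : g q' = w t * u + (n t * x + l t) := by
    have h1 := hfg.self_of_nhds
    rw [hform.self_of_nhds] at h1
    rw [hq']
    exact h1.symm
  have v0 : (θ.val (t, x)).y0 = y0 t := hL.e0 _ hqb
  have v1 : (θ.val (t, x)).y1 = y1 t := hL.e1 _ hqb
  have v2 : (θ.val (t, x)).y2 = y2 t := hL.e2 _ hqb
  have v10 : (θ.val (t, x)).a10 = a10 t := hL.e10 _ hqb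
  have v11 : (θ.val (t, x)).a11 = a11 t := hL.e11 _ hqb
  have hv := congrArg Prod.snd hpt
  dsimp only at hv
  have b10 := congrArg Arb.a10 hv
  have b11 := congrArg Arb.a11 hv
  have b2 := congrArg Arb.a2 hv
  change P.toMap _ |>.2.1 = _ at b10
  change P.toMap _ |>.2.2.1 = _ at b11
  change P.toMap _ |>.2.2.2.1 = _ at b2
  simp only [Params.toMap, v0, v1, v2, v10, v11] at b10 b11 b2
  have hT0 : deriv P.T t ≠ 0 := hP.deriv_ne hd.2.1
  have hW0 : P.c1 * y1 t + P.c0 ≠ 0 := by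
    have := hd.2.2
    dsimp only at this
    rwa [v1] at this
  have Dw : HasDerivAt w (P.c1 * Real.exp (y0 t)) t :=
    ((hL.d1 t htI).const_mul P.c1).add_const P.c0
  have DT' := hP.hasDerivAt_T' hd.2.1
  have DX := hP.hasDerivAt_X hd.2.1
  have DE : HasDerivAt (fun s => Real.exp (-y0 s / 2)) (Real.exp (-y0 t / 2) * (-a11 t / 2)) t :=
    ((hL.d0 t htI).neg.div_const 2).exp
  have Dm := DT'.mul Dw
  have Dk := Dm.mul (DE.mul DX)
  have Dn : HasDerivAt n (-(P.c1 * (Real.exp (y0 t) * a11 t))) t :=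
    ((hL.d0 t htI).exp.const_mul P.c1).neg
  have Dl : HasDerivAt l (-(P.c1 * (a10 t * Real.exp (y0 t)))) t :=
    (((hL.d2 t htI).const_mul P.c1).const_sub P.c2)
  have hm' : deriv m t = _ := Dm.deriv
  have hk' : deriv k t = _ := Dk.deriv
  rw [Dw.deriv, Dn.deriv, Dl.deriv, hm', hk'] at r1
  unfold SatisfiesAt
  have hq2 : q'.2 = m t * x + k t := by rw [hq']
  rw [← b10, ← b11, ← b2, hu', hq2, v10, v11, ← hu]
  clear_value q' u
  generalize dt g q' = gt at *
  generalize dx (dx g) q' = gxx at *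
  generalize dx g q' = gx at *
  simp only [hm, hk, hn, hl, hw, Pi.mul_apply] at r1 r2 r3 ⊢
  set E := Real.exp (y0 t / 2) with hE
  have hE0 : E ≠ 0 := (Real.exp_pos _).ne'
  have e1 : Real.exp (y0 t) = E ^ 2 := by rw [hE, ← Real.exp_nat_mul]; congr 1; push_cast; ring
  have e2 : Real.exp (-y0 t / 2) = E⁻¹ := by rw [hE, ← Real.exp_neg]; congr 1; ring
  rw [e1, e2] at r1
  rw [e1] at r2
  rw [e1, e2]
  generalize P.c1 * y1 t + P.c0 = W at *
  generalize dt f (t, x) = a at *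
  generalize dx (dx f) (t, x) = c at *
  generalize dx f (t, x) = b at *
  have s2 : gx = (W * b - P.c1 * E ^ 2) / (deriv P.T t * W) := by
    rw [eq_div_iff (mul_ne_zero hT0 hW0)]; linear_combination -r2
  have s3 : gxx = c / (deriv P.T t ^ 2 * W) := by
    rw [eq_div_iff (by positivity)]
    refine mul_right_cancel₀ hW0 ?_
    linear_combination -r3
  -- The proportionality of the two defects. After eliminating the jet of `g` it is a rational
  -- identity in `E = exp (Y⁰/2)` and the remaining jet values.
  have key : deriv P.T t * ((gt + (W * u + (-(P.c1 * E ^ 2) * x + (P.c2 - P.c1 * y2 t))) * gx)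
      - (deriv P.T t * W ^ 2 * (θ.val (t, x)).a2 * gxx +
        (1 / deriv P.T t * (a11 t - deriv (deriv P.T) t / deriv P.T t - 2 * P.c1 * E ^ 2 / W) *
          (deriv P.T t * W * x + deriv P.T t * W * (E⁻¹ * P.X t)) +
        (W * (a10 t - 1 / 2 * E⁻¹ * P.X t * a11 t - E⁻¹ * deriv P.X t) + P.c1 * E * P.X t + P.c2
          - P.c1 * y2 t)) * gx))
      = W * ((a + u * b) - ((θ.val (t, x)).a2 * c + (a11 t * x + a10 t) * b)) := by
    subst s2 s3
    generalize deriv P.X t = X' at *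
    generalize deriv (deriv P.T) t = T'' at *
    generalize deriv P.T t = T' at *
    have s1 : gt = (P.c1 * E ^ 2 * u + (-(P.c1 * (E ^ 2 * a11 t)) * x
      + -(P.c1 * (a10 t * E ^ 2))) + W * a - (W * b - P.c1 * E ^ 2) / (T' * W) *
        ((T'' * W + T' * (P.c1 * E ^ 2)) * x + ((T'' * W + T' * (P.c1 * E ^ 2)) * (E⁻¹ * P.X t)
          + T' * W * (E⁻¹ * (-a11 t / 2) * P.X t + E⁻¹ * X')))) / T' := by
      rw [eq_div_iff hT0]; linear_combination -r1
    rw [s1]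
    field_simp
    ring
  rw [← sub_eq_zero, ← sub_eq_zero (b := _ + _ * gx)]
  constructor
  · intro h0
    rw [h0, mul_zero] at key
    exact (mul_eq_zero.1 key).resolve_left hT0
  · intro h0
    rw [h0, mul_zero] at key
    exact (mul_eq_zero.1 key.symm).resolve_left hW0

/-! ### Differential consequences for the transformed arbitrary elements -/

namespace Params

/-- The transformed `x`-independent arbitrary elements as functions of the old time. -/
noncomputable def arbCurve (P : Params) (a10 a11 y0 y1 y2 : ℝ → ℝ) (s : ℝ) : Arb :=
  (P.toMap (((s, 0), 0), (a10 s, a11 s, 1, y0 s, y1 s, y2 s))).2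

section
variable {P : Params} {I : Set ℝ} {t : ℝ} {a10 a11 y0 y1 y2 : ℝ → ℝ}

theorem exp_arbCurve_y0 (hP : P.Admissible I) (ht : t ∈ I) (hW : P.c1 * y1 t + P.c0 ≠ 0) :
    Real.exp (P.arbCurve a10 a11 y0 y1 y2 t).y0 =
      Real.exp (y0 t) * (P.delta / (deriv P.T t * (P.c1 * y1 t + P.c0) ^ 2)) := by
  change Real.exp (y0 t + Real.log (P.delta / (deriv P.T t * (P.c1 * y1 t + P.c0) ^ 2))) = _
  rw [Real.exp_add, Real.exp_log]
  rw [← div_div]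
  exact div_pos (hP.div_pos ht) (by positivity)

/-- These are the three differential constraints for the target elements, still in the old time; the
factor `T_t` disappears on passing to the new time. -/
theorem hasDerivAt_arbCurve (hP : P.Admissible I) (ht : t ∈ I)
    (h0 : HasDerivAt y0 (a11 t) t) (h1 : HasDerivAt y1 (Real.exp (y0 t)) t)
    (h2 : HasDerivAt y2 (a10 t * Real.exp (y0 t)) t) (hW : P.c1 * y1 t + P.c0 ≠ 0) :
    HasDerivAt (fun s => (P.arbCurve a10 a11 y0 y1 y2 s).y0)
      (deriv P.T t * (P.arbCurve a10 a11 y0 y1 y2 t).a11) t ∧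
    HasDerivAt (fun s => (P.arbCurve a10 a11 y0 y1 y2 s).y1)
      (deriv P.T t * Real.exp (P.arbCurve a10 a11 y0 y1 y2 t).y0) t ∧
    HasDerivAt (fun s => (P.arbCurve a10 a11 y0 y1 y2 s).y2)
      (deriv P.T t * ((P.arbCurve a10 a11 y0 y1 y2 t).a10 *
        Real.exp (P.arbCurve a10 a11 y0 y1 y2 t).y0)) t := by
  have hT0 := hP.deriv_ne ht
  have hδ := hP.delta_ne ht
  have DT := hP.hasDerivAt_T' ht
  have DX := hP.hasDerivAt_X ht
  have Dw : HasDerivAt (fun s => P.c1 * y1 s + P.c0) (P.c1 * Real.exp (y0 t)) t :=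
    (h1.const_mul P.c1).add_const P.c0
  have DN : HasDerivAt (fun s => P.d1 * y1 s + P.d0) (P.d1 * Real.exp (y0 t)) t :=
    (h1.const_mul P.d1).add_const P.d0
  have DE : HasDerivAt (fun s => Real.exp (y0 s / 2)) (Real.exp (y0 t / 2) * (a11 t / 2)) t :=
    (h0.div_const 2).exp
  have hTw : deriv P.T t * (P.c1 * y1 t + P.c0) ^ 2 ≠ 0 := mul_ne_zero hT0 (pow_ne_zero 2 hW)
  have hd1 : P.d1 = (P.c1 * (P.d1 * y1 t + P.d0) + P.delta) / (P.c1 * y1 t + P.c0) := by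
    rw [eq_div_iff hW]; unfold delta; ring
  rw [exp_arbCurve_y0 hP ht hW]
  refine ⟨?_, ?_, ?_⟩
  · have D := h0.add ((HasDerivAt.div (hasDerivAt_const t P.delta)
      (DT.mul (Dw.pow 2)) hTw).log (div_ne_zero hδ hTw))
    refine D.congr_deriv ?_
    change _ = deriv P.T t * (1 / deriv P.T t * (a11 t - deriv (deriv P.T) t / deriv P.T t
      - 2 * P.c1 * Real.exp (y0 t) / (P.c1 * y1 t + P.c0)))
    simp only [Pi.mul_apply, Pi.pow_apply, Pi.div_apply]
    generalize P.c1 * y1 t + P.c0 = W at *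
    push_cast
    field_simp
    ring
  · have D := DN.div Dw hW
    refine D.congr_deriv ?_
    generalize P.d1 * y1 t + P.d0 = N at *
    generalize P.c1 * y1 t + P.c0 = W at *
    rw [hd1]
    field_simp
    ring
  · have D := (((h2.const_mul P.delta).div Dw hW).sub (((DX.const_mul P.delta).mul DE).div
      Dw hW)).add ((DN.div Dw hW).const_mul P.c2) |>.add_const P.c3
    refine D.congr_deriv ?_
    change _ = deriv P.T t * (((P.c1 * y1 t + P.c0) * (a10 t - 1 / 2 * Real.exp (-y0 t / 2) * P.X t
      * a11 t - Real.exp (-y0 t / 2) * deriv P.X t) + P.c1 * Real.exp (y0 t / 2) * P.X t + P.c2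
      - P.c1 * y2 t) * (Real.exp (y0 t) * (P.delta / (deriv P.T t * (P.c1 * y1 t + P.c0) ^ 2))))
    simp only [Pi.mul_apply]
    set E := Real.exp (y0 t / 2) with hE
    have hE0 : E ≠ 0 := (Real.exp_pos _).ne'
    have e1 : Real.exp (y0 t) = E ^ 2 := by rw [hE, ← Real.exp_nat_mul]; congr 1; push_cast; ring
    have e2 : Real.exp (-y0 t / 2) = E⁻¹ := by rw [hE, ← Real.exp_neg]; congr 1; ring
    rw [e1, e2]
    generalize P.d1 * y1 t + P.d0 = N at *
    generalize P.c1 * y1 t + P.c0 = W at *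
    rw [hd1]
    field_simp
    ring

end

end Params

/-! ### Triples generated by transformations of the extended space -/

section
variable {θ θ' : ArbTuple} {φ : OpenPartialHomeomorph Pt Pt} {e : OpenPartialHomeomorph Ext Ext}
  {p : Pt}

theorem contDiffAt_lift (hp : p.1 ∈ θ.dom) :
    ContDiffAt ℝ ∞ (fun r : Pt => ((r, θ.val r.1) : Ext)) p :=
  contDiffAt_id.prodMk ((θ.smooth.contDiffAt (θ.isOpen_dom.mem_nhds hp)).comp p contDiffAt_fst)

theorem InducesAt.symm (h : InducesAt e θ φ θ' p) (hp : p ∈ φ.source) (hθ : p.1 ∈ θ.dom) :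
    InducesAt e.symm θ' φ.symm θ (φ p) := by
  have h0 := h.2.self_of_nhds
  refine ⟨?_, ?_⟩
  · rw [← h0]; exact e.map_source h.1
  · have hc : Tendsto φ.symm (𝓝 (φ p)) (𝓝 p) := by
      have := φ.continuousAt_symm (φ.map_source hp)
      rwa [ContinuousAt, φ.left_inv hp] at this
    have hs : ∀ᶠ r in 𝓝 p, ((r, θ.val r.1) : Ext) ∈ e.source :=
      (contDiffAt_lift hθ).continuousAt.preimage_mem_nhds (e.open_source.mem_nhds h.1)
    filter_upwards [hc.eventually h.2, hc.eventually hs,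
      φ.open_target.mem_nhds (φ.map_source hp)] with s h1 h2 h3
    rw [φ.right_inv h3] at h1
    rw [← h1, e.left_inv h2]

/-- Locally `φ` is the lift `r ↦ (r, θ.val r.1)`, followed by `e` and the projection, all of which
are smooth. -/
theorem contDiffOn_of_inducesAt (hc : Compatible θ φ θ')
    (h : ∀ p ∈ φ.source, ∃ e : OpenPartialHomeomorph Ext Ext, ContDiffOn ℝ ∞ e e.source ∧
      InducesAt e θ φ θ' p) : ContDiffOn ℝ ∞ φ φ.source := by
  intro p hp
  obtain ⟨e, he, hs, hi⟩ := h p hp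
  have h1 : ContDiffAt ℝ ∞ (fun r : Pt => (e (r, θ.val r.1)).1) p :=
    contDiffAt_fst.comp p (ContDiffAt.comp p (he.contDiffAt (e.open_source.mem_nhds hs))
      (contDiffAt_lift (hc.1 p hp)))
  refine (h1.congr_of_eventuallyEq ?_).contDiffWithinAt
  filter_upwards [hi] with r hr
  rw [hr]

theorem contDiffOn_symm_of_inducesAt (hc : Compatible θ φ θ')
    (h : ∀ p ∈ φ.source, ∃ e : OpenPartialHomeomorph Ext Ext, ContDiffOn ℝ ∞ e.symm e.target ∧
      InducesAt e θ φ θ' p) : ContDiffOn ℝ ∞ φ.symm φ.target := by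
  refine contDiffOn_of_inducesAt (θ := θ') (φ := φ.symm) (θ' := θ) ⟨hc.2, hc.1⟩ fun s hs => ?_
  obtain ⟨e, he, hi⟩ := h _ (φ.map_target hs)
  have := hi.symm (φ.map_target hs) (hc.1 _ (φ.map_target hs))
  rw [φ.right_inv hs] at this
  exact ⟨e.symm, he, this⟩

end

theorem generated_breveGroup_subset : generated breveGroup ⊆ equivalenceGroupoid := by
  rintro ⟨θ, φ, θ'⟩ ⟨hc, h⟩
  dsimp only at hc h
  refine ⟨hc, ?_, ?_, ?_⟩
  · refine contDiffOn_of_inducesAt hc fun p hp => ?_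
    obtain ⟨e, he, hi⟩ := h p hp
    exact ⟨e, contDiffOn_of_mem_breveGroup he, hi⟩
  · refine contDiffOn_symm_of_inducesAt hc fun p hp => ?_
    obtain ⟨e, he, hi⟩ := h p hp
    exact ⟨e, contDiffOn_of_mem_breveGroup (symm_mem_breveGroup he), hi⟩
  · intro q f g hq hf hg hm
    obtain ⟨e, he, hs, hi⟩ := h _ hq
    obtain ⟨P, I, hP, hd, heP⟩ := mem_breveGroup_iff.1 he _ hs
    refine satisfiesAt_iff_of_toMap hP (hc.1 _ hq) hd ?_ hf hg hm.1
    filter_upwards [hi, (contDiffAt_lift (hc.1 _ hq)).continuousAt.eventually heP] with r h1 h2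
    rw [← h1, h2]

/-- A generalized equivalence inducing `φ` near a point also induces an admissible `φ₁` there. The
germs of `φ` and `φ₁` coincide, as do the target values, and mapping equations depends only on these
data. -/
theorem generated_generalizedEquivalences_subset :
    generated generalizedEquivalences ⊆ equivalenceGroupoid := by
  rintro ⟨θ, φ, θ'⟩ ⟨hc, h⟩
  dsimp only at hc h
  refine ⟨hc, ?_, ?_, ?_⟩
  · refine contDiffOn_of_inducesAt hc fun p hp => ?_
    obtain ⟨e, he, hi⟩ := h p hp
    exact ⟨e, he.2.2.1, hi⟩
  · refine contDiffOn_symm_of_inducesAt hc fun p hp => ?_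
    obtain ⟨e, he, hi⟩ := h p hp
    exact ⟨e, he.2.2.2.1, hi⟩
  · intro q f g hq hf hg hm
    obtain ⟨e, he, hs, hi⟩ := h _ hq
    obtain ⟨φ₁, θ₁, hτ, hq₁, hs₁, hi₁⟩ := he.2.2.2.2 θ _ (hc.1 _ hq) hs
    have heq : ∀ᶠ r in 𝓝 ((q, f q) : Pt), φ r = φ₁ r ∧ θ'.val (φ r).1 = θ₁.val (φ₁ r).1 := by
      filter_upwards [hi, hi₁] with r h1 h2
      rw [h1, Prod.mk.injEq] at h2
      exact h2
    have h0 := heq.self_of_nhds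
    have hgr : Tendsto (fun r : Base => ((r, f r) : Pt)) (𝓝 q) (𝓝 (q, f q)) :=
      (continuousAt_id.prodMk hf.continuousAt)
    have hgr' : Tendsto (fun r : Base => ((r, g r) : Pt)) (𝓝 (φ (q, f q)).1) (𝓝 (φ (q, f q))) := by
      have := (continuousAt_id.prodMk hg.continuousAt : ContinuousAt (fun r : Base => (r, g r)) _)
      rw [ContinuousAt, id, ← hm.1.self_of_nhds] at this
      exact this
    have hsy : Tendsto φ.symm (𝓝 (φ (q, f q))) (𝓝 (q, f q)) := by
      have := φ.continuousAt_symm (φ.map_source hq)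
      rwa [ContinuousAt, φ.left_inv hq] at this
    -- Equality of the inverse germs is needed as well, since `MapsGraphAt` imposes a condition on
    -- both sides.
    have hinv : ∀ᶠ s in 𝓝 (φ (q, f q)), φ₁.symm s = φ.symm s := by
      filter_upwards [hsy.eventually heq, hsy.eventually (φ₁.open_source.mem_nhds hq₁),
        φ.open_target.mem_nhds (φ.map_source hq)] with s h1 h2 h3
      have h4 : s = φ₁ (φ.symm s) := by rw [← h1.1, φ.right_inv h3]
      conv_lhs => rw [h4]
      exact φ₁.left_inv h2
    have key := hτ.2.2.2 q f g hq₁ hf (by rwa [← h0.1]) ⟨?_, ?_⟩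
    · refine key.trans ?_
      unfold SatisfiesAt
      dsimp only
      rw [h0.2, h0.1]
    · filter_upwards [hm.1, hgr.eventually heq] with r h1 h2
      rwa [← h2.1]
    · change ∀ᶠ r in 𝓝 (φ₁ (q, f q)).1, _
      rw [← h0.1]
      filter_upwards [hm.2, hgr'.eventually hinv] with r h1 h2
      rwa [h2]

/-! ### Induced transformations -/

theorem dx_eq_zero_of_eqOn {F : Base → ℝ} {f : ℝ → ℝ} {U : Set Base} (hU : IsOpen U)
    (hF : ∀ r ∈ U, F r = f r.1) {q : Base} (hq : q ∈ U) : dx F q = 0 := by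
  have h : (fun y => F (q.1, y)) =ᶠ[𝓝 q.2] fun _ => f q.1 := by
    have hc : ContinuousAt (fun y : ℝ => ((q.1, y) : Base)) q.2 := by fun_prop
    filter_upwards [hc.preimage_mem_nhds (hU.mem_nhds hq)] with y hy
    exact hF _ hy
  unfold dx
  rw [h.deriv_eq, deriv_const]

theorem dt_eq_of_eqOn {F : Base → ℝ} {f : ℝ → ℝ} {U : Set Base} (hU : IsOpen U)
    (hF : ∀ r ∈ U, F r = f r.1) {q : Base} (hq : q ∈ U) {d : ℝ} (hd : HasDerivAt f d q.1) :
    dt F q = d := by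
  have h : (fun s => F (s, q.2)) =ᶠ[𝓝 q.1] f := by
    have hc : ContinuousAt (fun s : ℝ => ((s, q.2) : Base)) q.1 := by fun_prop
    filter_upwards [hc.preimage_mem_nhds (hU.mem_nhds hq)] with y hy
    exact hF _ hy
  unfold dt
  rw [h.deriv_eq, hd.deriv]

/-- A local transformation of a line bundle that is affine along the fibers. -/
noncomputable def fiberAffine {B : Type*} [TopologicalSpace B] (β : OpenPartialHomeomorph B B)
    (m k : B → ℝ) (hm : ContinuousOn m β.source) (hk : ContinuousOn k β.source)
    (h0 : ∀ b ∈ β.source, m b ≠ 0) : OpenPartialHomeomorph (B × ℝ) (B × ℝ) where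
  toFun r := (β r.1, m r.1 * r.2 + k r.1)
  invFun s := (β.symm s.1, (s.2 - k (β.symm s.1)) / m (β.symm s.1))
  source := Prod.fst ⁻¹' β.source
  target := Prod.fst ⁻¹' β.target
  map_source' _ hr := β.map_source hr
  map_target' _ hs := β.map_target hs
  left_inv' := by
    rintro ⟨b, x⟩ hr
    have := h0 b hr
    dsimp only
    rw [β.left_inv hr]
    refine Prod.ext rfl ?_
    dsimp only
    field_simp
    ring
  right_inv' := by
    rintro ⟨b, x⟩ hr
    have := h0 _ (β.map_target hr)
    dsimp only
    rw [β.right_inv hr]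
    refine Prod.ext rfl ?_
    dsimp only
    field_simp
    ring
  open_source := β.open_source.preimage continuous_fst
  open_target := β.open_target.preimage continuous_fst
  continuousOn_toFun := by
    have hf : ContinuousOn (Prod.fst : B × ℝ → B) (Prod.fst ⁻¹' β.source) :=
      continuous_fst.continuousOn
    exact (β.continuousOn.comp hf fun _ h => h).prodMk
      (((hm.comp hf fun _ h => h).mul continuous_snd.continuousOn).add (hk.comp hf fun _ h => h))
  continuousOn_invFun := by
    have hf : ContinuousOn (fun s : B × ℝ => β.symm s.1) (Prod.fst ⁻¹' β.target) :=
      β.continuousOn_symm.comp continuous_fst.continuousOn fun _ h => h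
    have hM : MapsTo (fun s : B × ℝ => β.symm s.1) (Prod.fst ⁻¹' β.target) β.source :=
      fun _ h => β.map_target h
    exact hf.prodMk ((continuous_snd.continuousOn.sub (hk.comp hf hM)).div (hm.comp hf hM)
      fun s hs => h0 _ (β.map_target hs))

namespace Params

theorem Admissible.exists_mem_breveGroup {P : Params} {I : Set ℝ} (hP : P.Admissible I) {z : Ext}
    (hz : z ∈ P.domain I) : ∃ e ∈ breveGroup, z ∈ e.source ∧ ∀ w, e w = P.toMap w := by
  obtain ⟨tt, hi, ht⟩ := hP.exists_localInverse hz.2.1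
  obtain ⟨σ, hσ, hpos⟩ := exists_sign hz.2.2
  exact ⟨toHomeo P I tt σ hP hi hσ, toHomeo_mem_breveGroup hP hi hσ, ⟨hz.1, ht, hpos⟩,
    fun w => rfl⟩

/-- Each transformation of the family induces an admissible transformation of each value of the
arbitrary elements. -/
theorem Admissible.exists_induced {P : Params} {I : Set ℝ} (hP : P.Admissible I) {θ : ArbTuple}
    {p : Pt} (hp : p.1 ∈ θ.dom) (hd : (p, θ.val p.1) ∈ P.domain I) :
    ∃ (φ : OpenPartialHomeomorph Pt Pt) (θ' : ArbTuple), Compatible θ φ θ' ∧ p ∈ φ.source ∧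
      ∀ r ∈ φ.source, (r, θ.val r.1) ∈ P.domain I ∧
        P.toMap (r, θ.val r.1) = (φ r, θ'.val (φ r).1) := by
  obtain ⟨q, u⟩ := p
  obtain ⟨tt, hi, htt⟩ := hP.exists_localInverse hd.2.1
  change q ∈ θ.dom at hp
  change q.1 ∈ tt.source at htt
  obtain ⟨ε₀, hε₀, a10, a11, y0, y1, y2, hL₀⟩ := exists_localForm θ hp
  have hW₀ : P.c1 * y1 q.1 + P.c0 ≠ 0 := by
    rw [← hL₀.e1 q (Metric.mem_ball_self hε₀)]; exact hd.2.2
  have hev : ∀ᶠ t in 𝓝 q.1, t ∈ tt.source ∧ P.c1 * y1 t + P.c0 ≠ 0 := by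
    refine (tt.open_source.eventually_mem htt).and ?_
    refine ContinuousAt.eventually_ne ?_ hW₀
    exact (continuousAt_const.mul
      (hL₀.d1 _ (Metric.mem_ball_self hε₀)).continuousAt).add continuousAt_const
  obtain ⟨ε₁, hε₁, hball⟩ := Metric.eventually_nhds_iff_ball.1 hev
  obtain ⟨ε, hε, hle₀, hle₁⟩ : ∃ ε > 0, ε ≤ ε₀ ∧ ε ≤ ε₁ :=
    ⟨min ε₀ ε₁, lt_min hε₀ hε₁, min_le_left _ _, min_le_right _ _⟩
  have hL := hL₀.mono hle₀
  have hB : ∀ t ∈ Metric.ball q.1 ε, t ∈ tt.source ∧ P.c1 * y1 t + P.c0 ≠ 0 :=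
    fun t ht => hball t (Metric.ball_subset_ball hle₁ ht)
  have hI : Metric.ball q.1 ε ⊆ I := fun t ht => hi.sub (hB t ht).1
  have hT' := hP.smooth_deriv.mono hI
  have hX := hP.smooth_X.mono hI
  let m : ℝ → ℝ := fun t => deriv P.T t * (P.c1 * y1 t + P.c0)
  let k : ℝ → ℝ := fun t => m t * (Real.exp (-y0 t / 2) * P.X t)
  have hm : ContDiffOn ℝ ∞ m (Metric.ball q.1 ε) :=
    hT'.mul ((contDiffOn_const.mul hL.s1).add contDiffOn_const)
  have hk : ContDiffOn ℝ ∞ k (Metric.ball q.1 ε) :=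
    hm.mul (((hL.s0.neg.div_const 2).exp).mul hX)
  have hm0 : ∀ t ∈ Metric.ball q.1 ε, m t ≠ 0 := fun t ht =>
    mul_ne_zero (hP.deriv_ne (hI ht)) (hB t ht).2
  -- The point transformation is built in stages: `τ` on time, `β` affine in `x` over `τ`, and
  -- finally `φ` affine in `u` over `β`.
  let τ := tt.restrOpen (Metric.ball q.1 ε) Metric.isOpen_ball
  have hτs : ∀ t, t ∈ τ.source ↔ t ∈ tt.source ∧ t ∈ Metric.ball q.1 ε := fun t => Iff.rfl
  have hτ : τ.source ⊆ Metric.ball q.1 ε := fun t ht => ((hτs t).1 ht).2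
  let β₀ := fiberAffine τ m k (hm.continuousOn.mono hτ) (hk.continuousOn.mono hτ)
    fun t ht => hm0 t (hτ ht)
  let β := β₀.restrOpen (Metric.ball q ε) Metric.isOpen_ball
  have hβs : ∀ r, r ∈ β.source ↔ r ∈ Metric.ball q ε := by
    intro r
    refine ⟨fun h => h.2, fun h => ⟨?_, h⟩⟩
    have := (mem_ball_base.1 h).1
    exact ⟨(hB _ this).1, this⟩
  have hβt : ∀ s ∈ β.target, s.1 ∈ tt.target ∧ β.symm s ∈ Metric.ball q ε := fun s hs =>
    ⟨hs.1.1, (hβs _).1 (β.map_target hs)⟩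
  have hβ : ∀ r, β r = (P.T r.1, m r.1 * r.2 + k r.1) := fun r => Prod.ext (hi.eq _) rfl
  have hβi : ∀ s, β.symm s = (tt.symm s.1, (s.2 - k (tt.symm s.1)) / m (tt.symm s.1)) :=
    fun s => rfl
  have hsym : ContDiffOn ℝ ∞ (fun s : Base => tt.symm s.1) β.target :=
    hi.smooth.comp contDiff_fst.contDiffOn fun s hs => (hβt s hs).1
  have hmap : MapsTo (fun s : Base => tt.symm s.1) β.target (Metric.ball q.1 ε) := fun s hs =>
    (mem_ball_base.1 (hβt s hs).2).1
  have hβsm : ContDiffOn ℝ ∞ β.symm β.target :=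
    hsym.prodMk ((contDiff_snd.contDiffOn.sub (hk.comp hsym hmap)).div (hm.comp hsym hmap)
      fun s hs => hm0 _ (hmap hs))
  have hθs : ContDiffOn ℝ ∞ (fun s => θ.val (β.symm s)) β.target :=
    θ.smooth.comp hβsm fun s hs => hL.sub (hβt s hs).2
  have hdom : ∀ r ∈ Metric.ball q ε, ∀ v : ℝ, ((r, v), θ.val r) ∈ P.domain I := by
    intro r hr v
    have ht := (mem_ball_base.1 hr).1
    refine ⟨θ.a2_ne r (hL.sub hr), hI ht, ?_⟩
    change P.c1 * (θ.val r).y1 + P.c0 ≠ 0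
    rw [hL.e1 r hr]; exact (hB _ ht).2
  -- The value `0` for `u` is arbitrary: the transformed arbitrary elements do not depend on `u`.
  let val' : Base → Arb := fun s => (P.toMap ((β.symm s, 0), θ.val (β.symm s))).2
  have hval : ∀ s ∈ β.target, (val' s).a10 = (P.arbCurve a10 a11 y0 y1 y2 (tt.symm s.1)).a10 ∧
      (val' s).a11 = (P.arbCurve a10 a11 y0 y1 y2 (tt.symm s.1)).a11 ∧
      (val' s).y0 = (P.arbCurve a10 a11 y0 y1 y2 (tt.symm s.1)).y0 ∧
      (val' s).y1 = (P.arbCurve a10 a11 y0 y1 y2 (tt.symm s.1)).y1 ∧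
      (val' s).y2 = (P.arbCurve a10 a11 y0 y1 y2 (tt.symm s.1)).y2 := by
    intro s hs
    have hr := (hβt s hs).2
    have h10 := hL.e10 _ hr
    have h11 := hL.e11 _ hr
    have h0 := hL.e0 _ hr
    have h1 := hL.e1 _ hr
    have h2 := hL.e2 _ hr
    simp only [val', arbCurve, toMap, Arb.a10, Arb.a11, Arb.y0, Arb.y1, Arb.y2]
        at h10 h11 h0 h1 h2 ⊢
    rw [h10, h11, h0, h1, h2]
    exact ⟨rfl, rfl, rfl, rfl, rfl⟩
  -- Passing from old to new time divides derivatives by `T_t`.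
  have hder : ∀ s ∈ β.target, ∀ {g : ℝ → ℝ} {d : ℝ},
      HasDerivAt g (deriv P.T (tt.symm s.1) * d) (tt.symm s.1) →
      HasDerivAt (fun v => g (tt.symm v)) d s.1 := by
    intro s hs g d hg
    have h1 := hi.hasDerivAt_symm hP (hβt s hs).1
    refine (hg.comp s.1 h1).congr_deriv ?_
    have := hP.deriv_ne (hi.sub (tt.map_target (hβt s hs).1))
    field_simp
  have hcurve := fun s (hs : s ∈ β.target) => hasDerivAt_arbCurve hP (hI (hmap hs))
    (hL.d0 _ (hmap hs)) (hL.d1 _ (hmap hs)) (hL.d2 _ (hmap hs)) (hB _ (hmap hs)).2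
  let θ' : ArbTuple :=
    { dom := β.target
      isOpen_dom := β.open_target
      val := val'
      smooth := contDiffOn_snd.comp (t := univ) (hP.contDiffOn_toMap.comp
        ((hβsm.prodMk contDiffOn_const).prodMk hθs) fun s hs => hdom _ (hβt s hs).2 0)
        fun _ _ => mem_univ _
      a2_ne := fun s hs => by
        have h := hdom _ (hβt s hs).2 0
        exact mul_ne_zero (mul_ne_zero (hP.deriv_ne h.2.1) (pow_ne_zero 2 h.2.2)) h.1
      a10_x := fun s hs => dx_eq_zero_of_eqOn
        (f := fun t => (P.arbCurve a10 a11 y0 y1 y2 (tt.symm t)).a10) β.open_target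
        (fun r hr => (hval r hr).1) hs
      a11_x := fun s hs => dx_eq_zero_of_eqOn
        (f := fun t => (P.arbCurve a10 a11 y0 y1 y2 (tt.symm t)).a11) β.open_target
        (fun r hr => (hval r hr).2.1) hs
      y0_x := fun s hs => dx_eq_zero_of_eqOn
        (f := fun t => (P.arbCurve a10 a11 y0 y1 y2 (tt.symm t)).y0) β.open_target
        (fun r hr => (hval r hr).2.2.1) hs
      y1_x := fun s hs => dx_eq_zero_of_eqOn
        (f := fun t => (P.arbCurve a10 a11 y0 y1 y2 (tt.symm t)).y1) β.open_target
        (fun r hr => (hval r hr).2.2.2.1) hs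
      y2_x := fun s hs => dx_eq_zero_of_eqOn
        (f := fun t => (P.arbCurve a10 a11 y0 y1 y2 (tt.symm t)).y2) β.open_target
        (fun r hr => (hval r hr).2.2.2.2) hs
      y0_t := fun s hs => dt_eq_of_eqOn
        (f := fun t => (P.arbCurve a10 a11 y0 y1 y2 (tt.symm t)).y0) β.open_target
        (fun r hr => (hval r hr).2.2.1) hs
        (by rw [(hval s hs).2.1]; exact hder s hs (hcurve s hs).1)
      y1_t := fun s hs => dt_eq_of_eqOn
        (f := fun t => (P.arbCurve a10 a11 y0 y1 y2 (tt.symm t)).y1) β.open_target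
        (fun r hr => (hval r hr).2.2.2.1) hs
        (by rw [(hval s hs).2.2.1]; exact hder s hs (hcurve s hs).2.1)
      y2_t := fun s hs => dt_eq_of_eqOn
        (f := fun t => (P.arbCurve a10 a11 y0 y1 y2 (tt.symm t)).y2) β.open_target
        (fun r hr => (hval r hr).2.2.2.2) hs
        (by rw [(hval s hs).2.2.1, (hval s hs).1]; exact hder s hs (hcurve s hs).2.2) }
  have hβball : β.source = Metric.ball q ε := Set.ext hβs
  have hc1 := contDiffOn_comp_time hL.s1
  have hc0 := contDiffOn_comp_time hL.s0
  have hc2 := contDiffOn_comp_time hL.s2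
  let φ := fiberAffine β (fun r => P.c1 * y1 r.1 + P.c0)
    (fun r => -P.c1 * Real.exp (y0 r.1) * r.2 + P.c2 - P.c1 * y2 r.1)
    (by rw [hβball]; exact ((contDiffOn_const.mul hc1).add contDiffOn_const).continuousOn)
    (by
      rw [hβball]
      exact ((((contDiffOn_const.mul hc0.exp).mul contDiff_snd.contDiffOn).add
        contDiffOn_const).sub (contDiffOn_const.mul hc2)).continuousOn)
    (fun r hr => (hB _ (mem_ball_base.1 ((hβs r).1 hr)).1).2)
  refine ⟨φ, θ', ⟨fun r hr => hL.sub ((hβs r.1).1 hr), fun s hs => hs⟩,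
    (hβs q).2 (Metric.mem_ball_self hε), fun r hr => ?_⟩
  have hrb : r.1 ∈ Metric.ball q ε := (hβs r.1).1 hr
  refine ⟨hdom _ hrb r.2, ?_⟩
  have h0 := hL.e0 _ hrb
  have h1 := hL.e1 _ hrb
  have h2 := hL.e2 _ hrb
  have hφ1 : (φ r).1 = β r.1 := rfl
  refine Prod.ext (Prod.ext ?_ ?_) ?_
  · rw [hφ1, hβ]
    refine Prod.ext rfl ?_
    change deriv P.T r.1.1 * (P.c1 * (θ.val r.1).y1 + P.c0) *
      (r.1.2 + Real.exp (-(θ.val r.1).y0 / 2) * P.X r.1.1) = _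
    rw [h0, h1]
    simp only [k, m]
    ring
  · change (P.c1 * (θ.val r.1).y1 + P.c0) * r.2 - P.c1 * Real.exp (θ.val r.1).y0 * r.1.2 + P.c2
      - P.c1 * (θ.val r.1).y2 = (P.c1 * y1 r.1.1 + P.c0) * r.2 +
        (-P.c1 * Real.exp (y0 r.1.1) * r.1.2 + P.c2 - P.c1 * y2 r.1.1)
    rw [h0, h1, h2]
    ring
  · change _ = (P.toMap ((β.symm (β r.1), 0), θ.val (β.symm (β r.1)))).2
    rw [β.left_inv hr]
    rfl

end Params

/-- `exists_induced` supplies `φ` and `θ'`. Their admissibility is checked at every point of the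
source of `φ`, where the lift may leave the source of `e`; there another local transformation with
the same parameters takes its place. -/
theorem breveGroup_subset_generalizedEquivalences : breveGroup ⊆ generalizedEquivalences := by
  intro e he
  refine ⟨isPseudogroupOn_breveGroup.source_subset e he,
    isPseudogroupOn_breveGroup.target_subset e he, contDiffOn_of_mem_breveGroup he,
    contDiffOn_of_mem_breveGroup (symm_mem_breveGroup he), fun θ p hp hs => ?_⟩
  obtain ⟨P, I, hP, hd, heP⟩ := mem_breveGroup_iff.1 he _ hs
  obtain ⟨φ, θ', hc, hpφ, hφ⟩ := hP.exists_induced hp hd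
  refine ⟨φ, θ', generated_breveGroup_subset ⟨hc, fun r hr => ?_⟩, hpφ, hs, ?_⟩
  · obtain ⟨e', he', hs', he'P⟩ := hP.exists_mem_breveGroup (hφ r hr).1
    refine ⟨e', he', hs', ?_⟩
    filter_upwards [φ.open_source.mem_nhds hr] with s hs
    rw [he'P, (hφ s hs).2]
  · filter_upwards [φ.open_source.mem_nhds hpφ,
      (contDiffAt_lift hp).continuousAt.eventually heP] with r h1 h2
    rw [h2, (hφ r h1).2]

/-! ### Recovering the parameters of an admissible transformation -/

namespace Params

section
variable {c ε : ℝ} {T w k b a10 a11 y0 y1 y2 b10 b11 z0 z1 z2 : ℝ → ℝ}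

/-- The constants are the first integrals `w_t exp (-Y⁰)`, `w - c₁Y¹` and `b + c₁Y²` of the system
for `w` and `b`. -/
theorem exists_constants (hε : 0 < ε) (hw : ContDiffOn ℝ ∞ w (Metric.ball c ε))
    (hb : ContDiffOn ℝ ∞ b (Metric.ball c ε))
    (h0 : ∀ t ∈ Metric.ball c ε, HasDerivAt y0 (a11 t) t)
    (h1 : ∀ t ∈ Metric.ball c ε, HasDerivAt y1 (Real.exp (y0 t)) t)
    (h2 : ∀ t ∈ Metric.ball c ε, HasDerivAt y2 (a10 t * Real.exp (y0 t)) t)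
    (hw2 : ∀ t ∈ Metric.ball c ε, deriv (deriv w) t = a11 t * deriv w t)
    (hb1 : ∀ t ∈ Metric.ball c ε, deriv b t = -(a10 t * deriv w t)) :
    ∃ c0 c1 c2 : ℝ, ∀ t ∈ Metric.ball c ε, c1 * y1 t + c0 = w t ∧
      c1 * Real.exp (y0 t) = deriv w t ∧ c2 - c1 * y2 t = b t := by
  have ho := Metric.isOpen_ball (x := c) (ε := ε)
  have hc := Metric.mem_ball_self (x := c) hε
  have hw' : ContDiffOn ℝ ∞ (deriv w) (Metric.ball c ε) := hw.deriv_of_isOpen ho (by simp)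
  have k1 : ∀ t ∈ Metric.ball c ε,
      HasDerivAt (fun s => deriv w s * Real.exp (-y0 s)) 0 t := fun t ht =>
    ((hasDerivAt_deriv_of_contDiffOn ho hw' ht).mul (h0 t ht).neg.exp).congr_deriv (by
      rw [hw2 t ht]; simp only [Pi.neg_apply]; ring)
  have e1 : ∀ t ∈ Metric.ball c ε,
      deriv w c * Real.exp (-y0 c) * Real.exp (y0 t) = deriv w t := by
    intro t ht
    rw [eq_of_hasDerivAt_zero k1 hc ht, mul_assoc, ← Real.exp_add, neg_add_cancel, Real.exp_zero,
      mul_one]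
  set c1 := deriv w c * Real.exp (-y0 c)
  have k0 : ∀ t ∈ Metric.ball c ε, HasDerivAt (fun s => w s - c1 * y1 s) 0 t := fun t ht =>
    ((hasDerivAt_deriv_of_contDiffOn ho hw ht).sub ((h1 t ht).const_mul c1)).congr_deriv (by
      rw [← e1 t ht]; ring)
  have k2 : ∀ t ∈ Metric.ball c ε, HasDerivAt (fun s => b s + c1 * y2 s) 0 t := fun t ht =>
    ((hasDerivAt_deriv_of_contDiffOn ho hb ht).add ((h2 t ht).const_mul c1)).congr_deriv (by
      rw [hb1 t ht, ← e1 t ht]; ring)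
  refine ⟨w c - c1 * y1 c, c1, b c + c1 * y2 c, fun t ht => ⟨?_, e1 t ht, ?_⟩⟩
  · linear_combination eq_of_hasDerivAt_zero k0 hc ht
  · linear_combination eq_of_hasDerivAt_zero k2 hc ht

/-- The relation between `A¹¹` and its image says that `Ỹ⁰ - Y⁰ + log (T_t w²)` is constant. -/
theorem exists_delta (hε : 0 < ε) {s : ℝ} (hs : s = 1 ∨ s = -1)
    (hsT : ∀ t ∈ Metric.ball c ε, 0 < s * deriv T t) (hw0 : ∀ t ∈ Metric.ball c ε, w t ≠ 0)
    (hT : ContDiffOn ℝ ∞ T (Metric.ball c ε)) (hw : ContDiffOn ℝ ∞ w (Metric.ball c ε))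
    (h0 : ∀ t ∈ Metric.ball c ε, HasDerivAt y0 (a11 t) t)
    (g0 : ∀ t ∈ Metric.ball c ε, HasDerivAt z0 (b11 (T t)) (T t))
    (heq : ∀ t ∈ Metric.ball c ε,
      deriv T t * w t * a11 t - (deriv (deriv T) t * w t + deriv T t * deriv w t)
          - deriv T t * deriv w t - deriv T t ^ 2 * b11 (T t) * w t = 0) :
    ∃ δ : ℝ, ∀ t ∈ Metric.ball c ε, 0 < δ * deriv T t ∧
      y0 t + Real.log (δ / (deriv T t * w t ^ 2)) = z0 (T t) := by
  have ho := Metric.isOpen_ball (x := c) (ε := ε)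
  have hc := Metric.mem_ball_self (x := c) hε
  have hT' : ContDiffOn ℝ ∞ (deriv T) (Metric.ball c ε) := hT.deriv_of_isOpen ho (by simp)
  have hT0 : ∀ t ∈ Metric.ball c ε, deriv T t ≠ 0 := fun t ht =>
    right_ne_zero_of_mul (hsT t ht).ne'
  have hn : ∀ t ∈ Metric.ball c ε, deriv T t * w t ^ 2 ≠ 0 := fun t ht =>
    mul_ne_zero (hT0 t ht) (pow_ne_zero 2 (hw0 t ht))
  have k : ∀ t ∈ Metric.ball c ε,
      HasDerivAt (fun s => z0 (T s) - y0 s + Real.log (deriv T s * w s ^ 2)) 0 t := by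
    intro t ht
    refine ((((g0 t ht).comp t (hasDerivAt_deriv_of_contDiffOn ho hT ht)).sub (h0 t ht)).add
      (((hasDerivAt_deriv_of_contDiffOn ho hT' ht).mul
        ((hasDerivAt_deriv_of_contDiffOn ho hw ht).pow 2)).log (hn t ht))).congr_deriv ?_
    have h1 := hT0 t ht
    have h2 := hw0 t ht
    have h3 := heq t ht
    simp only [Pi.pow_apply, Pi.mul_apply]
    push_cast
    field_simp
    linear_combination -h3
  have e := fun t ht => eq_of_hasDerivAt_zero k (a := t) ht hc
  set γ := z0 (T c) - y0 c + Real.log (deriv T c * w c ^ 2)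
  -- `Real.log` sees only absolute values, so the factor `s` is needed to give `δ` the sign of
  -- `T_t`.
  refine ⟨s * Real.exp γ, fun t ht => ⟨?_, ?_⟩⟩
  · have := mul_pos (hsT t ht) (Real.exp_pos γ)
    linarith
  · have hpos : 0 < s * (deriv T t * w t ^ 2) := by
      have := mul_pos (hsT t ht) (pow_pos (abs_pos.2 (hw0 t ht)) 2)
      rw [sq_abs] at this
      linarith
    have h1 : s * Real.exp γ / (deriv T t * w t ^ 2)
        = Real.exp γ / (s * (deriv T t * w t ^ 2)) := by
      have h2 := hn t ht
      rcases hs with rfl | rfl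
      · simp
      · rw [neg_one_mul, neg_one_mul, div_neg, neg_div]
    have h2 : Real.log (s * (deriv T t * w t ^ 2)) = Real.log (deriv T t * w t ^ 2) := by
      rcases hs with rfl | rfl
      · rw [one_mul]
      · rw [neg_one_mul, Real.log_neg_eq_log]
    rw [h1, Real.log_div (Real.exp_pos γ).ne' hpos.ne', Real.log_exp, h2]
    linear_combination -(e t ht)

theorem arbCurve_y1 (P : Params) (t : ℝ) : (P.arbCurve a10 a11 y0 y1 y2 t).y1 =
    (P.d1 * y1 t + P.d0) / (P.c1 * y1 t + P.c0) := rfl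

/-- The functions `w`, `b`, `k` and the target `Y⁰` fix `c₀`, `c₁`, `c₂`, `X` and `δ`. The target
`A¹⁰` and `A¹¹` are then forced, and the integration constants of the target `Y¹` and `Y²` determine
the rest of the parameters. -/
theorem exists_params (hε : 0 < ε) {s : ℝ} (hs : s = 1 ∨ s = -1)
    (hsT : ∀ t ∈ Metric.ball c ε, 0 < s * deriv T t) (hw0 : ∀ t ∈ Metric.ball c ε, w t ≠ 0)
    (hT : ContDiffOn ℝ ∞ T (Metric.ball c ε)) (hw : ContDiffOn ℝ ∞ w (Metric.ball c ε))
    (hk : ContDiffOn ℝ ∞ k (Metric.ball c ε)) (hb : ContDiffOn ℝ ∞ b (Metric.ball c ε))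
    (hy0 : ContDiffOn ℝ ∞ y0 (Metric.ball c ε))
    (h0 : ∀ t ∈ Metric.ball c ε, HasDerivAt y0 (a11 t) t)
    (h1 : ∀ t ∈ Metric.ball c ε, HasDerivAt y1 (Real.exp (y0 t)) t)
    (h2 : ∀ t ∈ Metric.ball c ε, HasDerivAt y2 (a10 t * Real.exp (y0 t)) t)
    (g0 : ∀ t ∈ Metric.ball c ε, HasDerivAt z0 (b11 (T t)) (T t))
    (g1 : ∀ t ∈ Metric.ball c ε, HasDerivAt z1 (Real.exp (z0 (T t))) (T t))
    (g2 : ∀ t ∈ Metric.ball c ε, HasDerivAt z2 (b10 (T t) * Real.exp (z0 (T t))) (T t))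
    (hw2 : ∀ t ∈ Metric.ball c ε, deriv (deriv w) t = a11 t * deriv w t)
    (hb1 : ∀ t ∈ Metric.ball c ε, deriv b t = -(a10 t * deriv w t))
    (heq : ∀ t ∈ Metric.ball c ε,
      deriv T t * w t * a11 t - (deriv (deriv T) t * w t + deriv T t * deriv w t)
          - deriv T t * deriv w t - deriv T t ^ 2 * b11 (T t) * w t = 0)
    (heq' : ∀ t ∈ Metric.ball c ε,
      deriv T t * w t * a10 t - deriv k t + deriv T t * b t
          - deriv T t * (b11 (T t) * k t + b10 (T t)) = 0) :
    ∃ P : Params, P.Admissible (Metric.ball c ε) ∧ P.T = T ∧ ∀ t ∈ Metric.ball c ε,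
      P.c1 * y1 t + P.c0 = w t ∧ P.c1 * Real.exp (y0 t) = deriv w t ∧ P.c2 - P.c1 * y2 t = b t ∧
      deriv T t * w t * (Real.exp (-y0 t / 2) * P.X t) = k t ∧
      (P.arbCurve a10 a11 y0 y1 y2 t).a10 = b10 (T t) ∧
      (P.arbCurve a10 a11 y0 y1 y2 t).a11 = b11 (T t) ∧
      (P.arbCurve a10 a11 y0 y1 y2 t).y0 = z0 (T t) ∧
      (P.arbCurve a10 a11 y0 y1 y2 t).y1 = z1 (T t) ∧
      (P.arbCurve a10 a11 y0 y1 y2 t).y2 = z2 (T t) := by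
  have ho := Metric.isOpen_ball (x := c) (ε := ε)
  have hc := Metric.mem_ball_self (x := c) hε
  have hT0 : ∀ t ∈ Metric.ball c ε, deriv T t ≠ 0 := fun t ht =>
    right_ne_zero_of_mul (hsT t ht).ne'
  have hT' : ContDiffOn ℝ ∞ (deriv T) (Metric.ball c ε) := hT.deriv_of_isOpen ho (by simp)
  obtain ⟨c0, c1, c2, hcs⟩ := exists_constants hε hw hb h0 h1 h2 hw2 hb1
  obtain ⟨δ, hδ⟩ := exists_delta hε hs hsT hw0 hT hw h0 g0 heq
  set X : ℝ → ℝ := fun t => k t * Real.exp (y0 t / 2) / (deriv T t * w t) with hXdef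
  have hX : ContDiffOn ℝ ∞ X (Metric.ball c ε) :=
    (hk.mul (hy0.div_const 2).exp).div (hT'.mul hw) fun t ht =>
      mul_ne_zero (hT0 t ht) (hw0 t ht)
  have hXk : ∀ t ∈ Metric.ball c ε, deriv T t * w t * (Real.exp (-y0 t / 2) * X t) = k t := by
    intro t ht
    have h1 := hT0 t ht
    have h2 := hw0 t ht
    have h3 : Real.exp (-y0 t / 2) * Real.exp (y0 t / 2) = 1 := by
      rw [← Real.exp_add, neg_div, neg_add_cancel, Real.exp_zero]
    simp only [hXdef]
    generalize Real.exp (-y0 t / 2) = E at *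
    field_simp
    linear_combination k t * h3
  have hcc : c0 ^ 2 + c1 ^ 2 ≠ 0 := by
    intro h
    have h3 : c0 = 0 := by nlinarith [sq_nonneg c0, sq_nonneg c1]
    have h4 : c1 = 0 := by nlinarith [sq_nonneg c0, sq_nonneg c1]
    apply hw0 c hc
    rw [← (hcs c hc).1, h3, h4]
    ring
  -- The general solution of `d1 c0 - d0 c1 = δ` is a particular one plus `κ (c0, c1)`. Changing `κ`
  -- shifts the transformed `Y¹` by the same constant, and `c3` shifts the transformed `Y²`.
  let P : ℝ → ℝ → Params := fun κ c3 => ⟨T, X, c0, c1, c2, c3,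
    -δ * c1 / (c0 ^ 2 + c1 ^ 2) + κ * c0, δ * c0 / (c0 ^ 2 + c1 ^ 2) + κ * c1⟩
  have hPδ : ∀ κ c3, (P κ c3).delta = δ := by
    intro κ c3
    simp only [delta, P]
    field_simp
    ring
  have hP : ∀ κ c3, (P κ c3).Admissible (Metric.ball c ε) := fun κ c3 =>
    ⟨ho, hT, hX, fun t ht => by rw [hPδ]; exact (hδ t ht).1⟩
  have hW : ∀ κ c3, ∀ t ∈ Metric.ball c ε, (P κ c3).c1 * y1 t + (P κ c3).c0 ≠ 0 :=
    fun κ c3 t ht => by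
      rw [show (P κ c3).c1 * y1 t + (P κ c3).c0 = w t from (hcs t ht).1]; exact hw0 t ht
  have hD := fun κ c3 t ht => hasDerivAt_arbCurve (hP κ c3) ht (h0 t ht) (h1 t ht) (h2 t ht)
    (hW κ c3 t ht)
  have r0 : ∀ κ c3, ∀ t ∈ Metric.ball c ε,
      ((P κ c3).arbCurve a10 a11 y0 y1 y2 t).y0 = z0 (T t) := by
    intro κ c3 t ht
    rw [← (hδ t ht).2, ← (hcs t ht).1, ← hPδ κ c3]
    rfl
  have r11 : ∀ κ c3, ∀ t ∈ Metric.ball c ε,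
      ((P κ c3).arbCurve a10 a11 y0 y1 y2 t).a11 = b11 (T t) := by
    intro κ c3 t ht
    change 1 / deriv T t * (a11 t - deriv (deriv T) t / deriv T t
      - 2 * c1 * Real.exp (y0 t) / (c1 * y1 t + c0)) = _
    rw [mul_assoc 2, (hcs t ht).2.1, (hcs t ht).1]
    have h3 := hT0 t ht
    have h4 := hw0 t ht
    field_simp
    linear_combination heq t ht
  have r10 : ∀ κ c3, ∀ t ∈ Metric.ball c ε,
      ((P κ c3).arbCurve a10 a11 y0 y1 y2 t).a10 = b10 (T t) := by
    intro κ c3 t ht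
    -- Substituting `k = T_t w exp (-Y⁰/2) X` into `heq'` brings in `X_t`; the surplus terms are a
    -- multiple of `heq`.
    have hd := ((((hasDerivAt_deriv_of_contDiffOn ho hT' ht).mul
      (hasDerivAt_deriv_of_contDiffOn ho hw ht)).mul ((((h0 t ht).neg.div_const 2).exp).mul
      (hasDerivAt_deriv_of_contDiffOn ho hX ht))).congr_of_eventuallyEq
      (f₁ := k) (by
        filter_upwards [ho.mem_nhds ht] with s hs
        exact (hXk s hs).symm)).deriv
    simp only [Pi.mul_apply, Pi.neg_apply] at hd
    have e1 : Real.exp (y0 t / 2) = Real.exp (y0 t) * Real.exp (-y0 t / 2) := by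
      rw [← Real.exp_add]; congr 1; ring
    change (c1 * y1 t + c0) * (a10 t - 1 / 2 * Real.exp (-y0 t / 2) * X t * a11 t
      - Real.exp (-y0 t / 2) * deriv X t) + c1 * Real.exp (y0 t / 2) * X t + c2 - c1 * y2 t = _
    rw [e1, ← mul_assoc c1, (hcs t ht).2.1, (hcs t ht).1, add_sub_assoc, (hcs t ht).2.2]
    have h3 := hT0 t ht
    have h4 := hw0 t ht
    have h5 := heq' t ht
    rw [hd, ← hXk t ht] at h5
    have h6 := heq t ht
    generalize Real.exp (-y0 t / 2) = E at *
    apply mul_left_cancel₀ h3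
    linear_combination h5 - E * X t * h6
  have k1 : ∀ t ∈ Metric.ball c ε,
      HasDerivAt (fun s => z1 (T s) - ((P 0 0).arbCurve a10 a11 y0 y1 y2 s).y1) 0 t := by
    intro t ht
    refine (((g1 t ht).comp t (hasDerivAt_deriv_of_contDiffOn ho hT ht)).sub
      (hD 0 0 t ht).2.1).congr_deriv ?_
    rw [r0 0 0 t ht]
    change _ - deriv T t * _ = 0
    ring
  have e1 := fun t ht => eq_of_hasDerivAt_zero k1 (a := t) ht hc
  -- The discrepancy in `Y¹` is constant and defines `κ`. It must be fixed before `c3`, because `κ`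
  -- enters the transformed `Y²` through its `c₂`-term.
  set κ := z1 (T c) - ((P 0 0).arbCurve a10 a11 y0 y1 y2 c).y1
  have k2 : ∀ t ∈ Metric.ball c ε,
      HasDerivAt (fun s => z2 (T s) - ((P κ 0).arbCurve a10 a11 y0 y1 y2 s).y2) 0 t := by
    intro t ht
    refine (((g2 t ht).comp t (hasDerivAt_deriv_of_contDiffOn ho hT ht)).sub
      (hD κ 0 t ht).2.2).congr_deriv ?_
    rw [r0 κ 0 t ht, r10 κ 0 t ht]
    change _ - deriv T t * _ = 0
    ring
  have e2 := fun t ht => eq_of_hasDerivAt_zero k2 (a := t) ht hc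
  set c3 := z2 (T c) - ((P κ 0).arbCurve a10 a11 y0 y1 y2 c).y2
  refine ⟨P κ c3, hP κ c3, rfl, fun t ht => ⟨(hcs t ht).1, (hcs t ht).2.1, (hcs t ht).2.2,
    hXk t ht, r10 κ c3 t ht, r11 κ c3 t ht, r0 κ c3 t ht, ?_, ?_⟩⟩
  · have h3 := e1 t ht
    have h4 := hW 0 0 t ht
    rw [arbCurve_y1] at h3 ⊢
    rw [sub_eq_iff_eq_add.1 h3]
    simp only [P] at h4 ⊢
    field_simp
    ring
  · have h3 := e2 t ht
    rw [sub_eq_iff_eq_add.1 h3, add_comm]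
    change _ = ((P κ 0).delta * y2 t / (c1 * y1 t + c0) - (P κ 0).delta * X t *
      Real.exp (y0 t / 2) / (c1 * y1 t + c0) + c2 * (((P κ 0).d1 * y1 t + (P κ 0).d0) /
      (c1 * y1 t + c0)) + 0) + c3
    change ((P κ c3).delta * y2 t / (c1 * y1 t + c0) - (P κ c3).delta * X t *
      Real.exp (y0 t / 2) / (c1 * y1 t + c0) + c2 * (((P κ c3).d1 * y1 t + (P κ c3).d0) /
      (c1 * y1 t + c0)) + c3) = _
    rw [hPδ, hPδ]
    simp only [P]
    ring

end

end Params

/-- The normal form provides `T`, `w`, `k`, `b`, and `exists_params` turns them into parameters of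
the family. The radius is reduced so that `T_t` has constant sign, as required for a single `δ`. -/
theorem equivalenceGroupoid_subset_generated : equivalenceGroupoid ⊆ generated breveGroup := by
  rintro ⟨θ, φ, θ'⟩ h
  refine ⟨h.1, fun p hp => ?_⟩
  change p ∈ φ.source at hp
  obtain ⟨ε₀, hε₀, a10, a11, y0, y1, y2, hL⟩ := exists_localForm θ (h.1.1 p hp)
  obtain ⟨ε₁, hε₁, b10, b11, z0, z1, z2, hL'⟩ := exists_localForm θ' (h.1.2 _ (φ.map_source hp))
  obtain ⟨ε₂, hε₂, hle₂, hsub, T, w, k, b, hT, hw, hk, hb, hφ, hd⟩ :=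
    exists_normal_form h hp hε₀ hε₁ hL hL'
  have ho := Metric.isOpen_ball (x := p.1.1) (ε := ε₂)
  have hc := Metric.mem_ball_self (x := p.1.1) hε₂
  obtain ⟨s, hs, hsT⟩ := exists_sign (hd _ hc).1
  have hev : ∀ᶠ t in 𝓝 p.1.1, 0 < s * deriv T t :=
    (continuousAt_const.mul (((hT.deriv_of_isOpen (m := ∞) ho (by simp)).continuousOn).continuousAt
      (ho.mem_nhds hc))).eventually_const_lt hsT
  obtain ⟨ε₃, hε₃, hball⟩ := Metric.eventually_nhds_iff_ball.1 hev
  obtain ⟨ε, hε, hle, hle₃⟩ : ∃ ε > 0, ε ≤ ε₂ ∧ ε ≤ ε₃ :=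
    ⟨min ε₂ ε₃, lt_min hε₂ hε₃, min_le_left _ _, min_le_right _ _⟩
  have hLε := hL.mono (hle.trans hle₂)
  have hs1 := Metric.ball_subset_ball (x := p.1.1) hle
  obtain ⟨P, hP, hPT, hPs⟩ := Params.exists_params hε hs
    (fun t ht => hball t (Metric.ball_subset_ball hle₃ ht)) (fun t ht => (hd t (hs1 ht)).2.1)
    (hT.mono hs1) (hw.mono hs1) (hk.mono hs1) (hb.mono hs1) hLε.s0 hLε.d0 hLε.d1 hLε.d2
    (fun t ht => hL'.d0 _ (hd t (hs1 ht)).2.2.1) (fun t ht => hL'.d1 _ (hd t (hs1 ht)).2.2.1)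
    (fun t ht => hL'.d2 _ (hd t (hs1 ht)).2.2.1) (fun t ht => (hd t (hs1 ht)).2.2.2.1)
    (fun t ht => (hd t (hs1 ht)).2.2.2.2.1) (fun t ht => (hd t (hs1 ht)).2.2.2.2.2.1)
    (fun t ht => (hd t (hs1 ht)).2.2.2.2.2.2)
  have hdom : (p, θ.val p.1) ∈ P.domain (Metric.ball p.1.1 ε) := by
    have hpt := Metric.mem_ball_self (x := p.1.1) hε
    refine ⟨θ.a2_ne _ (h.1.1 p hp), hpt, ?_⟩
    change P.c1 * (θ.val p.1).y1 + P.c0 ≠ 0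
    rw [hL.e1 _ (Metric.mem_ball_self hε₀), (hPs _ hpt).1]
    exact (hd _ hc).2.1
  obtain ⟨e, he, hes, heP⟩ := hP.exists_mem_breveGroup hdom
  refine ⟨e, he, hes, ?_⟩
  filter_upwards [Metric.ball_mem_nhds p hε] with r hr
  rw [heP]
  obtain ⟨m1, m2, m3⟩ := hφ r (Metric.ball_subset_ball hle hr)
  have hrb := (mem_ball_pt_iff_base.1 hr).1
  have ht : r.1.1 ∈ Metric.ball p.1.1 ε := (mem_ball_pt.1 hr).1.1
  obtain ⟨p1, p2, p3, p4, p5, p6, p7, p8, p9⟩ := hPs _ ht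
  have hT0 := (hd _ (hs1 ht)).1
  have q10 := hLε.e10 _ hrb
  have q11 := hLε.e11 _ hrb
  have q0 := hLε.e0 _ hrb
  have q1 := hLε.e1 _ hrb
  have q2 := hLε.e2 _ hrb
  have o10 := hL'.e10 _ m1
  have o11 := hL'.e11 _ m1
  have o0 := hL'.e0 _ m1
  have o1 := hL'.e1 _ m1
  have o2 := hL'.e2 _ m1
  have hT1 : (φ r).1.1 = T r.1.1 := by rw [m2]
  rw [hT1] at o10 o11 o0 o1 o2
  refine Prod.ext ?_ (Prod.ext ?_ (Prod.ext ?_ (Prod.ext ?_ (Prod.ext ?_ (Prod.ext ?_ ?_)))))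
  · rw [m2]
    refine Prod.ext (Prod.ext ?_ ?_) ?_
    · change P.T r.1.1 = _
      rw [hPT]
    · change deriv P.T r.1.1 * (P.c1 * (θ.val r.1).y1 + P.c0) *
        (r.1.2 + Real.exp (-(θ.val r.1).y0 / 2) * P.X r.1.1) = _
      rw [q0, q1, p1, hPT, mul_add, p4]
    · change (P.c1 * (θ.val r.1).y1 + P.c0) * r.2 - P.c1 * Real.exp (θ.val r.1).y0 * r.1.2 + P.c2
        - P.c1 * (θ.val r.1).y2 = _
      rw [q0, q1, q2, p1, p2, add_sub_assoc, p3]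
      ring
  · refine Eq.trans ?_ (p5.trans o10.symm)
    simp only [Params.arbCurve, Params.toMap, Arb.a10, Arb.a11, Arb.y0, Arb.y1, Arb.y2]
      at q10 q11 q0 q1 q2 ⊢
    rw [q10, q11, q0, q1, q2]
  · refine Eq.trans ?_ (p6.trans o11.symm)
    simp only [Params.arbCurve, Params.toMap, Arb.a10, Arb.a11, Arb.y0, Arb.y1, Arb.y2]
      at q10 q11 q0 q1 q2 ⊢
    rw [q11, q0, q1]
  · change deriv P.T r.1.1 * (P.c1 * (θ.val r.1).y1 + P.c0) ^ 2 * (θ.val r.1).a2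
      = (θ'.val (φ r).1).a2
    rw [q1, p1, hPT]
    apply mul_left_cancel₀ hT0
    linear_combination m3
  · refine Eq.trans ?_ (p7.trans o0.symm)
    simp only [Params.arbCurve, Params.toMap, Arb.a10, Arb.a11, Arb.y0, Arb.y1, Arb.y2]
      at q10 q11 q0 q1 q2 ⊢
    rw [q0, q1]
  · refine Eq.trans ?_ (p8.trans o1.symm)
    simp only [Params.arbCurve, Params.toMap, Arb.a10, Arb.a11, Arb.y0, Arb.y1, Arb.y2]
      at q10 q11 q0 q1 q2 ⊢
    rw [q1]
  · refine Eq.trans ?_ (p9.trans o2.symm)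
    simp only [Params.arbCurve, Params.toMap, Arb.a10, Arb.a11, Arb.y0, Arb.y1, Arb.y2]
      at q10 q11 q0 q1 q2 ⊢
    rw [q0, q1, q2]

/-! ### Minimality -/

/-- Locality, restriction and invariance under equality on sources together make membership in a
pseudogroup a condition on germs. -/
theorem IsPseudogroupOn.mem_of_eventuallyEq {Z : Type*} [TopologicalSpace Z] {M : Set Z}
    {𝒢 : Set (OpenPartialHomeomorph Z Z)} (h : IsPseudogroupOn M 𝒢)
    {e : OpenPartialHomeomorph Z Z}
    (he : ∀ z ∈ e.source, ∃ e' ∈ 𝒢, z ∈ e'.source ∧ e =ᶠ[𝓝 z] e') : e ∈ 𝒢 := by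
  refine h.locality e fun z hz => ?_
  obtain ⟨e', he', hz', heq⟩ := he z hz
  obtain ⟨s, hs, hso, hzs⟩ := mem_nhds_iff.1 (Filter.inter_mem (Filter.inter_mem
    (e.open_source.mem_nhds hz) (e'.open_source.mem_nhds hz')) heq)
  refine ⟨s, hso, hzs, h.eqOnSource_mem _ (h.restr_mem e' he' s hso) _ ⟨?_, ?_⟩⟩
  · rw [e.restr_source' s hso, e'.restr_source' s hso,
      inter_eq_right.2 fun w hw => (hs hw).1.1, inter_eq_right.2 fun w hw => (hs hw).1.2]
  · intro w hw
    rw [e.restr_source' s hso] at hw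
    exact (hs hw.2).2

/-- A value of the arbitrary elements through a given point. -/
theorem exists_arbTuple (q : Base) {a : Arb} (ha : a.a2 ≠ 0) :
    ∃ (θ : ArbTuple) (A : ℝ → Arb), q ∈ θ.dom ∧ A q.1 = a ∧ ContinuousAt A q.1 ∧
      ∀ r, θ.val r = A r.1 := by
  -- Here `A¹¹` is chosen so that `exp Y⁰` is affine in `t`, and `A¹⁰` so that `A¹⁰ exp Y⁰` is
  -- constant. Then `Y¹` and `Y²` are polynomials, without treating `A¹¹ = 0` separately.
  let A : ℝ → Arb := fun t =>
    (a.a10 / (1 + a.a11 * (t - q.1)), a.a11 / (1 + a.a11 * (t - q.1)), a.a2,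
      a.y0 + Real.log (1 + a.a11 * (t - q.1)),
      a.y1 + Real.exp a.y0 * ((t - q.1) + a.a11 * (t - q.1) ^ 2 / 2),
      a.y2 + a.a10 * Real.exp a.y0 * (t - q.1))
  have hA : ∀ t, 0 < 1 + a.a11 * (t - q.1) → ContDiffAt ℝ ∞ A t := by
    intro t ht
    have h1 : ContDiffAt ℝ ∞ (fun t : ℝ => 1 + a.a11 * (t - q.1)) t := by fun_prop
    exact (contDiffAt_const.div h1 ht.ne').prodMk ((contDiffAt_const.div h1 ht.ne').prodMk
      (contDiffAt_const.prodMk ((contDiffAt_const.add (h1.log ht.ne')).prodMk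
      (ContDiffAt.prodMk (by fun_prop) (by fun_prop)))))
  have hs : ∀ t : ℝ, HasDerivAt (fun t => t - q.1) 1 t := fun t => (hasDerivAt_id t).sub_const q.1
  have hl : ∀ t : ℝ, HasDerivAt (fun t => 1 + a.a11 * (t - q.1)) a.a11 t := fun t =>
    (((hs t).const_mul a.a11).const_add 1).congr_deriv (mul_one _)
  let θ : ArbTuple :=
    { dom := {r | 0 < 1 + a.a11 * (r.1 - q.1)}
      isOpen_dom := isOpen_lt continuous_const (by fun_prop)
      val := fun r => A r.1
      smooth := fun r hr => ((hA r.1 hr).comp r contDiffAt_fst).contDiffWithinAt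
      a2_ne := fun _ _ => ha
      a10_x := fun r _ => dx_eq_zero_of_eqOn (f := fun t => (A t).a10) isOpen_univ
        (fun _ _ => rfl) (mem_univ r)
      a11_x := fun r _ => dx_eq_zero_of_eqOn (f := fun t => (A t).a11) isOpen_univ
        (fun _ _ => rfl) (mem_univ r)
      y0_x := fun r _ => dx_eq_zero_of_eqOn (f := fun t => (A t).y0) isOpen_univ
        (fun _ _ => rfl) (mem_univ r)
      y1_x := fun r _ => dx_eq_zero_of_eqOn (f := fun t => (A t).y1) isOpen_univ
        (fun _ _ => rfl) (mem_univ r)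
      y2_x := fun r _ => dx_eq_zero_of_eqOn (f := fun t => (A t).y2) isOpen_univ
        (fun _ _ => rfl) (mem_univ r)
      y0_t := fun r hr => dt_eq_of_eqOn (f := fun t => (A t).y0) isOpen_univ
        (fun _ _ => rfl) (mem_univ r) (((hl r.1).log (ne_of_gt hr)).const_add a.y0)
      y1_t := fun r hr => dt_eq_of_eqOn (f := fun t => (A t).y1) isOpen_univ
        (fun _ _ => rfl) (mem_univ r) (((((hs r.1).add
          ((((hs r.1).pow 2).const_mul a.a11).div_const 2)).const_mul
          (Real.exp a.y0)).const_add a.y1).congr_deriv (by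
            change _ = Real.exp (a.y0 + Real.log (1 + a.a11 * (r.1 - q.1)))
            rw [Real.exp_add, Real.exp_log hr]
            push_cast
            ring))
      y2_t := fun r hr => dt_eq_of_eqOn (f := fun t => (A t).y2) isOpen_univ
        (fun _ _ => rfl) (mem_univ r) ((((hs r.1).const_mul
          (a.a10 * Real.exp a.y0)).const_add a.y2).congr_deriv (by
            change _ = a.a10 / (1 + a.a11 * (r.1 - q.1)) *
              Real.exp (a.y0 + Real.log (1 + a.a11 * (r.1 - q.1)))
            rw [Real.exp_add, Real.exp_log hr]
            have := ne_of_gt (show 0 < 1 + a.a11 * (r.1 - q.1) from hr)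
            field_simp)) }
  have hq : 0 < 1 + a.a11 * (q.1 - q.1) := by simp
  refine ⟨θ, A, hq, ?_, (hA q.1 hq).continuousAt, fun _ => rfl⟩
  simp [A, Arb.a10, Arb.a11, Arb.a2, Arb.y0, Arb.y1, Arb.y2]

namespace Params

/-- The constant parameters and the values of `X` are determined by the values of the
transformation at three points of a fiber over `t`. -/
theorem eq_of_toMap_eq {P Q : Params} {I J : Set ℝ} (hP : P.Admissible I) (hQ : Q.Admissible J)
    {t x u h : ℝ} {a : Arb} (hh : h ≠ 0) (hT : deriv P.T t = deriv Q.T t)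
    (hzP : (((t, x), u), a) ∈ P.domain I) (hzQ : (((t, x), u), a) ∈ Q.domain J)
    (e : P.toMap (((t, x), u), a) = Q.toMap (((t, x), u), a))
    (eu : P.toMap (((t, x), u + h), a) = Q.toMap (((t, x), u + h), a))
    (ex : P.toMap (((t, x + h), u), a) = Q.toMap (((t, x + h), u), a)) :
    P.X t = Q.X t ∧ P.c0 = Q.c0 ∧ P.c1 = Q.c1 ∧ P.c2 = Q.c2 ∧ P.c3 = Q.c3 ∧ P.d0 = Q.d0 ∧
      P.d1 = Q.d1 := by
  have hT0 : deriv P.T t ≠ 0 := hP.deriv_ne hzP.2.1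
  have hW : P.c1 * a.y1 + P.c0 ≠ 0 := hzP.2.2
  have posP : 0 < P.delta / deriv P.T t := hP.div_pos hzP.2.1
  have posQ : 0 < Q.delta / deriv P.T t := by rw [hT]; exact hQ.div_pos hzQ.2.1
  have f0 := congrArg (fun z : Ext => z.1.2) e
  have f1 := congrArg (fun z : Ext => z.1.2) eu
  have f2 := congrArg (fun z : Ext => z.1.2) ex
  have f3 := congrArg (fun z : Ext => z.1.1.2) e
  have f4 := congrArg (fun z : Ext => z.2.2.2.2.1) e
  have f5 := congrArg (fun z : Ext => z.2.2.2.2.2.1) e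
  have f6 := congrArg (fun z : Ext => z.2.2.2.2.2.2) e
  simp only [toMap] at f0 f1 f2 f3 f4 f5 f6
  have hE := (Real.exp_pos a.y0).ne'
  -- Shifting `u` isolates the coefficient `c₁Y¹ + c₀` of `u`; shifting `x` then isolates `c₁ exp
  -- Y⁰`.
  have w : P.c1 * a.y1 + P.c0 = Q.c1 * a.y1 + Q.c0 := by
    apply mul_right_cancel₀ hh
    linear_combination f1 - f0
  have c1 : P.c1 = Q.c1 := by
    apply mul_right_cancel₀ (mul_ne_zero hE hh)
    linear_combination f0 - f2
  have c0 : P.c0 = Q.c0 := by linear_combination w - a.y1 * c1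
  rw [← c0, ← c1] at f0 f3 f4 f5 f6
  have c2 : P.c2 = Q.c2 := by linear_combination f0
  rw [← hT] at f3 f4
  have hX : P.X t = Q.X t := by
    have h1 := mul_left_cancel₀ (mul_ne_zero hT0 hW) f3
    have h2 := add_left_cancel h1
    exact mul_left_cancel₀ (Real.exp_pos _).ne' h2
  -- The positivity `δ T_t > 0` makes the logarithm injective on the values concerned.
  have hδ : P.delta = Q.delta := by
    have h1 := add_left_cancel f4
    have hsq : 0 < (P.c1 * a.y1 + P.c0) ^ 2 := by positivity
    rw [← div_div, ← div_div] at h1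
    have h2 := Real.log_injOn_pos (mem_Ioi.2 (div_pos posP hsq)) (mem_Ioi.2 (div_pos posQ hsq)) h1
    field_simp at h2
    exact h2
  have hN : P.d1 * a.y1 + P.d0 = Q.d1 * a.y1 + Q.d0 := by
    exact (div_left_inj' hW).1 f5
  have hδ' := hδ
  unfold delta at hδ'
  rw [← c0, ← c1] at hδ'
  have d1 : P.d1 = Q.d1 := by
    apply mul_right_cancel₀ hW
    linear_combination hδ' + P.c1 * hN
  have d0 : P.d0 = Q.d0 := by linear_combination hN - a.y1 * d1
  refine ⟨hX, c0, c1, c2, ?_, d0, d1⟩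
  rw [← hδ, ← hX, ← c2, ← d0, ← d1] at f6
  exact add_left_cancel f6

/-- Along the lift of one tuple, `eq_of_toMap_eq` applies at each nearby time. It gives equality of
all constants and of `T`, `X` on an interval, and these determine the maps at all values of the
arbitrary elements. This is the rigidity behind minimality. -/
theorem eventuallyEq_toMap {P Q : Params} {I J : Set ℝ} (hP : P.Admissible I)
    (hQ : Q.Admissible J) {p : Pt} {A : ℝ → Arb} (hA : ContinuousAt A p.1.1)
    (hzP : (p, A p.1.1) ∈ P.domain I) (hzQ : (p, A p.1.1) ∈ Q.domain J)
    (h : ∀ᶠ r in 𝓝 p, P.toMap (r, A r.1.1) = Q.toMap (r, A r.1.1)) :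
    P.toMap =ᶠ[𝓝 (p, A p.1.1)] Q.toMap := by
  have hc : ContinuousAt (fun r : Pt => ((r, A r.1.1) : Ext)) p :=
    continuousAt_id.prodMk (ContinuousAt.comp (f := fun r : Pt => r.1.1) hA (by fun_prop))
  obtain ⟨ε, hε, hb⟩ := Metric.eventually_nhds_iff_ball.1 (h.and
    ((hc.eventually (hP.isOpen_domain.eventually_mem hzP)).and
      (hc.eventually (hQ.isOpen_domain.eventually_mem hzQ))))
  obtain ⟨⟨t₀, x⟩, u⟩ := p
  have hx := Metric.mem_ball_self (x := x) hε
  have hu := Metric.mem_ball_self (x := u) hε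
  have hx' : x + ε / 2 ∈ Metric.ball x ε := by
    rw [Metric.mem_ball, Real.dist_eq, add_sub_cancel_left, abs_of_pos (by positivity)]; linarith
  have hu' : u + ε / 2 ∈ Metric.ball u ε := by
    rw [Metric.mem_ball, Real.dist_eq, add_sub_cancel_left, abs_of_pos (by positivity)]; linarith
  have ho := Metric.isOpen_ball (x := t₀) (ε := ε)
  have ht₀ := Metric.mem_ball_self (x := t₀) hε
  have hT : ∀ t ∈ Metric.ball t₀ ε, P.T t = Q.T t := fun t ht =>
    congrArg (fun z : Ext => z.1.1.1) (hb ((t, x), u) (mem_ball_pt.2 ⟨⟨ht, hx⟩, hu⟩)).1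
  have key : ∀ t ∈ Metric.ball t₀ ε, _ := fun t ht => eq_of_toMap_eq hP hQ (t := t) (a := A t)
    (by positivity : ε / 2 ≠ 0)
    (EventuallyEq.deriv_eq (by filter_upwards [ho.mem_nhds ht] with s hs using hT s hs))
    (hb ((t, x), u) (mem_ball_pt.2 ⟨⟨ht, hx⟩, hu⟩)).2.1
    (hb ((t, x), u) (mem_ball_pt.2 ⟨⟨ht, hx⟩, hu⟩)).2.2
    (hb ((t, x), u) (mem_ball_pt.2 ⟨⟨ht, hx⟩, hu⟩)).1
    (hb ((t, x), u + ε / 2) (mem_ball_pt.2 ⟨⟨ht, hx⟩, hu'⟩)).1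
    (hb ((t, x + ε / 2), u) (mem_ball_pt.2 ⟨⟨ht, hx'⟩, hu⟩)).1
  obtain ⟨-, c0, c1, c2, c3, d0, d1⟩ := key t₀ ht₀
  have hn : ∀ᶠ z in 𝓝 ((((t₀, x), u), A t₀) : Ext), z.1.1.1 ∈ Metric.ball t₀ ε :=
    continuous_time.continuousAt.preimage_mem_nhds (ho.mem_nhds ht₀)
  filter_upwards [hn] with z hz
  refine toMap_congr ?_ ?_ c0 c1 c2 c3 d0 d1
  · filter_upwards [ho.mem_nhds hz] with s hs using hT s hs
  · filter_upwards [ho.mem_nhds hz] with s hs using (key s hs).1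

end Params

/-! ### The generated groupoid and the minimality argument -/

theorem generated_breveGroup_eq : generated breveGroup = equivalenceGroupoid :=
  generated_breveGroup_subset.antisymm equivalenceGroupoid_subset_generated

theorem generated_mono {𝒢 ℋ : Set (OpenPartialHomeomorph Ext Ext)} (h : 𝒢 ⊆ ℋ) :
    generated 𝒢 ⊆ generated ℋ := fun _ hτ =>
  ⟨hτ.1, fun p hp => let ⟨e, he, hi⟩ := hτ.2 p hp; ⟨e, h he, hi⟩⟩

theorem generated_generalizedEquivalences_eq :
    generated generalizedEquivalences = equivalenceGroupoid :=
  generated_generalizedEquivalences_subset.antisymm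
    (equivalenceGroupoid_subset_generated.trans
      (generated_mono breveGroup_subset_generalizedEquivalences))

/-- At a point of the source of `e`, a tuple through it and a transformation `φ` induced by `e` are
chosen. Some `e'` in `𝒢` induces the same `φ` with the same target tuple, so `e` and `e'` agree
along the lift. As both lie in the family, rigidity makes their germs equal. -/
theorem breveGroup_subset_of_generated_eq {𝒢 : Set (OpenPartialHomeomorph Ext Ext)}
    (hG : IsPseudogroupOn extDomain 𝒢) (hs : 𝒢 ⊆ breveGroup)
    (hgen : generated 𝒢 = equivalenceGroupoid) : breveGroup ⊆ 𝒢 := by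
  intro e he
  refine hG.mem_of_eventuallyEq fun z hz => ?_
  obtain ⟨p, a⟩ := z
  obtain ⟨P, I, hP, hd, heP⟩ := mem_breveGroup_iff.1 he _ hz
  obtain ⟨θ, A, hq, rfl, hA, hθ⟩ := exists_arbTuple p.1 (a := a) hd.1
  obtain ⟨φ, θ', hτ, hp, -, hi⟩ :=
    (breveGroup_subset_generalizedEquivalences he).2.2.2.2 θ p hq (by rwa [hθ])
  rw [← hgen] at hτ
  obtain ⟨e', he', hs', hi'⟩ := hτ.2 p hp
  rw [hθ] at hs'
  obtain ⟨Q, J, hQ, hd', heQ⟩ := mem_breveGroup_iff.1 (hs he') _ hs'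
  refine ⟨e', he', hs', heP.trans ((Params.eventuallyEq_toMap hP hQ hA hd hd' ?_).trans heQ.symm)⟩
  have hc := (contDiffAt_lift (p := p) hq).continuousAt
  have hc' : Tendsto (fun r : Pt => ((r, θ.val r.1) : Ext)) (𝓝 p) (𝓝 (p, A p.1.1)) := by
    rw [← hθ]; exact hc
  filter_upwards [hi, hi', hc'.eventually heP, hc'.eventually heQ] with r h1 h2 h3 h4
  rw [← hθ, ← h3, ← h4, h1, h2]

end SingularBurgers

theorem mainTheorem5 :
    SingularBurgers.IsEffectiveGeneralizedEquivalenceGroup SingularBurgers.breveGroup ∧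
      SingularBurgers.generated SingularBurgers.breveGroup =
        SingularBurgers.equivalenceGroupoid := by
  refine ⟨⟨⟨SingularBurgers.isPseudogroupOn_breveGroup,
      SingularBurgers.breveGroup_subset_generalizedEquivalences,
    SingularBurgers.generated_breveGroup_eq.trans
      SingularBurgers.generated_generalizedEquivalences_eq.symm⟩,
    fun 𝒢 h𝒢 hs => ?_⟩, SingularBurgers.generated_breveGroup_eq⟩
  exact SingularBurgers.breveGroup_subset_of_generated_eq h𝒢.isPseudogroup hs
    (h𝒢.generated_eq.trans SingularBurgers.generated_generalizedEquivalences_eq)
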